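/- Let $p$ be a prime, $f\ge 1$, $q=p^f$, and let $\mathbb{C}_p$ be the completion of an algebraic closure of $\mathbb{Q}_p$, with the valuation $v_p$ normalized by $v_p(p)=1$. Let $\Psi=\Psi_q\in T+T^2\mathbb{Z}[[T]]$ be the unique power series with $$\sum_{j=0}^{\infty}p^{-j}\,\Psi(p^jT)^{q^j}=T .$$ It converges on all of $\mathbb{C}_p$, and so defines a function $\Psi:\mathbb{C}_p\to\mathbb{C}_p$. We say that $\Psi$ induces a finite map (a possibly ramified covering) of degree $d$ from $X$ to $Y$ if $\Psi(X)\subset Y$, if $\Psi:X\to Y$ is a finite morphism of rigid analytic spaces for which, locally on the target, functions on $X$ form a free module of rank $d$ over functions on $Y$, and if each $a\in Y$ has exactly $d$ preimages in $X$, counted with multiplicity. The map $\Psi$ induces an analytic isomorphism of the disc $\{v_p(x)>-1\}$ onto itself. Moreover, for every $i=0,1,2,\dots$: 1. $\Psi$ induces a (possibly ramified) covering of degree $q^i$ $$\{x\in\mathbb{C}_p : v_p(x)>-i-1\}\longrightarrow\Big\{x\in\mathbb{C}_p : v_p(x)>-\tfrac{q^{i+1}-1}{q-1}\Big\}.$$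 2. $\Psi$ induces a finite map of degree $q^i$ $$\{x\in\mathbb{C}_p : -(i+1)<v_p(x)<-i\}\longrightarrow\Big\{x\in\mathbb{C}_p : -\tfrac{q^{i+1}-1}{q-1}<v_p(x)<-\tfrac{q^i-1}{q-1}\Big\}.$$ 3. $\Psi$ maps the circle $\{v_p(x)=-i-1\}$ into the closed disc $\{v_p(x)\ge-\frac{q^{i+1}-1}{q-1}\}$. Over the open disc it induces a finite map of degree $q^{i+1}-q^i$ $$\Big\{x\in\mathbb{C}_p : v_p(x)=-i-1,\ v_p(\Psi(x))>-\tfrac{q^{i+1}-1}{q-1}\Big\}\longrightarrow\Big\{x\in\mathbb{C}_p : v_p(x)>-\tfrac{q^{i+1}-1}{q-1}\Big\},$$ while each $a$ with $v_p(a)=-\frac{q^{i+1}-1}{q-1}$ has exactly $q^{i+1}$ preimages on the circle, counted with multiplicity. -/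

import Mathlib

namespace CoveringPsi

/-! ### The power series `Ψ_q` -/

noncomputable section Series

open PowerSeries

/-- `φ` lies in `T + T² ℤ⟦T⟧` and satisfies `∑_{j ≥ 0} p^{-j} φ(p^j T)^{q^j} = T` in `ℚ⟦T⟧`,
the sum being convergent for the `T`-adic topology. -/
structure IsPsi (p q : ℕ) (φ : PowerSeries ℤ) : Prop where
  coeff_zero : coeff 0 φ = 0
  coeff_one : coeff 1 φ = 1
  functional_equation : ∀ n : ℕ, ∀ᶠ N : ℕ in Filter.atTop,
    coeff n (∑ j ∈ Finset.range N,
      C (((p : ℚ) ^ j)⁻¹) * (rescale ((p : ℚ) ^ j) (φ.map (Int.castRingHom ℚ))) ^ (q ^ j)) =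
    coeff n (PowerSeries.X : PowerSeries ℚ)

/-- The operator `φ ↦ T - ∑_{j ≥ 1} p^{-j} φ(p^j T)^{q^j}`, written on coefficients (for `φ` without
constant term the `j`-th summand has no terms of degree `n < j`). -/
def psiStep (p q : ℕ) (φ : PowerSeries ℤ) : PowerSeries ℤ :=
  PowerSeries.X -
    PowerSeries.mk fun n => ∑ j ∈ Finset.Icc 1 n, (p : ℤ) ^ (j * (n - 1)) * coeff n (φ ^ (q ^ j))

/-- The power series `Ψ_q`, as the `T`-adic limit of the iterates of the contraction `psiStep`
(see `isPsi_psi` and `IsPsi.eq_psi`: it is the unique solution of the functional equation). -/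
def psi (p q : ℕ) : PowerSeries ℤ :=
  PowerSeries.mk fun n => coeff n ((psiStep p q)^[n] PowerSeries.X)

theorem coeff_pow_eq_zero {φ : PowerSeries ℤ} (h0 : coeff 0 φ = 0) {n k : ℕ} (h : n < k) :
    coeff n (φ ^ k) = 0 := by
  have : (PowerSeries.X : PowerSeries ℤ) ∣ φ := by
    rw [PowerSeries.X_dvd_iff, ← PowerSeries.coeff_zero_eq_constantCoeff_apply, h0]
  exact PowerSeries.X_pow_dvd_iff.1 (pow_dvd_pow_of_dvd this k) n h

theorem coeff_zero_psiStep (p q : ℕ) (φ : PowerSeries ℤ) : coeff 0 (psiStep p q φ) = 0 := by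
  simp [psiStep]

theorem coeff_psiStep_congr (p : ℕ) {q : ℕ} (hq : 2 ≤ q) {φ χ : PowerSeries ℤ}
    (hφ : coeff 0 φ = 0) (hχ : coeff 0 χ = 0) {m : ℕ} (h : ∀ n < m, coeff n φ = coeff n χ) :
    ∀ n < m + 1, coeff n (psiStep p q φ) = coeff n (psiStep p q χ) := by
  intro n hn
  simp only [psiStep, map_sub, PowerSeries.coeff_mk]
  congr 1
  refine Finset.sum_congr rfl fun j hj => ?_
  congr 1
  rw [← sub_eq_zero, ← map_sub]
  have hj1 : 1 ≤ j := (Finset.mem_Icc.1 hj).1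
  obtain ⟨l, hl⟩ : ∃ l, q ^ j = l + 2 := by
    have : q ^ 1 ≤ q ^ j := Nat.pow_le_pow_right (by omega) hj1
    rw [pow_one] at this
    exact ⟨q ^ j - 2, by omega⟩
  have hd : (PowerSeries.X : PowerSeries ℤ) ^ m ∣ φ - χ := by
    rw [PowerSeries.X_pow_dvd_iff]
    intro k hk
    rw [map_sub, h k hk, sub_self]
  have hXφ : (PowerSeries.X : PowerSeries ℤ) ∣ φ := by
    rw [PowerSeries.X_dvd_iff, ← PowerSeries.coeff_zero_eq_constantCoeff_apply, hφ]
  have hXχ : (PowerSeries.X : PowerSeries ℤ) ∣ χ := by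
    rw [PowerSeries.X_dvd_iff, ← PowerSeries.coeff_zero_eq_constantCoeff_apply, hχ]
  have key : (PowerSeries.X : PowerSeries ℤ) ^ (m + 1) ∣ φ ^ (l + 2) - χ ^ (l + 2) := by
    have e : φ ^ (l + 2) - χ ^ (l + 2) =
        (φ ^ (l + 1) - χ ^ (l + 1)) * φ + (φ - χ) * χ ^ (l + 1) := by ring
    rw [e, pow_succ]
    exact dvd_add (mul_dvd_mul (hd.trans (sub_dvd_pow_sub_pow _ _ _)) hXφ)
      (mul_dvd_mul hd (hXχ.trans (dvd_pow_self _ (by omega))))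
  rw [hl]
  exact PowerSeries.X_pow_dvd_iff.1 key n hn

theorem coeff_zero_iterate (p q k : ℕ) :
    coeff 0 ((psiStep p q)^[k] PowerSeries.X) = 0 := by
  cases k with
  | zero => simp
  | succ k => rw [Function.iterate_succ_apply', coeff_zero_psiStep]

theorem coeff_zero_psi (p q : ℕ) : coeff 0 (psi p q) = 0 := by
  simp [psi]

theorem psiStep_psi (p : ℕ) {q : ℕ} (hq : 2 ≤ q) : psiStep p q (psi p q) = psi p q := by
  have stab : ∀ k, ∀ n < k + 1, coeff n ((psiStep p q)^[k + 1] PowerSeries.X) =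
      coeff n ((psiStep p q)^[k] PowerSeries.X) := by
    intro k
    induction k with
    | zero =>
      intro n hn
      obtain rfl : n = 0 := by omega
      rw [coeff_zero_iterate, coeff_zero_iterate]
    | succ k ih =>
      rw [Function.iterate_succ_apply' _ (k + 1), Function.iterate_succ_apply' _ k]
      refine coeff_psiStep_congr p hq ?_ (coeff_zero_iterate p q k) ?_
      · rw [← Function.iterate_succ_apply' (psiStep p q) k]
        exact coeff_zero_iterate p q (k + 1)
      · rw [← Function.iterate_succ_apply' (psiStep p q) k]
        exact ih
  have stab' : ∀ n k, coeff n ((psiStep p q)^[n + k] PowerSeries.X) = coeff n (psi p q) := by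
    intro n k
    induction k with
    | zero => simp [psi]
    | succ k ih => rw [← ih, ← stab (n + k) n (by omega)]; rfl
  ext n
  rw [← stab' n 1, Function.iterate_succ_apply']
  refine coeff_psiStep_congr p hq (coeff_zero_psi p q) (coeff_zero_iterate p q n)
    (m := n) (fun k hk => ?_) n (by omega)
  obtain ⟨d, rfl⟩ := Nat.exists_eq_add_of_lt hk
  rw [add_assoc, stab']

/-- For series without constant term, the functional equation says that `φ` is fixed by
`psiStep`. -/
theorem functional_equation_iff {p q : ℕ} (hp : p ≠ 0) (hq : 2 ≤ q) {φ : PowerSeries ℤ}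
    (h0 : coeff 0 φ = 0) :
    (∀ n : ℕ, ∀ᶠ N : ℕ in Filter.atTop,
      coeff n (∑ j ∈ Finset.range N,
        C (((p : ℚ) ^ j)⁻¹) * (rescale ((p : ℚ) ^ j) (φ.map (Int.castRingHom ℚ))) ^ (q ^ j)) =
      coeff n (PowerSeries.X : PowerSeries ℚ)) ↔ psiStep p q φ = φ := by
  have hp' : (p : ℚ) ≠ 0 := by exact_mod_cast hp
  have hterm : ∀ n j : ℕ, coeff n (C (((p : ℚ) ^ j)⁻¹) *
      (rescale ((p : ℚ) ^ j) (φ.map (Int.castRingHom ℚ))) ^ (q ^ j)) =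
      ((p : ℚ) ^ j)⁻¹ * (((p : ℚ) ^ j) ^ n * ((coeff n (φ ^ (q ^ j)) : ℤ) : ℚ)) := by
    intro n j
    rw [PowerSeries.coeff_C_mul, ← map_pow, PowerSeries.coeff_rescale, ← map_pow,
      PowerSeries.coeff_map]
    simp
  have hsum : ∀ n N : ℕ, n + 1 ≤ N → coeff n (∑ j ∈ Finset.range N,
        C (((p : ℚ) ^ j)⁻¹) * (rescale ((p : ℚ) ^ j) (φ.map (Int.castRingHom ℚ))) ^ (q ^ j)) =
      ((coeff n φ + ∑ j ∈ Finset.Icc 1 n,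
        (p : ℤ) ^ (j * (n - 1)) * coeff n (φ ^ (q ^ j)) : ℤ) : ℚ) := by
    intro n N hN
    rw [map_sum, Finset.sum_congr rfl (fun j _ => hterm n j)]
    have hsub : Finset.range (n + 1) ⊆ Finset.range N := by
      intro j hj
      simp only [Finset.mem_range] at *
      omega
    rw [← Finset.sum_subset hsub ?_, Finset.sum_range_succ', add_comm]
    · push_cast
      congr 1
      · simp
      · rw [Finset.range_eq_Ico, Finset.sum_Ico_add' (fun j => ((p : ℚ) ^ j)⁻¹ *
          (((p : ℚ) ^ j) ^ n * ((coeff n (φ ^ (q ^ j)) : ℤ) : ℚ))) 0 n 1]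
        refine Finset.sum_congr (by ext; simp [Finset.mem_Ico, Finset.mem_Icc])
          fun j hj => ?_
        have hj' := Finset.mem_Icc.1 hj
        obtain ⟨m, rfl⟩ : ∃ m, n = m + 1 := ⟨n - 1, by omega⟩
        rw [← mul_assoc]
        congr 1
        rw [pow_succ, Nat.add_sub_cancel, pow_mul]
        field_simp
    · intro j _ hj
      rw [coeff_pow_eq_zero h0]
      · simp
      · have h1 : j < q ^ j := Nat.lt_pow_self (by omega)
        simp only [Finset.mem_range] at hj
        omega
  constructor
  · intro h
    ext n
    obtain ⟨N, hN, hN'⟩ := ((h n).and (Filter.eventually_ge_atTop (n + 1))).exists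
    rw [hsum n N hN', PowerSeries.coeff_X] at hN
    simp only [psiStep, map_sub, PowerSeries.coeff_mk, PowerSeries.coeff_X]
    have : coeff n φ + ∑ j ∈ Finset.Icc 1 n,
        (p : ℤ) ^ (j * (n - 1)) * coeff n (φ ^ (q ^ j)) = if n = 1 then 1 else 0 := by
      exact_mod_cast hN
    rw [← this]
    ring
  · intro h n
    filter_upwards [Filter.eventually_ge_atTop (n + 1)] with N hN
    rw [hsum n N hN, PowerSeries.coeff_X]
    have := congrArg (coeff n) h
    simp only [psiStep, map_sub, PowerSeries.coeff_mk, PowerSeries.coeff_X] at this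
    rw [← this]
    push_cast
    ring

/-- `Ψ_q` solves the functional equation. -/
theorem isPsi_psi {p q : ℕ} (hp : p ≠ 0) (hq : 2 ≤ q) : IsPsi p q (psi p q) where
  coeff_zero := coeff_zero_psi p q
  coeff_one := by
    rw [← psiStep_psi p hq]
    simp only [psiStep, map_sub, PowerSeries.coeff_mk, PowerSeries.coeff_one_X]
    simp [coeff_pow_eq_zero (coeff_zero_psi p q) (show 1 < q by omega)]
  functional_equation :=
    (functional_equation_iff hp hq (coeff_zero_psi p q)).2 (psiStep_psi p hq)

/-- `Ψ_q` is the only solution of the functional equation. -/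
theorem IsPsi.eq_psi {p q : ℕ} (hp : p ≠ 0) (hq : 2 ≤ q) {φ : PowerSeries ℤ}
    (h : IsPsi p q φ) : φ = psi p q := by
  have hφ := (functional_equation_iff hp hq h.coeff_zero).1 h.functional_equation
  have : ∀ m, ∀ n < m, coeff n φ = coeff n (psi p q) := by
    intro m
    induction m with
    | zero => intro n hn; omega
    | succ m ih =>
      have := coeff_psiStep_congr p hq h.coeff_zero (coeff_zero_psi p q) ih
      rwa [hφ, psiStep_psi p hq] at this
  ext n
  exact this (n + 1) n (by omega)

end Series

/-! ### Analytic geometry on the affine line over `ℂ_p` -/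

noncomputable section

variable (p : ℕ) [Fact p.Prime]

/-- The function `x ↦ Ψ_q(x)` on `ℂ_p`. -/
def psiFun (q : ℕ) (x : ℂ_[p]) : ℂ_[p] :=
  ∑' n : ℕ, ((PowerSeries.coeff n (psi p q) : ℤ) : ℂ_[p]) * x ^ n

variable {p}

open Classical in
/-- The valuation `v_p` of `ℂ_p`, with `v_p(p) = 1` and `v_p(0) = +∞`. -/
def vp (x : ℂ_[p]) : EReal :=
  if x = 0 then ⊤ else ((-Real.logb p ‖x‖ : ℝ) : EReal)

variable (p) in
/-- The set of all `x ∈ ℂ_p` with `v_p(x) ∈ J`: a disc centred at `0` if `J` is an interval with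
right end point `+∞ ∈ J`, an annulus or a circle if `J` is a bounded interval of real numbers. -/
def shell (J : Set EReal) : Set ℂ_[p] := {x | vp x ∈ J}

/-- The intervals `[s, +∞]` and `[s, t]` with `s, t ∈ ℚ`. Their shells are the closed discs and the
closed annuli with centre `0` and radii in `|ℂ_p^×|`. -/
def IsClosedRationalInterval (K : Set EReal) : Prop :=
  ∃ s : ℚ, K = Set.Icc (((s : ℝ)) : EReal) ⊤ ∨
    ∃ t : ℚ, K = Set.Icc (((s : ℝ)) : EReal) ((t : ℝ) : EReal)

/-- `U` is an affinoid subset of the affine line, presented as a Laurent domain in a closed disc: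
it is cut out in `v_p(x) ≥ r` by finitely many conditions `v_p(P(x)) ≥ s` and `v_p(P(x)) ≤ t`, with
polynomials `P` and rational `r, s, t`. -/
def IsAffinoid (U : Set ℂ_[p]) : Prop :=
  ∃ (r : ℚ) (A B : Finset (Polynomial ℂ_[p] × ℚ)),
    U = {x | ((r : ℝ) : EReal) ≤ vp x ∧
      (∀ a ∈ A, ((a.2 : ℝ) : EReal) ≤ vp (a.1.eval x)) ∧
      (∀ b ∈ B, vp (b.1.eval x) ≤ ((b.2 : ℝ) : EReal))}

/-- For an affinoid `U` in the affine line: the restriction of `g` to `U` is an element of the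
affinoid algebra `𝒪(U)`, i.e. a uniform limit on `U` of rational functions without poles in `U`. -/
def IsRigidOn (g : ℂ_[p] → ℂ_[p]) (U : Set ℂ_[p]) : Prop :=
  ∀ ε : ℝ, 0 < ε → ∃ P Q : Polynomial ℂ_[p], ∀ x ∈ U, Q.eval x ≠ 0 ∧ ‖g x - P.eval x / Q.eval x‖ < ε

/-- `g` is a rigid analytic function on the disc or annulus `v_p(x) ∈ J`: it is so on every closed
disc and closed annulus with centre `0` contained in it. -/
def IsRigidOnShell (g : ℂ_[p] → ℂ_[p]) (J : Set EReal) : Prop :=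
  ∀ K : Set EReal, IsClosedRationalInterval K → K ⊆ J → IsRigidOn g (shell p K)

/-- `f` induces a map of affinoids `U → V` for which `𝒪(U)` is a free module of rank `d` over `𝒪(V)`,
the module structure being given by the pull-back `c ↦ c ∘ f`. -/
structure IsFreeOfRank (f : ℂ_[p] → ℂ_[p]) (U V : Set ℂ_[p]) (d : ℕ) : Prop where
  mapsTo : Set.MapsTo f U V
  pullback : ∀ c : ℂ_[p] → ℂ_[p], IsRigidOn c V → IsRigidOn (fun x => c (f x)) U
  basis : ∃ e : Fin d → ℂ_[p] → ℂ_[p], (∀ j, IsRigidOn (e j) U) ∧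
    (∀ h : ℂ_[p] → ℂ_[p], IsRigidOn h U → ∃ c : Fin d → ℂ_[p] → ℂ_[p],
      (∀ j, IsRigidOn (c j) V) ∧ ∀ x ∈ U, h x = ∑ j, c j (f x) * e j x) ∧
    (∀ c : Fin d → ℂ_[p] → ℂ_[p], (∀ j, IsRigidOn (c j) V) →
      (∀ x ∈ U, ∑ j, c j (f x) * e j x = 0) → ∀ j, ∀ y ∈ V, c j y = 0)

/-- The fibre of `f` in `X` over `a` consists of exactly `d` points, counted with multiplicity (the
multiplicity of `x` is the order of vanishing of `f - a` at `x`). -/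
def HasFibreDegree (f : ℂ_[p] → ℂ_[p]) (X : Set ℂ_[p]) (a : ℂ_[p]) (d : ℕ) : Prop :=
  ∃ S : Finset ℂ_[p], (∀ x, x ∈ S ↔ x ∈ X ∧ f x = a) ∧
    ∑ x ∈ S, analyticOrderAt (fun z => f z - a) x = (d : ℕ∞)

/-- `f` induces a finite analytic map of degree `d`, in other words a (possibly ramified) covering of
degree `d`, from `X` to the disc or annulus `v_p ∈ J`.

Finiteness is local on the target: every closed disc or annulus in the target is contained in a
closed disc or annulus `V` in the target whose preimage `U` in `X` is an affinoid such that `𝒪(U)` is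
finite free over `𝒪(V)`, of rank `d`. Moreover all fibres have `d` points counted with
multiplicity. -/
structure IsFiniteOfDegree (f : ℂ_[p] → ℂ_[p]) (X : Set ℂ_[p]) (J : Set EReal) (d : ℕ) : Prop where
  mapsTo : Set.MapsTo f X (shell p J)
  finite : ∀ K : Set EReal, IsClosedRationalInterval K → K ⊆ J →
    ∃ K' : Set EReal, IsClosedRationalInterval K' ∧ K ⊆ K' ∧ K' ⊆ J ∧
      IsAffinoid (X ∩ f ⁻¹' shell p K') ∧ IsFreeOfRank f (X ∩ f ⁻¹' shell p K') (shell p K') d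
  fibres : ∀ a ∈ shell p J, HasFibreDegree f X a d

/-- `f` induces an analytic isomorphism from the disc or annulus `v_p ∈ I` onto the disc or annulus
`v_p ∈ J`. -/
def IsAnalyticIso (f : ℂ_[p] → ℂ_[p]) (I J : Set EReal) : Prop :=
  IsRigidOnShell f I ∧ ∃ g : ℂ_[p] → ℂ_[p], IsRigidOnShell g J ∧
    Set.MapsTo f (shell p I) (shell p J) ∧ Set.MapsTo g (shell p J) (shell p I) ∧
    Set.LeftInvOn g f (shell p I) ∧ Set.RightInvOn g f (shell p J)

/-- The real number `-(q^n - 1)/(q - 1)`. -/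
def psiBound (q n : ℕ) : ℝ := -(((q : ℝ) ^ n - 1) / ((q : ℝ) - 1))

end

end CoveringPsi

/-!
Write `b_k = 1 + q + … + q ^ (k - 1)`. The theorem reads off the Newton polygon of `Ψ`, whose
vertices lie over the degrees `q ^ i`, and the reduction of `Ψ` at the critical radii `p ^ (i + 1)`.

*Integrality.* The rescaled series `F_k = p ^ b_k Ψ(T / p ^ k)` has integral coefficients, and
`F_k ≡ ± (T ^ (q ^ (k - 1)) - T ^ (q ^ k))` modulo `p` for `k ≥ 1` (`exists_isRescaledPsi`,
`IsRescaledPsi.map_eq`). Indeed the functional equation of `Ψ`, rescaled by `p ^ k`, has the terms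
`p ^ (b_j - j) F_{k - j} ^ (q ^ j)` for `j ≤ k` and terms divisible by `p` for `j > k`; since
`b_j > j` for `j ≥ 2`, it becomes `F_k ≡ - F_{k - 1} ^ q` modulo `p` as soon as `k ≥ 2`. Both the
bound on all coefficients and the exact size of the coefficient of degree `q ^ i` follow, so that on
the radii strictly between `p ^ i` and `p ^ (i + 1)` the term of degree `q ^ i` dominates
(`norm_psiFun_sub_le`).

*Freeness.* If `f` differs from a monomial `α (x - β) ^ d` by less than the monomial, on a disc or an
annulus `U`, then `f` maps `U` to the disc or annulus `V` predicted by the monomial, and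
`1, x - β, …, (x - β) ^ (d - 1)` is a basis of `𝒪(U)` over `𝒪(V)` (`IsNearMonomial.hasFreeBasis`). For
the monomial itself this is the decomposition of Laurent polynomials by the residue of the exponent
modulo `d`; the decomposition is compatible with norms, and so survives the perturbation by
successive approximation.

*Fibres.* Multiplication by `x - β` on the free module has a characteristic polynomial over `𝒪(V)`.
Over a point `a ∈ V` it specialises to a polynomial of degree `d`, whose roots are the
points of the fibre, with the order of vanishing of `f - a` as multiplicity
(`HasFreeBasis.exists_fibre`).

*Critical circles.* For `x = t / p ^ (i + 1)` with `‖t‖ = 1`, `p ^ b_{i + 1} Ψ(x)` is congruent to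
`± (t - t ^ q) ^ (q ^ i)` modulo `p`, since `q`-th powers are additive modulo `p`. The equation
`t - t ^ q = b` has `q` solutions, pairwise at distance `1` (`exists_roots`). In a smaller disc around
each of them `Ψ`, up to a constant, is close to a monomial of degree `q ^ i`
(`IsCircleSign.isNearMonomial`), so the preimage of a disc is a disjoint union of discs, one for each
solution of norm `1`. There are `q - 1` of these for `b = 0`, which is the case over the open disc,
and `q` for `‖b‖ = 1`, which is the case over its boundary.
-/


/-! ### Uniform limits of rational functions -/

namespace CoveringPsi

open Polynomial Filter Topology

section Ultrametric

variable {E : Type*} [SeminormedAddCommGroup E] [IsUltrametricDist E]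

theorem ultra_add_le {x y : E} {M : ℝ} (hx : ‖x‖ ≤ M) (hy : ‖y‖ ≤ M) : ‖x + y‖ ≤ M :=
  (IsUltrametricDist.norm_add_le_max x y).trans (max_le hx hy)

theorem ultra_sub_le {x y : E} {M : ℝ} (hx : ‖x‖ ≤ M) (hy : ‖y‖ ≤ M) : ‖x - y‖ ≤ M :=
  sub_eq_add_neg x y ▸ ultra_add_le hx (norm_neg y ▸ hy)

theorem ultra_add_lt {x y : E} {M : ℝ} (hx : ‖x‖ < M) (hy : ‖y‖ < M) : ‖x + y‖ < M :=
  (IsUltrametricDist.norm_add_le_max x y).trans_lt (max_lt hx hy)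

theorem ultra_sub_lt {x y : E} {M : ℝ} (hx : ‖x‖ < M) (hy : ‖y‖ < M) : ‖x - y‖ < M :=
  sub_eq_add_neg x y ▸ ultra_add_lt hx (norm_neg y ▸ hy)

theorem ultra_sum_le {ι : Type*} {s : Finset ι} {g : ι → E} {M : ℝ} (hM : 0 ≤ M)
    (h : ∀ i ∈ s, ‖g i‖ ≤ M) : ‖∑ i ∈ s, g i‖ ≤ M :=
  IsUltrametricDist.norm_sum_le_of_forall_le_of_nonneg hM h

theorem ultra_trans_lt {x y z : E} {M : ℝ} (hx : ‖x - y‖ < M) (hy : ‖y - z‖ < M) : ‖x - z‖ < M := by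
  simpa using ultra_add_lt hx hy

theorem ultra_trans_le {x y z : E} {M : ℝ} (hx : ‖x - y‖ ≤ M) (hy : ‖y - z‖ ≤ M) :
    ‖x - z‖ ≤ M := by
  simpa using ultra_add_le hx hy

theorem ultra_norm_eq_of_sub_lt {x y : E} (h : ‖x - y‖ < ‖y‖) : ‖x‖ = ‖y‖ := by
  have := IsUltrametricDist.norm_add_eq_max_of_norm_ne_norm h.ne
  rw [sub_add_cancel, max_eq_right h.le] at this
  exact this

theorem ultra_norm_sub_eq_left {x y : E} (h : ‖y‖ < ‖x‖) : ‖x - y‖ = ‖x‖ := by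
  apply ultra_norm_eq_of_sub_lt
  rwa [sub_sub_cancel_left, norm_neg]

end Ultrametric

variable {K : Type*} [NontriviallyNormedField K]

/-- `g` is, on `U`, a uniform limit of rational functions `P / Q` without poles in `U` and with
denominators `Q` in `D`. Denominators are restricted in order to express expansions: with `D` the
powers of `X - β` these are limits of Laurent polynomials in `x - β`. -/
def ApproxOn (D : Submonoid K[X]) (g : K → K) (U : Set K) : Prop :=
  ∀ ε : ℝ, 0 < ε → ∃ P : K[X], ∃ Q ∈ D, ∀ x ∈ U,
    Q.eval x ≠ 0 ∧ ‖g x - P.eval x / Q.eval x‖ < ε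

/-- The elements of the affinoid algebra of `U`: uniform limits of rational functions without
poles. -/
abbrev RigidOn (g : K → K) (U : Set K) : Prop := ApproxOn ⊤ g U

namespace ApproxOn

variable {D : Submonoid K[X]} {g h : K → K} {U : Set K}

theorem mono (hg : ApproxOn D g U) {V : Set K} (hV : V ⊆ U) : ApproxOn D g V := by
  intro ε hε
  obtain ⟨P, Q, hQ, H⟩ := hg ε hε
  exact ⟨P, Q, hQ, fun x hx => H x (hV hx)⟩

theorem congr (hg : ApproxOn D g U) (H : ∀ x ∈ U, g x = h x) : ApproxOn D h U := by
  intro ε hε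
  obtain ⟨P, Q, hQ, H'⟩ := hg ε hε
  exact ⟨P, Q, hQ, fun x hx => H x hx ▸ H' x hx⟩

theorem ratFunc (P : K[X]) {Q : K[X]} (hQ : Q ∈ D) (H : ∀ x ∈ U, Q.eval x ≠ 0) :
    ApproxOn D (fun x => P.eval x / Q.eval x) U := by
  intro ε hε
  exact ⟨P, Q, hQ, fun x hx => ⟨H x hx, by simpa using hε⟩⟩

theorem poly (P : K[X]) : ApproxOn D (fun x => P.eval x) U := by
  refine (ratFunc (D := D) P (Q := 1) D.one_mem (by simp)).congr (by simp)

theorem const (c : K) : ApproxOn D (fun _ => c) U :=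
  (poly (C c)).congr (by simp)

theorem toRigid (hg : ApproxOn D g U) : RigidOn g U := by
  intro ε hε
  obtain ⟨P, Q, _, H⟩ := hg ε hε
  exact ⟨P, Q, trivial, H⟩

variable [IsUltrametricDist K]

theorem of_approx (H : ∀ ε : ℝ, 0 < ε → ∃ g', ApproxOn D g' U ∧ ∀ x ∈ U, ‖g x - g' x‖ < ε) :
    ApproxOn D g U := by
  intro ε hε
  obtain ⟨g', hg', h1⟩ := H ε hε
  obtain ⟨P, Q, hQ, h2⟩ := hg' ε hε
  exact ⟨P, Q, hQ, fun x hx => ⟨(h2 x hx).1, ultra_trans_lt (h1 x hx) (h2 x hx).2⟩⟩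

theorem add (hg : ApproxOn D g U) (hh : ApproxOn D h U) : ApproxOn D (fun x => g x + h x) U := by
  intro ε hε
  obtain ⟨P, Q, hQ, h1⟩ := hg ε hε
  obtain ⟨P', Q', hQ', h2⟩ := hh ε hε
  refine ⟨P * Q' + P' * Q, Q * Q', D.mul_mem hQ hQ', fun x hx => ?_⟩
  have a := (h1 x hx).1
  have b := (h2 x hx).1
  refine ⟨by simp [a, b], ?_⟩
  have e : g x + h x - (P * Q' + P' * Q).eval x / (Q * Q').eval x =
      (g x - P.eval x / Q.eval x) + (h x - P'.eval x / Q'.eval x) := by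
    simp only [eval_add, eval_mul]
    field_simp
    ring
  rw [e]
  exact ultra_add_lt (h1 x hx).2 (h2 x hx).2

theorem mul (hg : ApproxOn D g U) (hh : ApproxOn D h U) {M M' : ℝ} (hgM : ∀ x ∈ U, ‖g x‖ ≤ M)
    (hhM : ∀ x ∈ U, ‖h x‖ ≤ M') : ApproxOn D (fun x => g x * h x) U := by
  intro ε hε
  have hM1 : 0 < |M| + 1 := by positivity
  have hM1' : 0 < |M'| + 1 := by positivity
  obtain ⟨P, Q, hQ, h1⟩ := hg (min 1 (ε / (|M'| + 1))) (by positivity)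
  obtain ⟨P', Q', hQ', h2⟩ := hh (ε / (|M| + 1)) (by positivity)
  refine ⟨P * P', Q * Q', D.mul_mem hQ hQ', fun x hx => ?_⟩
  have a := (h1 x hx).1
  have b := (h2 x hx).1
  refine ⟨by simp [a, b], ?_⟩
  have e : g x * h x - (P * P').eval x / (Q * Q').eval x =
      (g x - P.eval x / Q.eval x) * h x + (P.eval x / Q.eval x) * (h x - P'.eval x / Q'.eval x) := by
    simp only [eval_mul]
    field_simp
    ring
  rw [e]
  have hP : ‖P.eval x / Q.eval x‖ ≤ |M| + 1 := by
    have : P.eval x / Q.eval x = g x - (g x - P.eval x / Q.eval x) := by ring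
    rw [this]
    refine ultra_sub_le (((hgM x hx).trans (le_abs_self M)).trans (by linarith)) ?_
    have := ((h1 x hx).2.trans_le (min_le_left _ _)).le
    linarith [abs_nonneg M]
  refine ultra_add_lt ?_ ?_
  · rw [norm_mul]
    have h3 := (h1 x hx).2.trans_le (min_le_right _ _)
    rw [lt_div_iff₀ hM1'] at h3
    refine lt_of_le_of_lt (mul_le_mul_of_nonneg_left ?_ (norm_nonneg _)) h3
    linarith [hhM x hx, le_abs_self M']
  · rw [norm_mul]
    have h3 := (h2 x hx).2
    rw [lt_div_iff₀ hM1] at h3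
    rw [mul_comm]
    exact lt_of_le_of_lt (mul_le_mul_of_nonneg_left hP (norm_nonneg _)) h3

omit [IsUltrametricDist K] in
theorem const_mul (hg : ApproxOn D g U) (c : K) : ApproxOn D (fun x => c * g x) U := by
  intro ε hε
  obtain ⟨P, Q, hQ, h1⟩ := hg (ε / (‖c‖ + 1)) (by positivity)
  refine ⟨C c * P, Q, hQ, fun x hx => ⟨(h1 x hx).1, ?_⟩⟩
  have e : c * g x - (C c * P).eval x / Q.eval x = c * (g x - P.eval x / Q.eval x) := by
    simp only [eval_mul, eval_C]
    ring
  have h3 := (h1 x hx).2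
  rw [lt_div_iff₀ (by positivity)] at h3
  rw [e, norm_mul]
  nlinarith [norm_nonneg c, norm_nonneg (g x - P.eval x / Q.eval x)]

theorem sub (hg : ApproxOn D g U) (hh : ApproxOn D h U) : ApproxOn D (fun x => g x - h x) U :=
  (hg.add (hh.const_mul (-1))).congr (fun x _ => by ring)

theorem sum {ι : Type*} (s : Finset ι) {g : ι → K → K} (hg : ∀ i ∈ s, ApproxOn D (g i) U) :
    ApproxOn D (fun x => ∑ i ∈ s, g i x) U := by
  classical
  induction s using Finset.induction_on with
  | empty => exact (const 0).congr (by simp)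
  | insert a s ha ih =>
    refine ((hg a (by simp)).add (ih fun i hi => hg i (by simp [hi]))).congr fun x _ => ?_
    rw [Finset.sum_insert ha]

theorem pow (hg : ApproxOn D g U) {M : ℝ} (hgM : ∀ x ∈ U, ‖g x‖ ≤ M) (n : ℕ) :
    ApproxOn D (fun x => g x ^ n) U := by
  induction n with
  | zero => exact (const 1).congr (by simp)
  | succ n ih =>
    refine (ih.mul hg (M := M ^ n) (M' := M) (fun x hx => ?_) hgM).congr fun x _ => by ring
    rw [norm_pow]
    exact pow_le_pow_left₀ (norm_nonneg _) (hgM x hx) n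

/-- Inverses of functions bounded away from `0`. -/
theorem inv (hg : RigidOn g U) {δ : ℝ} (hδ : 0 < δ) (hgδ : ∀ x ∈ U, δ ≤ ‖g x‖) :
    RigidOn (fun x => (g x)⁻¹) U := by
  intro ε hε
  obtain ⟨P, Q, -, h1⟩ := hg (min δ (ε * (δ * δ))) (by positivity)
  refine ⟨Q, P, trivial, fun x hx => ?_⟩
  have hQ := (h1 x hx).1
  have h2 := ((h1 x hx).2.trans_le (min_le_left _ _)).trans_le (hgδ x hx)
  have h3 : ‖P.eval x / Q.eval x‖ = ‖g x‖ := by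
    rw [norm_sub_rev] at h2
    exact ultra_norm_eq_of_sub_lt h2
  have hg0 : g x ≠ 0 := fun h0 => by
    have := hgδ x hx
    rw [h0, norm_zero] at this
    linarith
  have hP : P.eval x ≠ 0 := fun h0 => by
    rw [h0, zero_div, norm_zero] at h3
    exact hg0 (norm_eq_zero.1 h3.symm)
  refine ⟨hP, ?_⟩
  have e : (g x)⁻¹ - Q.eval x / P.eval x =
      -((g x - P.eval x / Q.eval x) / (g x * (P.eval x / Q.eval x))) := by
    field_simp
    ring
  rw [e, norm_neg, norm_div, norm_mul, h3]
  have h4 : δ * δ ≤ ‖g x‖ * ‖g x‖ := mul_self_le_mul_self hδ.le (hgδ x hx)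
  rw [div_lt_iff₀ (by positivity)]
  refine ((h1 x hx).2.trans_le (min_le_right _ _)).trans_le ?_
  exact mul_le_mul_of_nonneg_left h4 hε.le

theorem continuousWithinAt (hg : ApproxOn D g U) {x : K} (hx : x ∈ U) :
    ContinuousWithinAt g U x := by
  rw [Metric.continuousWithinAt_iff]
  intro ε hε
  obtain ⟨P, Q, -, h1⟩ := hg ε hε
  have hc : ContinuousAt (fun x => P.eval x / Q.eval x) x :=
    P.continuous.continuousAt.div Q.continuous.continuousAt (h1 x hx).1
  obtain ⟨δ, hδ, h2⟩ := Metric.continuousAt_iff.1 hc ε hε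
  refine ⟨δ, hδ, fun y hy hyx => ?_⟩
  have h3 := h2 hyx
  rw [dist_eq_norm] at h3 ⊢
  have h4 := (h1 x hx).2
  rw [norm_sub_rev] at h4
  exact ultra_trans_lt (h1 y hy).2 (ultra_trans_lt h3 h4)

end ApproxOn

/-! ### Laurent expansions on annuli -/

/-- The closed annulus with centre `β` and radii `r₁ ≤ r₂`; for `r₁ = 0` it is a closed disc. -/
def annulus (β : K) (r₁ r₂ : ℝ) : Set K := {x | r₁ ≤ ‖x - β‖ ∧ ‖x - β‖ ≤ r₂}

theorem exists_norm_eval_le [IsUltrametricDist K] (P : K[X]) (β : K) (r : ℝ) :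
    ∃ M : ℝ, ∀ x, ‖x - β‖ ≤ r → ‖P.eval x‖ ≤ M := by
  have hx : ∀ x, ‖x - β‖ ≤ r → ‖x‖ ≤ max r ‖β‖ := fun x h => by
    have := IsUltrametricDist.norm_add_le_max (x - β) β
    rw [sub_add_cancel] at this
    exact this.trans (max_le_max_right _ h)
  induction P using Polynomial.induction_on' with
  | add P Q hP hQ =>
    obtain ⟨M, hM⟩ := hP
    obtain ⟨M', hM'⟩ := hQ
    refine ⟨max M M', fun x h => ?_⟩
    rw [eval_add]
    exact ultra_add_le ((hM x h).trans (le_max_left _ _)) ((hM' x h).trans (le_max_right _ _))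
  | monomial n a =>
    refine ⟨‖a‖ * (max r ‖β‖) ^ n, fun x h => ?_⟩
    rw [eval_monomial, norm_mul, norm_pow]
    have := hx x h
    gcongr

/-- The denominators of Laurent polynomials in `x - β` (of polynomials, if `r₁ = 0`). -/
noncomputable def laurentDenoms (β : K) (r₁ : ℝ) : Submonoid K[X] :=
  open Classical in Submonoid.powers (if 0 < r₁ then X - C β else 1)

theorem mem_laurentDenoms {β : K} {r₁ : ℝ} {Q : K[X]} (hQ : Q ∈ laurentDenoms β r₁) :
    ∃ N : ℕ, (N = 0 ∨ 0 < r₁) ∧ Q = (X - C β) ^ N := by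
  obtain ⟨N, rfl⟩ := hQ
  by_cases h : 0 < r₁
  · exact ⟨N, Or.inr h, by simp [h]⟩
  · exact ⟨0, Or.inl rfl, by simp [h]⟩

theorem exists_bound_of_approxOn_annulus [IsUltrametricDist K] {β : K} {r₁ r₂ : ℝ} {g : K → K}
    (hg : ApproxOn (laurentDenoms β r₁) g (annulus β r₁ r₂)) :
    ∃ M : ℝ, 0 < M ∧ ∀ x ∈ annulus β r₁ r₂, ‖g x‖ ≤ M := by
  obtain ⟨P, Q, hQ, h1⟩ := hg 1 one_pos
  obtain ⟨N, hN, rfl⟩ := mem_laurentDenoms hQ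
  obtain ⟨M, hM⟩ := exists_norm_eval_le P β r₂
  refine ⟨max 1 (M * (r₁ ^ N)⁻¹), by positivity, fun x hx => ?_⟩
  have e : g x = (g x - P.eval x / ((X - C β) ^ N).eval x) + P.eval x / ((X - C β) ^ N).eval x := by
    ring
  rw [e]
  refine ultra_add_le ((h1 x hx).2.le.trans (le_max_left _ _)) (le_trans ?_ (le_max_right _ _))
  have hMx := hM x hx.2
  have hM0 : 0 ≤ M := (norm_nonneg _).trans hMx
  rw [norm_div, div_eq_mul_inv, eval_pow, eval_sub, eval_X, eval_C, norm_pow]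
  rcases hN with rfl | hr
  · simpa using hMx
  · have := hx.1
    gcongr

variable [IsUltrametricDist K]

theorem tendsto_geom_error {a b c : ℝ} (ha : 0 ≤ a) (hab : a < b) (hc : 0 < c) {ε : ℝ}
    (hε : 0 < ε) : ∃ N : ℕ, (a / b) ^ N / c < ε := by
  have hb : 0 < b := ha.trans_lt hab
  obtain ⟨N, hN⟩ := exists_pow_lt_of_lt_one (mul_pos hε hc) ((div_lt_one hb).2 hab)
  exact ⟨N, (div_lt_iff₀ hc).2 hN⟩

omit [IsUltrametricDist K] in
theorem geom_sub_inv {z w : K} (hw : w ≠ 0) (hzw : z - w ≠ 0) (N : ℕ) :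
    (z - w)⁻¹ - ∑ k ∈ Finset.range N, -(w⁻¹) ^ (k + 1) * z ^ k = (z / w) ^ N / (z - w) := by
  induction N with
  | zero => simp
  | succ N ih =>
    rw [Finset.sum_range_succ, ← sub_sub, ih]
    simp only [inv_pow, div_pow]
    field_simp
    ring

theorem approxOn_inv_sub {β : K} {r₁ r₂ : ℝ} (hr : 0 ≤ r₁) (γ : K) (hγ : γ ∉ annulus β r₁ r₂) :
    ApproxOn (laurentDenoms β r₁) (fun x => (x - γ)⁻¹) (annulus β r₁ r₂) := by
  by_cases hempty : r₁ ≤ r₂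
  swap
  · intro ε _
    exact ⟨0, 1, one_mem _, fun x hx => absurd (hx.1.trans hx.2) hempty⟩
  rcases lt_or_ge r₂ ‖γ - β‖ with h | h
  · -- expansion in powers of `(x - β) / (γ - β)`
    have hw : γ - β ≠ 0 := norm_pos_iff.1 ((hr.trans hempty).trans_lt h)
    have hwp := norm_pos_iff.2 hw
    refine ApproxOn.of_approx fun ε hε => ?_
    obtain ⟨N, hN⟩ := tendsto_geom_error (hr.trans hempty) h hwp hε
    refine ⟨_, ApproxOn.poly (∑ k ∈ Finset.range N, C (-((γ - β)⁻¹) ^ (k + 1)) * (X - C β) ^ k),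
      fun x hx => ?_⟩
    have hn : ‖(x - β) - (γ - β)‖ = ‖γ - β‖ := by
      rw [norm_sub_rev]
      exact ultra_norm_sub_eq_left (hx.2.trans_lt h)
    have hn0 : (x - β) - (γ - β) ≠ 0 := norm_pos_iff.1 (hn ▸ hwp)
    have e := geom_sub_inv hw hn0 N
    simp only [eval_finsetSum, eval_mul, eval_C, eval_pow, eval_sub, eval_X]
    rw [show x - γ = (x - β) - (γ - β) by ring, e, norm_div, norm_pow, norm_div, hn]
    refine lt_of_le_of_lt ?_ hN
    have := hx.2
    gcongr
  · -- expansion in powers of `(γ - β) / (x - β)`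
    have h' : ‖γ - β‖ < r₁ := by
      by_contra hc
      exact hγ ⟨not_lt.1 hc, h⟩
    have hr₁ : 0 < r₁ := (norm_nonneg _).trans_lt h'
    have hx0 : ∀ x ∈ annulus β r₁ r₂, x - β ≠ 0 := fun x hx => norm_pos_iff.1 (hr₁.trans_le hx.1)
    have hinv : ApproxOn (laurentDenoms β r₁) (fun x => (x - β)⁻¹) (annulus β r₁ r₂) := by
      refine (ApproxOn.ratFunc (D := laurentDenoms β r₁) 1 (Q := X - C β) ⟨1, by simp [hr₁]⟩
        fun x hx => by simpa using hx0 x hx).congr fun x _ => by simp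
    have hinvb : ∀ x ∈ annulus β r₁ r₂, ‖(x - β)⁻¹‖ ≤ r₁⁻¹ := fun x hx => by
      rw [norm_inv]
      exact inv_anti₀ hr₁ hx.1
    refine ApproxOn.of_approx fun ε hε => ?_
    obtain ⟨N, hN⟩ := tendsto_geom_error (norm_nonneg _) h' hr₁ hε
    refine ⟨_, ApproxOn.sum (Finset.range N) (g := fun k x => (γ - β) ^ k * ((x - β)⁻¹) ^ (k + 1))
      fun k _ => (hinv.pow hinvb (k + 1)).const_mul _, fun x hx => ?_⟩
    have h1 : ‖γ - β‖ < ‖x - β‖ := h'.trans_le hx.1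
    have hn : ‖(x - β) - (γ - β)‖ = ‖x - β‖ := ultra_norm_sub_eq_left h1
    have hxp := norm_pos_iff.2 (hx0 x hx)
    have hn0 : (x - β) - (γ - β) ≠ 0 := norm_pos_iff.1 (hn ▸ hxp)
    have e : ∀ N : ℕ, ((x - β) - (γ - β))⁻¹ -
        ∑ k ∈ Finset.range N, (γ - β) ^ k * ((x - β)⁻¹) ^ (k + 1) =
        ((γ - β) / (x - β)) ^ N / ((x - β) - (γ - β)) := by
      intro N
      have hxx := hx0 x hx
      induction N with
      | zero => simp
      | succ N ih =>
        rw [Finset.sum_range_succ, ← sub_sub, ih]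
        simp only [inv_pow, div_pow]
        field_simp
        ring
    rw [show x - γ = (x - β) - (γ - β) by ring, e, norm_div, norm_pow, norm_div, hn]
    refine lt_of_le_of_lt ?_ hN
    have := hx.1
    gcongr

variable [IsAlgClosed K]

/-- On a disc or an annulus, rational functions without poles are uniform limits of polynomials or
Laurent polynomials: the partial fractions `1 / (x - γ)` have geometric expansions. -/
theorem approxOn_laurentDenoms {β : K} {r₁ r₂ : ℝ} (hr : 0 ≤ r₁) {g : K → K}
    (hg : RigidOn g (annulus β r₁ r₂)) :
    ApproxOn (laurentDenoms β r₁) g (annulus β r₁ r₂) := by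
  refine ApproxOn.of_approx fun ε hε => ?_
  obtain ⟨P, Q, -, h1⟩ := hg ε hε
  refine ⟨_, ?_, fun x hx => (h1 x hx).2⟩
  have bdd := fun g hg => exists_bound_of_approxOn_annulus (β := β) (r₁ := r₁) (r₂ := r₂) (g := g) hg
  have key : ∀ s : Multiset K, (∀ γ ∈ s, γ ∉ annulus β r₁ r₂) →
      ApproxOn (laurentDenoms β r₁) (fun x => ((s.map fun γ => x - γ).prod)⁻¹)
        (annulus β r₁ r₂) := by
    intro s
    induction s using Multiset.induction_on with
    | empty => exact fun _ => (ApproxOn.const 1).congr (by simp)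
    | cons γ s ih =>
      intro hs
      have a := approxOn_inv_sub (r₂ := r₂) hr γ (hs γ (by simp))
      have b := ih fun γ' hγ' => hs γ' (by simp [hγ'])
      obtain ⟨M, -, hM⟩ := bdd _ a
      obtain ⟨M', -, hM'⟩ := bdd _ b
      exact (a.mul b hM hM').congr fun x _ => by simp [mul_comm]
  have hQ : ApproxOn (laurentDenoms β r₁) (fun x => (Q.eval x)⁻¹) (annulus β r₁ r₂) := by
    refine ((key Q.roots fun γ hγ hγU => (h1 γ hγU).1 (isRoot_of_mem_roots hγ)).const_mul
      (Q.leadingCoeff⁻¹)).congr fun x _ => ?_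
    have e := congrArg (eval x) (IsAlgClosed.splits Q).eq_prod_roots
    rw [eval_mul, eval_C, eval_multiset_prod, Multiset.map_map] at e
    rw [e, mul_inv]
    simp
  have hP : ApproxOn (laurentDenoms β r₁) (fun x => P.eval x) (annulus β r₁ r₂) := ApproxOn.poly P
  obtain ⟨M, -, hM⟩ := bdd _ hQ
  obtain ⟨M', -, hM'⟩ := bdd _ hP
  exact (hP.mul hQ hM' hM).congr fun x _ => (div_eq_mul_inv _ _).symm

theorem RigidOn.exists_bound {β : K} {r₁ r₂ : ℝ} (hr : 0 ≤ r₁) {g : K → K}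
    (hg : RigidOn g (annulus β r₁ r₂)) :
    ∃ M : ℝ, 0 < M ∧ ∀ x ∈ annulus β r₁ r₂, ‖g x‖ ≤ M :=
  exists_bound_of_approxOn_annulus (approxOn_laurentDenoms hr hg)

/-- Approximation by finite Laurent sums in `x - β`, which are polynomials if `r₁ = 0`. -/
theorem RigidOn.exists_laurent {β : K} {r₁ r₂ : ℝ} (hr : 0 ≤ r₁) {g : K → K}
    (hg : RigidOn g (annulus β r₁ r₂)) {ε : ℝ} (hε : 0 < ε) :
    ∃ (F : Finset ℤ) (a : ℤ → K), (∀ n ∈ F, 0 ≤ n ∨ 0 < r₁) ∧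
      ∀ x ∈ annulus β r₁ r₂, ‖g x - ∑ n ∈ F, a n * (x - β) ^ n‖ < ε := by
  obtain ⟨P, Q, hQ, h1⟩ := approxOn_laurentDenoms hr hg ε hε
  obtain ⟨N, hN, rfl⟩ := mem_laurentDenoms hQ
  set P' := P.comp (X + C β) with hP'
  refine ⟨P'.support.image fun k : ℕ => (k : ℤ) - N, fun n => P'.coeff (n + N).toNat, ?_, ?_⟩
  · intro n hn
    obtain ⟨k, -, rfl⟩ := Finset.mem_image.1 hn
    rcases hN with rfl | h
    · left; simp
    · exact Or.inr h
  · intro x hx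
    have h2 := h1 x hx
    rw [Finset.sum_image (by intro a _ b _ h; simpa using h)]
    have hz : (x - β) ^ N ≠ 0 := by simpa using h2.1
    have e : P.eval x = ∑ k ∈ P'.support, P'.coeff k * (x - β) ^ k := by
      have : P.eval x = P'.eval (x - β) := by simp [hP', eval_comp]
      rw [this, eval_eq_sum, Polynomial.sum]
    have e2 : ∑ k ∈ P'.support, P'.coeff ((k : ℤ) - N + N).toNat * (x - β) ^ ((k : ℤ) - N) =
        P.eval x / ((X - C β) ^ N).eval x := by
      rw [e, Finset.sum_div]
      refine Finset.sum_congr rfl fun k _ => ?_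
      simp only [sub_add_cancel, Int.toNat_natCast, eval_pow, eval_sub, eval_X, eval_C]
      rcases hN with rfl | h
      · simp
      · have hz' : x - β ≠ 0 := norm_pos_iff.1 (h.trans_le hx.1)
        rw [zpow_sub₀ hz', zpow_natCast, zpow_natCast, mul_div_assoc]
    rw [e2]
    exact h2.2

omit [IsUltrametricDist K] [IsAlgClosed K] in
theorem rigidOn_zpow {β : K} {r₁ r₂ : ℝ} {n : ℤ} (hn : 0 ≤ n ∨ 0 < r₁) :
    RigidOn (fun x => (x - β) ^ n) (annulus β r₁ r₂) := by
  obtain ⟨n, rfl | rfl⟩ := n.eq_nat_or_neg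
  · exact (ApproxOn.poly ((X - C β) ^ n)).congr (by simp)
  · by_cases h0 : n = 0
    · subst h0
      exact (ApproxOn.const 1).congr (by simp)
    · have hr : 0 < r₁ := hn.resolve_left (by omega)
      refine (ApproxOn.ratFunc (D := ⊤) 1 (Q := (X - C β) ^ n) trivial fun x hx => ?_).congr
        fun x _ => by simp
      simpa using fun h => absurd (norm_pos_iff.1 (hr.trans_le hx.1)) (by simp [h])

end CoveringPsi

namespace CoveringPsi

open Polynomial Filter Topology

variable {K : Type*} [NontriviallyNormedField K] [IsUltrametricDist K] [IsAlgClosed K]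

/-! ### The Cauchy estimate -/

omit [IsAlgClosed K] in
/-- At most one prime has norm `< 1`: two of them would generate the unit ideal. -/
theorem exists_prime_norm_eq_one (B : ℕ) : ∃ l : ℕ, l.Prime ∧ B < l ∧ ‖(l : K)‖ = 1 := by
  obtain ⟨a, ha, hap⟩ := Nat.exists_infinite_primes (B + 1)
  obtain ⟨b, hb, hbp⟩ := Nat.exists_infinite_primes (a + 1)
  by_contra! H
  have h1 := (IsUltrametricDist.norm_natCast_le_one K a).lt_of_ne (H a hap (by omega))
  have h2 := (IsUltrametricDist.norm_natCast_le_one K b).lt_of_ne (H b hbp (by omega))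
  have hco : IsCoprime (a : ℤ) (b : ℤ) :=
    Nat.isCoprime_iff_coprime.2 ((Nat.coprime_primes hap hbp).2 (by omega))
  obtain ⟨u, v, huv⟩ := hco
  have h3 : (u : K) * (a : K) + (v : K) * (b : K) = 1 := by exact_mod_cast congrArg (Int.cast : ℤ → K) huv
  have h4 : ‖(u : K) * (a : K) + (v : K) * (b : K)‖ < 1 := by
    refine ultra_add_lt ?_ ?_
    · rw [norm_mul]
      nlinarith [IsUltrametricDist.norm_intCast_le_one K u, norm_nonneg (a : K), norm_nonneg (u : K)]
    · rw [norm_mul]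
      nlinarith [IsUltrametricDist.norm_intCast_le_one K v, norm_nonneg (b : K), norm_nonneg (v : K)]
  rw [h3, norm_one] at h4
  exact lt_irrefl _ h4

variable [CharZero K]

/-- Each monomial of a Laurent polynomial is an average of the values of the polynomial over
rotations by `l`-th roots of unity; it is bounded like the polynomial if `‖l‖ = 1`. -/
theorem cauchy_estimate {ι : Type*} {s : Finset ι} {φ : ι → ℤ} (hφ : Set.InjOn φ s) {a : ι → K}
    {r₁ r₂ M : ℝ} (H : ∀ z : K, r₁ ≤ ‖z‖ → ‖z‖ ≤ r₂ → ‖∑ i ∈ s, a i * z ^ φ i‖ ≤ M)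
    {i : ι} (hi : i ∈ s) {z : K} (h1 : r₁ ≤ ‖z‖) (h2 : ‖z‖ ≤ r₂) : ‖a i * z ^ φ i‖ ≤ M := by
  obtain ⟨l, hl, hB, hl1⟩ := exists_prime_norm_eq_one (K := K) (∑ j ∈ s, (φ j - φ i).natAbs)
  have : NeZero (l : K) := ⟨by simpa using hl.ne_zero⟩
  obtain ⟨ζ, hζ⟩ := HasEnoughRootsOfUnity.exists_primitiveRoot K l
  have hζ1 : ‖ζ‖ = 1 := (pow_eq_one_iff_of_nonneg (norm_nonneg _) hl.ne_zero).1
    (by rw [← norm_pow, hζ.pow_eq_one, norm_one])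
  have hζ0 : ζ ≠ 0 := norm_ne_zero_iff.1 (by simp [hζ1])
  have hM : 0 ≤ M := (norm_nonneg _).trans (H z h1 h2)
  have key : ∑ k ∈ Finset.range l, (ζ ^ (-φ i)) ^ k * ∑ j ∈ s, a j * (ζ ^ k * z) ^ φ j =
      (l : K) * (a i * z ^ φ i) := by
    have e1 : ∀ j ∈ s, ∑ k ∈ Finset.range l, (ζ ^ (-φ i)) ^ k * (a j * (ζ ^ k * z) ^ φ j) =
        a j * z ^ φ j * ∑ k ∈ Finset.range l, (ζ ^ (φ j - φ i)) ^ k := by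
      intro j _
      rw [Finset.mul_sum]
      refine Finset.sum_congr rfl fun k _ => ?_
      have : (ζ ^ (φ j - φ i)) ^ k = (ζ ^ (-φ i)) ^ k * (ζ ^ k) ^ φ j := by
        rw [sub_eq_neg_add, zpow_add₀ hζ0, mul_pow]
        congr 1
        rw [← zpow_natCast, ← zpow_mul, ← zpow_natCast, ← zpow_mul, mul_comm]
      rw [this, mul_zpow]
      ring
    simp_rw [Finset.mul_sum]
    rw [Finset.sum_comm, Finset.sum_congr rfl e1, Finset.sum_eq_single_of_mem i hi]
    · simp [mul_comm]
    · intro j hj hji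
      have hne : ζ ^ (φ j - φ i) ≠ 1 := by
        rw [Ne, hζ.zpow_eq_one_iff_dvd]
        intro hd
        have h0 : φ j - φ i ≠ 0 := fun h => hji (hφ hj hi (by omega))
        have h3 := Int.natAbs_le_of_dvd_ne_zero hd h0
        have h4 := Finset.single_le_sum (f := fun j => (φ j - φ i).natAbs) (fun _ _ => Nat.zero_le _) hj
        simp only [Int.natAbs_natCast] at h3 h4
        omega
      have h5 : (ζ ^ (φ j - φ i)) ^ l = 1 := by
        rw [← zpow_natCast, ← zpow_mul, mul_comm, zpow_mul, zpow_natCast, hζ.pow_eq_one, one_zpow]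
      rw [geom_sum_eq hne, h5, sub_self, zero_div, mul_zero]
  have h3 : ‖(l : K) * (a i * z ^ φ i)‖ ≤ M := by
    rw [← key]
    refine ultra_sum_le hM fun k _ => ?_
    have hz : ‖ζ ^ k * z‖ = ‖z‖ := by rw [norm_mul, norm_pow, hζ1, one_pow, one_mul]
    rw [norm_mul, norm_pow, norm_zpow, hζ1, one_zpow, one_pow, one_mul]
    exact H _ (hz ▸ h1) (hz ▸ h2)
  rwa [norm_mul, hl1, one_mul] at h3

/-! ### Perturbations of `x ↦ α x ^ d` -/

/-- `f : U → V` makes `𝒪(U)` a free module over `𝒪(V)` with basis `e`. -/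
structure HasFreeBasis (f : K → K) (U V : Set K) {ι : Type*} [Fintype ι] (e : ι → K → K) :
    Prop where
  mapsTo : Set.MapsTo f U V
  pullback : ∀ c : K → K, RigidOn c V → RigidOn (fun x => c (f x)) U
  rigid : ∀ j, RigidOn (e j) U
  span : ∀ h : K → K, RigidOn h U → ∃ c : ι → K → K,
    (∀ j, RigidOn (c j) V) ∧ ∀ x ∈ U, h x = ∑ j, c j (f x) * e j x
  unique : ∀ c : ι → K → K, (∀ j, RigidOn (c j) V) →
    (∀ x ∈ U, ∑ j, c j (f x) * e j x = 0) → ∀ j, ∀ y ∈ V, c j y = 0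

/-- On the annulus or disc with centre `β` and radii `r₁`, `r₂`, the function `f` differs from the
monomial `α (x - β) ^ d` by at most `ε` times that monomial, in the pointwise sense on an annulus
and in the sense of the supremum norm on a disc. -/
structure IsNearMonomial (f : K → K) (β : K) (r₁ r₂ : ℝ) (α : K) (d : ℕ) (ε : ℝ) : Prop where
  rigid : RigidOn f (annulus β r₁ r₂)
  nonneg : 0 ≤ r₁
  exists_norm_eq : ∃ w : K, w ≠ 0 ∧ ‖w‖ = r₂
  coeff_ne_zero : α ≠ 0
  degree_pos : 0 < d
  eps_pos : 0 < ε
  eps_lt_one : ε < 1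
  near : (0 < r₁ ∧ ∀ x ∈ annulus β r₁ r₂, ‖f x - α * (x - β) ^ d‖ ≤ ε * ‖α * (x - β) ^ d‖) ∨
    (r₁ = 0 ∧ ∀ x ∈ annulus β r₁ r₂, ‖f x - α * (x - β) ^ d‖ ≤ ε * (‖α‖ * r₂ ^ d))

omit [IsAlgClosed K] [CharZero K] in
theorem norm_pow_sub_pow_le {a b : K} {R ε : ℝ} (hε : 0 ≤ ε) (ha : ‖a‖ ≤ R) (hb : ‖b‖ ≤ R)
    (hab : ‖a - b‖ ≤ ε * R) (m : ℕ) : ‖a ^ m - b ^ m‖ ≤ ε * R ^ m := by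
  have hR : 0 ≤ R := (norm_nonneg _).trans ha
  induction m with
  | zero => simpa using hε
  | succ m ih =>
    have e : a ^ (m + 1) - b ^ (m + 1) = a ^ m * (a - b) + (a ^ m - b ^ m) * b := by ring
    rw [e]
    refine ultra_add_le ?_ ?_
    · rw [norm_mul, norm_pow]
      calc ‖a‖ ^ m * ‖a - b‖ ≤ R ^ m * (ε * R) := by gcongr
        _ = _ := by ring
    · rw [norm_mul]
      calc ‖a ^ m - b ^ m‖ * ‖b‖ ≤ ε * R ^ m * R := by gcongr
        _ = _ := by ring

omit [IsAlgClosed K] [CharZero K] in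
theorem norm_one_sub_zpow_le {u : K} {ε : ℝ} (hε : 0 ≤ ε) (hε1 : ε < 1) (hu : ‖u - 1‖ ≤ ε) (m : ℤ) :
    ‖1 - u ^ m‖ ≤ ε := by
  have h1 : ‖u‖ = 1 := by
    have := ultra_norm_eq_of_sub_lt (x := u) (y := 1) (by rw [norm_one]; linarith)
    rwa [norm_one] at this
  have hn : ∀ m : ℕ, ‖1 - u ^ m‖ ≤ ε := fun m => by
    have := norm_pow_sub_pow_le (a := u) (b := 1) (R := 1) hε h1.le (by simp) (by simpa using hu) m
    rw [norm_sub_rev]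
    simpa using this
  obtain ⟨m, rfl | rfl⟩ := m.eq_nat_or_neg
  · simpa using hn m
  · have hu0 : u ≠ 0 := norm_ne_zero_iff.1 (by simp [h1])
    have e : 1 - u ^ (-(m : ℤ)) = -((1 - u ^ m) / u ^ m) := by
      rw [zpow_neg, zpow_natCast]
      field_simp
      ring
    rw [e, norm_neg, norm_div, norm_pow, h1, one_pow, div_one]
    exact hn m

namespace IsNearMonomial

variable {f : K → K} {β : K} {r₁ r₂ : ℝ} {α : K} {d : ℕ} {ε : ℝ}

omit [IsUltrametricDist K] [IsAlgClosed K] [CharZero K] in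
theorem radius_pos (H : IsNearMonomial f β r₁ r₂ α d ε) : 0 < r₂ := by
  obtain ⟨w, hw0, hw⟩ := H.exists_norm_eq
  exact hw ▸ norm_pos_iff.2 hw0

omit [IsAlgClosed K] [CharZero K] in
theorem norm_eq (H : IsNearMonomial f β r₁ r₂ α d ε) (hr : 0 < r₁) {x : K}
    (hx : x ∈ annulus β r₁ r₂) : ‖f x‖ = ‖α‖ * ‖x - β‖ ^ d := by
  rcases H.near with ⟨-, h⟩ | ⟨h0, -⟩
  · have hz : x - β ≠ 0 := norm_pos_iff.1 (hr.trans_le hx.1)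
    have hp : 0 < ‖α * (x - β) ^ d‖ :=
      norm_pos_iff.2 (mul_ne_zero H.coeff_ne_zero (pow_ne_zero _ hz))
    rw [← norm_pow, ← norm_mul]
    refine ultra_norm_eq_of_sub_lt ((h x hx).trans_lt ?_)
    nlinarith [H.eps_lt_one]
  · exact absurd h0 hr.ne'

omit [IsAlgClosed K] [CharZero K] in
theorem norm_le (H : IsNearMonomial f β r₁ r₂ α d ε) {x : K}
    (hx : x ∈ annulus β r₁ r₂) : ‖f x‖ ≤ ‖α‖ * r₂ ^ d := by
  have h0 : ‖α * (x - β) ^ d‖ ≤ ‖α‖ * r₂ ^ d := by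
    rw [norm_mul, norm_pow]
    have := hx.2
    gcongr
  have h1 : ‖f x - α * (x - β) ^ d‖ ≤ ‖α‖ * r₂ ^ d := by
    have h2 := H.eps_lt_one
    have h3 := H.eps_pos
    have h4 := (norm_nonneg _).trans h0
    rcases H.near with ⟨-, h⟩ | ⟨-, h⟩
    · nlinarith [h x hx, norm_nonneg (α * (x - β) ^ d)]
    · nlinarith [h x hx]
  simpa using ultra_add_le h1 h0

omit [IsAlgClosed K] [CharZero K] in
theorem mapsTo (H : IsNearMonomial f β r₁ r₂ α d ε) :
    Set.MapsTo f (annulus β r₁ r₂) (annulus 0 (‖α‖ * r₁ ^ d) (‖α‖ * r₂ ^ d)) := by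
  intro x hx
  refine ⟨?_, by simpa using H.norm_le hx⟩
  rw [sub_zero]
  rcases H.nonneg.lt_or_eq with h | h
  · rw [H.norm_eq h hx]
    have := hx.1
    gcongr
  · rw [← h, zero_pow H.degree_pos.ne', mul_zero]
    exact norm_nonneg _

omit [IsAlgClosed K] [CharZero K] in
/-- A monomial in `x - β`, of degree `n = d * m + j`, hardly changes when `(x - β) ^ d` is replaced
by `f x / α`. -/
theorem norm_monomial_sub_le (H : IsNearMonomial f β r₁ r₂ α d ε) {n : ℤ} (hn : 0 ≤ n ∨ 0 < r₁)
    {c : K} {t : ℝ} (ht : ∀ z : K, r₁ ≤ ‖z‖ → ‖z‖ ≤ r₂ → ‖c * z ^ n‖ ≤ t) {x : K}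
    (hx : x ∈ annulus β r₁ r₂) :
    ‖c * (x - β) ^ n - c * ((f x / α) ^ (n / (d : ℤ)) * (x - β) ^ (n % (d : ℤ)))‖ ≤ ε * t := by
  have hα := H.coeff_ne_zero
  have hαn := norm_pos_iff.2 hα
  have hd : (0 : ℤ) < d := by exact_mod_cast H.degree_pos
  rcases H.near with ⟨hr, h⟩ | ⟨h0, h⟩
  · have hz : x - β ≠ 0 := norm_pos_iff.1 (hr.trans_le hx.1)
    set z := x - β with hzdef
    set u := f x / α / z ^ d with hu
    have hu1 : ‖u - 1‖ ≤ ε := by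
      have e : u - 1 = (f x - α * z ^ d) / (α * z ^ d) := by
        rw [hu]
        field_simp
      rw [e, norm_div, div_le_iff₀ (norm_pos_iff.2 (mul_ne_zero hα (pow_ne_zero _ hz)))]
      exact h x hx
    have e : f x / α = u * z ^ d := by
      rw [hu]
      field_simp
    have e2 : z ^ n = (z ^ d) ^ (n / (d : ℤ)) * z ^ (n % (d : ℤ)) := by
      rw [← zpow_natCast, ← zpow_mul, ← zpow_add₀ hz, Int.mul_ediv_add_emod]
    have e3 : c * z ^ n - c * ((f x / α) ^ (n / (d : ℤ)) * z ^ (n % (d : ℤ))) =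
        (1 - u ^ (n / (d : ℤ))) * (c * z ^ n) := by
      rw [e, mul_zpow, e2]
      ring
    rw [e3, norm_mul]
    exact mul_le_mul (norm_one_sub_zpow_le H.eps_pos.le H.eps_lt_one hu1 _) (ht z hx.1 hx.2)
      (norm_nonneg _) H.eps_pos.le
  · have hn0 : 0 ≤ n := hn.resolve_right (by rw [h0]; exact lt_irrefl _)
    obtain ⟨w, hw0, hw⟩ := H.exists_norm_eq
    lift n to ℕ using hn0
    set z := x - β with hzdef
    have hzr : ‖z‖ ≤ r₂ := hx.2
    have hr2 := H.radius_pos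
    have e1 : ((n : ℤ) / (d : ℤ)) = ((n / d : ℕ) : ℤ) := by norm_cast
    have e2 : ((n : ℤ) % (d : ℤ)) = ((n % d : ℕ) : ℤ) := by norm_cast
    rw [e1, e2, zpow_natCast, zpow_natCast, zpow_natCast]
    have e3 : z ^ n = (z ^ d) ^ (n / d) * z ^ (n % d) := by
      rw [← pow_mul, ← pow_add, Nat.div_add_mod]
    have e4 : c * z ^ n - c * ((f x / α) ^ (n / d) * z ^ (n % d)) =
        c * z ^ (n % d) * ((z ^ d) ^ (n / d) - (f x / α) ^ (n / d)) := by
      rw [e3]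
      ring
    have hb1 : ‖z ^ d‖ ≤ r₂ ^ d := by
      rw [norm_pow]
      gcongr
    have hb2 : ‖f x / α‖ ≤ r₂ ^ d := by
      rw [norm_div, div_le_iff₀ hαn, mul_comm]
      exact H.norm_le hx
    have hb3 : ‖z ^ d - f x / α‖ ≤ ε * r₂ ^ d := by
      have e5 : z ^ d - f x / α = -((f x - α * z ^ d) / α) := by
        field_simp
        ring
      rw [e5, norm_neg, norm_div, div_le_iff₀ hαn]
      have := h x hx
      linarith
    have hb := norm_pow_sub_pow_le H.eps_pos.le hb1 hb2 hb3 (n / d)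
    have htw := ht w (by rw [h0]; exact norm_nonneg _) hw.le
    rw [zpow_natCast, norm_mul, norm_pow, hw] at htw
    rw [e4, norm_mul, norm_mul, norm_pow]
    have hε := H.eps_pos
    calc ‖c‖ * ‖z‖ ^ (n % d) * ‖(z ^ d) ^ (n / d) - (f x / α) ^ (n / d)‖
        ≤ ‖c‖ * r₂ ^ (n % d) * (ε * (r₂ ^ d) ^ (n / d)) := by gcongr
      _ = ε * (‖c‖ * r₂ ^ n) := by
        rw [← pow_mul]
        conv_rhs => rw [← Nat.div_add_mod n d, pow_add]
        ring
      _ ≤ ε * t := by gcongr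

omit [IsUltrametricDist K] [CharZero K] in
/-- A monomial of degree `n = d * m + j` on the source controls the monomial of degree `m` on the
target. -/
theorem exists_const (H : IsNearMonomial f β r₁ r₂ α d ε) :
    ∃ C : ℝ, 0 < C ∧ ∀ (n : ℤ) (c : K) (t : ℝ), (0 ≤ n ∨ 0 < r₁) →
      (∀ z : K, r₁ ≤ ‖z‖ → ‖z‖ ≤ r₂ → ‖c * z ^ n‖ ≤ t) →
      ∀ y ∈ annulus 0 (‖α‖ * r₁ ^ d) (‖α‖ * r₂ ^ d), ‖c * (y / α) ^ (n / (d : ℤ))‖ ≤ C * t := by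
  have hα := H.coeff_ne_zero
  have hαn := norm_pos_iff.2 hα
  have hd := H.degree_pos
  have hd' : (0 : ℤ) < d := by exact_mod_cast hd
  have hr2 := H.radius_pos
  have key : ∀ s : ℝ, 0 < s → ∀ j : ℕ, j < d → (min 1 s) ^ d ≤ s ^ j := fun s hs j hj =>
    (pow_le_pow_of_le_one (by positivity) (min_le_left _ _) hj.le).trans
      (pow_le_pow_left₀ (by positivity) (min_le_right _ _) _)
  have hj : ∀ n : ℤ, ((n % (d : ℤ)).toNat : ℤ) = n % (d : ℤ) ∧ (n % (d : ℤ)).toNat < d := fun n => by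
    have h1 := Int.emod_nonneg n hd'.ne'
    have h2 := Int.emod_lt_of_pos n hd'
    omega
  rcases H.nonneg.lt_or_eq with hr | hr
  · refine ⟨((min 1 r₁) ^ d)⁻¹, by positivity, fun n c t _ ht y hy => ?_⟩
    obtain ⟨z, hz⟩ := IsAlgClosed.exists_pow_nat_eq (y / α) hd
    have hzn : ‖z‖ ^ d * ‖α‖ = ‖y‖ := by rw [← norm_pow, hz, norm_div, div_mul_cancel₀ _ hαn.ne']
    obtain ⟨h1, h2⟩ := hy
    rw [sub_zero, ← hzn, mul_comm] at h1 h2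
    have h1' : r₁ ≤ ‖z‖ := le_of_pow_le_pow_left₀ hd.ne' (norm_nonneg _) (le_of_mul_le_mul_right h1 hαn)
    have h2' : ‖z‖ ≤ r₂ := le_of_pow_le_pow_left₀ hd.ne' hr2.le
      (le_of_mul_le_mul_left (mul_comm ‖α‖ (‖z‖ ^ d) ▸ h2) hαn)
    have hz0 : z ≠ 0 := norm_pos_iff.1 (hr.trans_le h1')
    have e : z ^ n = (y / α) ^ (n / (d : ℤ)) * z ^ (n % (d : ℤ)).toNat := by
      rw [← hz, ← zpow_natCast, ← zpow_natCast, (hj n).1, ← zpow_mul, ← zpow_add₀ hz0,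
        Int.mul_ediv_add_emod]
    have h3 := ht z h1' h2'
    rw [e, ← mul_assoc, norm_mul, norm_pow] at h3
    rw [inv_mul_eq_div, le_div_iff₀ (by positivity)]
    refine le_trans (mul_le_mul_of_nonneg_left ?_ (norm_nonneg _)) h3
    exact (key r₁ hr _ (hj n).2).trans (by gcongr)
  · refine ⟨((min 1 r₂) ^ d)⁻¹, by positivity, fun n c t hn ht y hy => ?_⟩
    have hn0 : 0 ≤ n := hn.resolve_right (by rw [← hr]; exact lt_irrefl _)
    obtain ⟨w, hw0, hw⟩ := H.exists_norm_eq
    have h3 := ht w (by rw [← hr]; exact norm_nonneg _) hw.le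
    lift n to ℕ using hn0
    have e1 : ((n : ℤ) / (d : ℤ)) = ((n / d : ℕ) : ℤ) := by norm_cast
    rw [zpow_natCast, norm_mul, norm_pow, hw] at h3
    have hy2 : ‖y / α‖ ≤ r₂ ^ d := by
      rw [norm_div, div_le_iff₀ hαn, mul_comm]
      simpa using hy.2
    rw [e1, zpow_natCast, norm_mul, norm_pow, inv_mul_eq_div, le_div_iff₀ (by positivity)]
    refine le_trans ?_ h3
    calc ‖c‖ * ‖y / α‖ ^ (n / d) * (min 1 r₂) ^ d ≤ ‖c‖ * (r₂ ^ d) ^ (n / d) * r₂ ^ (n % d) := by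
          gcongr
          exact key r₂ hr2 _ (Nat.mod_lt _ hd)
      _ = ‖c‖ * r₂ ^ n := by
        rw [← pow_mul]
        conv_rhs => rw [← Nat.div_add_mod n d, pow_add]
        ring

omit [IsAlgClosed K] [CharZero K] in
theorem rigidOn_zpow (H : IsNearMonomial f β r₁ r₂ α d ε) {m : ℤ} (hm : 0 ≤ m ∨ 0 < r₁) :
    RigidOn (fun x => f x ^ m) (annulus β r₁ r₂) := by
  have hpow : ∀ m : ℕ, RigidOn (fun x => f x ^ m) (annulus β r₁ r₂) :=
    fun m => H.rigid.pow (fun x hx => H.norm_le hx) m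
  obtain ⟨m, rfl | rfl⟩ := m.eq_nat_or_neg
  · simpa using hpow m
  · rcases hm with h0 | hr
    · obtain rfl : m = 0 := by omega
      simpa using hpow 0
    · have hαn := norm_pos_iff.2 H.coeff_ne_zero
      refine ((hpow m).inv (δ := (‖α‖ * r₁ ^ d) ^ m) (by positivity) fun x hx => ?_).congr
        fun x _ => by simp
      rw [norm_pow, H.norm_eq hr hx]
      have := hx.1
      gcongr

omit [CharZero K] in
theorem pullback (H : IsNearMonomial f β r₁ r₂ α d ε) {c : K → K}
    (hc : RigidOn c (annulus 0 (‖α‖ * r₁ ^ d) (‖α‖ * r₂ ^ d))) :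
    RigidOn (fun x => c (f x)) (annulus β r₁ r₂) := by
  refine ApproxOn.of_approx fun δ hδ => ?_
  have hr := H.nonneg
  obtain ⟨F, a, hF, h1⟩ := hc.exists_laurent (by positivity) hδ
  refine ⟨_, ApproxOn.sum F (g := fun n x => a n * f x ^ n) fun n hn =>
    (H.rigidOn_zpow ((hF n hn).imp id fun h => ?_)).const_mul _, fun x hx => by
      simpa using h1 _ (H.mapsTo hx)⟩
  rcases hr.lt_or_eq with h0 | h0
  · exact h0
  · rw [← h0, zero_pow H.degree_pos.ne', mul_zero] at h
    exact absurd h (lt_irrefl _)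

/-- One step of the successive approximation that writes `h` in the basis `(x - β) ^ j`. -/
theorem exists_approx (H : IsNearMonomial f β r₁ r₂ α d ε) {C : ℝ}
    (hC : ∀ (n : ℤ) (c : K) (t : ℝ), (0 ≤ n ∨ 0 < r₁) →
      (∀ z : K, r₁ ≤ ‖z‖ → ‖z‖ ≤ r₂ → ‖c * z ^ n‖ ≤ t) →
      ∀ y ∈ annulus 0 (‖α‖ * r₁ ^ d) (‖α‖ * r₂ ^ d), ‖c * (y / α) ^ (n / (d : ℤ))‖ ≤ C * t)
    (hC0 : 0 < C) {M : ℝ} (hM : 0 < M) {h : K → K} (hh : RigidOn h (annulus β r₁ r₂))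
    (hhM : ∀ x ∈ annulus β r₁ r₂, ‖h x‖ ≤ M) :
    ∃ c : Fin d → K → K, (∀ j, RigidOn (c j) (annulus 0 (‖α‖ * r₁ ^ d) (‖α‖ * r₂ ^ d))) ∧
      (∀ j, ∀ y ∈ annulus 0 (‖α‖ * r₁ ^ d) (‖α‖ * r₂ ^ d), ‖c j y‖ ≤ C * M) ∧
      ∀ x ∈ annulus β r₁ r₂, ‖h x - ∑ j, c j (f x) * (x - β) ^ (j : ℕ)‖ ≤ ε * M := by
  have hε := H.eps_pos
  have hαn := norm_pos_iff.2 H.coeff_ne_zero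
  have hd : (0 : ℤ) < d := by exact_mod_cast H.degree_pos
  obtain ⟨F, a, hF, h1⟩ := hh.exists_laurent H.nonneg (mul_pos hε hM)
  have h2 : ∀ n ∈ F, ∀ z : K, r₁ ≤ ‖z‖ → ‖z‖ ≤ r₂ → ‖a n * z ^ n‖ ≤ M := by
    intro n hn z hz1 hz2
    refine cauchy_estimate (φ := id) Function.injective_id.injOn (fun z hz1 hz2 => ?_) hn hz1 hz2
    have hx : z + β ∈ annulus β r₁ r₂ := by simp [annulus, hz1, hz2]
    have h3 := (h1 _ hx).le
    simp only [add_sub_cancel_right] at h3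
    have h4 := ultra_sub_le (hhM _ hx) (h3.trans (by nlinarith [H.eps_lt_one]))
    simpa using h4
  refine ⟨fun j y => ∑ n ∈ F with n % (d : ℤ) = j, a n * (y / α) ^ (n / (d : ℤ)), fun j => ?_,
    fun j y hy => ?_, fun x hx => ?_⟩
  · refine ApproxOn.sum _ fun n hn => ?_
    have hn' := hF n (Finset.mem_filter.1 hn).1
    refine ((CoveringPsi.rigidOn_zpow (β := (0 : K)) (n := n / (d : ℤ)) ?_).const_mul
      (a n * (α ^ (n / (d : ℤ)))⁻¹)).congr fun y _ => ?_
    · refine hn'.imp (fun h => Int.ediv_nonneg h hd.le) fun h => by positivity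
    · rw [sub_zero, div_zpow]
      ring
  · exact ultra_sum_le (by positivity) fun n hn =>
      hC n (a n) M (hF n (Finset.mem_filter.1 hn).1) (h2 n (Finset.mem_filter.1 hn).1) y hy
  · have e : ∑ j : Fin d, (∑ n ∈ F with n % (d : ℤ) = j, a n * (f x / α) ^ (n / (d : ℤ))) *
        (x - β) ^ (j : ℕ) = ∑ n ∈ F, a n * ((f x / α) ^ (n / (d : ℤ)) * (x - β) ^ (n % (d : ℤ))) := by
      have hm : ∀ n ∈ F, (⟨(n % (d : ℤ)).toNat, by
          have h1 := Int.emod_nonneg n hd.ne'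
          have h2 := Int.emod_lt_of_pos n hd
          omega⟩ : Fin d) ∈ Finset.univ := fun _ _ => Finset.mem_univ _
      rw [← Finset.sum_fiberwise_of_maps_to hm]
      refine Finset.sum_congr rfl fun j _ => ?_
      have hfil : (F.filter fun n => n % (d : ℤ) = j) = F.filter fun n =>
          (⟨(n % (d : ℤ)).toNat, by
          have h1 := Int.emod_nonneg n hd.ne'
          have h2 := Int.emod_lt_of_pos n hd
          omega⟩ : Fin d) = j := by
        refine Finset.filter_congr fun n _ => ?_
        have h1 := Int.emod_nonneg n hd.ne'
        rw [Fin.ext_iff]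
        simp only
        omega
      rw [Finset.sum_mul, ← hfil]
      refine Finset.sum_congr rfl fun n hn => ?_
      rw [(Finset.mem_filter.1 hn).2, zpow_natCast, mul_assoc]
    rw [e]
    refine ultra_trans_le (h1 x hx).le ?_
    rw [← Finset.sum_sub_distrib]
    exact ultra_sum_le (by positivity) fun n hn => H.norm_monomial_sub_le (hF n hn) (h2 n hn) hx

/-- Independence of the power basis. After approximating the coefficients by Laurent polynomials up
to `δ`, a relation gives a Laurent polynomial in `x - β` of size `max (E δ) (ε t)`, where `t` bounds
its monomials; by the Cauchy estimate `t` can be replaced by that maximum, and finally by `E δ`. -/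
theorem unique (H : IsNearMonomial f β r₁ r₂ α d ε) {c : Fin d → K → K}
    (hc : ∀ j, RigidOn (c j) (annulus 0 (‖α‖ * r₁ ^ d) (‖α‖ * r₂ ^ d)))
    (h0 : ∀ x ∈ annulus β r₁ r₂, ∑ j, c j (f x) * (x - β) ^ (j : ℕ) = 0) (j : Fin d) {y : K}
    (hy : y ∈ annulus 0 (‖α‖ * r₁ ^ d) (‖α‖ * r₂ ^ d)) : c j y = 0 := by
  have hε := H.eps_pos
  have hε1 := H.eps_lt_one
  have hr2 := H.radius_pos
  have hr1 := H.nonneg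
  have hα := H.coeff_ne_zero
  have hd : (0 : ℤ) < d := by exact_mod_cast H.degree_pos
  obtain ⟨C, hC0, hC⟩ := H.exists_const
  set E : ℝ := (max 1 r₂) ^ d with hE
  have hE1 : 1 ≤ E := one_le_pow₀ (le_max_left _ _)
  have hEb : ∀ (j : Fin d), ∀ x ∈ annulus β r₁ r₂, ‖(x - β) ^ (j : ℕ)‖ ≤ E := fun j x hx => by
    rw [norm_pow]
    calc ‖x - β‖ ^ (j : ℕ) ≤ (max 1 r₂) ^ (j : ℕ) := by
          have := hx.2.trans (le_max_right 1 r₂)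
          gcongr
      _ ≤ E := pow_le_pow_right₀ (le_max_left _ _) j.2.le
  have main : ∀ δ : ℝ, 0 < δ → ‖c j y‖ ≤ (max 1 (C * E)) * δ := by
    intro δ hδ
    choose F b hF hb using fun j => (hc j).exists_laurent (by positivity) hδ
    have hbm : ∀ j, ∀ m ∈ F j, 0 ≤ m ∨ 0 < r₁ := fun j m hm => (hF j m hm).imp id fun h => by
      rcases hr1.lt_or_eq with h' | h'
      · exact h'
      · rw [← h', zero_pow H.degree_pos.ne', mul_zero] at h
        exact absurd h (lt_irrefl _)
    -- the Laurent polynomial `∑ b j m * α ^ m * z ^ (d * m + j)`, indexed by the pairs `(j, m)`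
    set s : Finset (Σ _ : Fin d, ℤ) := Finset.univ.sigma F with hs
    set φ : (Σ _ : Fin d, ℤ) → ℤ := fun i => d * i.2 + (i.1 : ℕ) with hφ
    set a : (Σ _ : Fin d, ℤ) → K := fun i => b i.1 i.2 * α ^ i.2 with ha
    have hφdiv : ∀ i, φ i / (d : ℤ) = i.2 := fun i => by
      rw [hφ]
      simp only
      rw [add_comm, Int.add_mul_ediv_left _ _ hd.ne', Int.ediv_eq_zero_of_lt, zero_add]
      · positivity
      · exact_mod_cast i.1.2
    have hφmod : ∀ i, φ i % (d : ℤ) = (i.1 : ℕ) := fun i => by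
      rw [hφ]
      simp only
      rw [add_comm, Int.add_mul_emod_self_left, Int.emod_eq_of_lt]
      · positivity
      · exact_mod_cast i.1.2
    have hφinj : Function.Injective φ := fun i i' h => by
      have h1 := hφdiv i
      have h2 := hφmod i
      rw [h, hφdiv] at h1
      rw [h, hφmod] at h2
      rcases i with ⟨i, m⟩
      rcases i' with ⟨i', m'⟩
      simp only at h1 h2
      obtain rfl : i' = i := Fin.ext (by exact_mod_cast h2)
      rw [h1]
    have hφpos : ∀ i ∈ s, 0 ≤ φ i ∨ 0 < r₁ := fun i hi => by
      refine (hbm i.1 i.2 (Finset.mem_sigma.1 hi).2).imp (fun h => ?_) id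
      positivity
    have hsum : ∀ x ∈ annulus β r₁ r₂,
        ‖∑ i ∈ s, a i * ((f x / α) ^ (φ i / (d : ℤ)) * (x - β) ^ (φ i % (d : ℤ)))‖ ≤ E * δ := by
      intro x hx
      have e : ∑ i ∈ s, a i * ((f x / α) ^ (φ i / (d : ℤ)) * (x - β) ^ (φ i % (d : ℤ))) =
          -∑ j, (c j (f x) - ∑ m ∈ F j, b j m * (f x - 0) ^ m) * (x - β) ^ (j : ℕ) := by
        simp_rw [sub_mul, sub_zero]
        rw [Finset.sum_sub_distrib, h0 x hx, zero_sub, neg_neg, Finset.sum_sigma]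
        refine Finset.sum_congr rfl fun j _ => ?_
        rw [Finset.sum_mul]
        refine Finset.sum_congr rfl fun m _ => ?_
        rw [hφdiv, hφmod, zpow_natCast, ha, div_zpow]
        simp only
        have := zpow_ne_zero m hα
        field_simp
      rw [e, norm_neg]
      refine ultra_sum_le (by positivity) fun j _ => ?_
      rw [norm_mul, mul_comm]
      exact mul_le_mul (hEb j x hx) (hb j _ (H.mapsTo hx)).le (norm_nonneg _) (by positivity)
    -- a bound `t` on all the monomials improves to `max (E * δ) (ε * t)`
    have improve : ∀ t : ℝ, (∀ i ∈ s, ∀ z : K, r₁ ≤ ‖z‖ → ‖z‖ ≤ r₂ → ‖a i * z ^ φ i‖ ≤ t) → 0 ≤ t →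
        ∀ i ∈ s, ∀ z : K, r₁ ≤ ‖z‖ → ‖z‖ ≤ r₂ → ‖a i * z ^ φ i‖ ≤ max (E * δ) (ε * t) := by
      intro t ht ht0 i hi z hz1 hz2
      refine cauchy_estimate hφinj.injOn (fun z hz1 hz2 => ?_) hi hz1 hz2
      have hx : z + β ∈ annulus β r₁ r₂ := by simp [annulus, hz1, hz2]
      have h1 : ‖∑ i ∈ s, a i * z ^ φ i - ∑ i ∈ s, a i * ((f (z + β) / α) ^ (φ i / (d : ℤ)) *
          ((z + β) - β) ^ (φ i % (d : ℤ)))‖ ≤ ε * t := by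
        rw [← Finset.sum_sub_distrib]
        refine ultra_sum_le (by positivity) fun i hi => ?_
        have := H.norm_monomial_sub_le (hφpos i hi) (ht i hi) hx
        rwa [add_sub_cancel_right] at this ⊢
      have h2 := ultra_add_le (h1.trans (le_max_right (E * δ) _))
        ((hsum _ hx).trans (le_max_left _ (ε * t)))
      rwa [sub_add_cancel] at h2
    have start : ∃ t : ℝ, 0 ≤ t ∧
        ∀ i ∈ s, ∀ z : K, r₁ ≤ ‖z‖ → ‖z‖ ≤ r₂ → ‖a i * z ^ φ i‖ ≤ t := by
      have h1 : ∀ i : (Σ _ : Fin d, ℤ), ∃ t : ℝ, 0 < t ∧ (i ∈ s → ∀ z : K, r₁ ≤ ‖z‖ → ‖z‖ ≤ r₂ →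
          ‖a i * z ^ φ i‖ ≤ t) := by
        intro i
        by_cases hi : i ∈ s
        · obtain ⟨t, ht, h⟩ := RigidOn.exists_bound hr1 ((CoveringPsi.rigidOn_zpow (β := (0 : K))
            (r₂ := r₂) (hφpos i hi)).const_mul (a i))
          exact ⟨t, ht, fun _ z hz1 hz2 => by simpa using h z (by simp [annulus, hz1, hz2])⟩
        · exact ⟨1, one_pos, fun h => absurd h hi⟩
      choose t ht h using h1
      refine ⟨∑ i ∈ s, t i, Finset.sum_nonneg fun i _ => (ht i).le, fun i hi z hz1 hz2 => ?_⟩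
      exact (h i hi z hz1 hz2).trans (Finset.single_le_sum (fun i _ => (ht i).le) hi)
    obtain ⟨t, ht0, ht⟩ := start
    have iter : ∀ k : ℕ, ∀ i ∈ s, ∀ z : K, r₁ ≤ ‖z‖ → ‖z‖ ≤ r₂ →
        ‖a i * z ^ φ i‖ ≤ max (E * δ) (ε ^ k * t) := by
      intro k
      induction k with
      | zero => exact fun i hi z hz1 hz2 => (ht i hi z hz1 hz2).trans (by simp)
      | succ k ih =>
        intro i hi z hz1 hz2
        refine (improve _ ih (by positivity) i hi z hz1 hz2).trans (max_le (le_max_left _ _) ?_)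
        rw [mul_max_of_nonneg _ _ hε.le]
        refine max_le_max ?_ (le_of_eq (by ring))
        nlinarith [mul_pos (one_pos.trans_le hE1) hδ]
    have final : ∀ i ∈ s, ∀ z : K, r₁ ≤ ‖z‖ → ‖z‖ ≤ r₂ → ‖a i * z ^ φ i‖ ≤ E * δ := by
      intro i hi z hz1 hz2
      obtain ⟨k, hk⟩ := exists_pow_lt_of_lt_one
        (show 0 < E * δ / (t + 1) by positivity) hε1
      rw [lt_div_iff₀ (by positivity)] at hk
      refine (iter k i hi z hz1 hz2).trans (max_le le_rfl ?_)
      have : 0 < ε ^ k := by positivity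
      nlinarith
    have h3 : ‖∑ m ∈ F j, b j m * (y - 0) ^ m‖ ≤ C * (E * δ) := by
      refine ultra_sum_le (by positivity) fun m hm => ?_
      have hi : (⟨j, m⟩ : Σ _ : Fin d, ℤ) ∈ s := Finset.mem_sigma.2 ⟨Finset.mem_univ _, hm⟩
      have h4 := hC _ _ _ (hφpos _ hi) (final _ hi) y hy
      rw [hφdiv, ha, div_zpow] at h4
      simp only at h4
      have := zpow_ne_zero m hα
      rwa [mul_assoc, mul_div_cancel₀ _ this, ← sub_zero y] at h4
    have h4 := ultra_add_le ((hb j y hy).le.trans (show δ ≤ (max 1 (C * E)) * δ by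
      nlinarith [le_max_left 1 (C * E)])) (h3.trans (show C * (E * δ) ≤ (max 1 (C * E)) * δ by
      nlinarith [le_max_right 1 (C * E)]))
    rwa [sub_add_cancel] at h4
  by_contra hne
  have hp := norm_pos_iff.2 hne
  have hm1 : 0 < max 1 (C * E) := by positivity
  have := main (‖c j y‖ / (2 * max 1 (C * E))) (by positivity)
  rw [mul_div_assoc', mul_comm (2 : ℝ), mul_div_mul_left _ _ hm1.ne'] at this
  linarith

/-- If `f` is close to `α (x - β) ^ d` on an annulus or a disc, then `1, x - β, …, (x - β) ^ (d - 1)`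
is a basis of the functions on the source over the functions on the target, as it is for the
monomial itself. -/
theorem hasFreeBasis [CompleteSpace K] (H : IsNearMonomial f β r₁ r₂ α d ε) :
    HasFreeBasis f (annulus β r₁ r₂) (annulus 0 (‖α‖ * r₁ ^ d) (‖α‖ * r₂ ^ d))
      (fun (j : Fin d) x => (x - β) ^ (j : ℕ)) := by
  have hε := H.eps_pos
  have hr2 := H.radius_pos
  have hrig : ∀ j : ℕ, RigidOn (fun x => (x - β) ^ j) (annulus β r₁ r₂) := fun j =>
    (ApproxOn.poly ((X - C β) ^ j)).congr (by simp)
  refine ⟨H.mapsTo, fun c hc => H.pullback hc, fun j => hrig j, fun h hh => ?_,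
    fun c hc h0 j y hy => H.unique hc h0 j hy⟩
  obtain ⟨B, hB0, hB⟩ := H.exists_const
  obtain ⟨M, hM0, hM⟩ := hh.exists_bound H.nonneg
  set U := annulus β r₁ r₂ with hU
  set V := annulus (0 : K) (‖α‖ * r₁ ^ d) (‖α‖ * r₂ ^ d) with hV
  have step : ∀ (k : ℕ) (g : K → K), (RigidOn g U ∧ ∀ x ∈ U, ‖g x‖ ≤ ε ^ k * M) →
      ∃ c : Fin d → K → K, (∀ j, RigidOn (c j) V) ∧ (∀ j, ∀ y ∈ V, ‖c j y‖ ≤ B * (ε ^ k * M)) ∧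
        RigidOn (fun x => g x - ∑ j, c j (f x) * (x - β) ^ (j : ℕ)) U ∧
        ∀ x ∈ U, ‖g x - ∑ j, c j (f x) * (x - β) ^ (j : ℕ)‖ ≤ ε ^ (k + 1) * M := by
    rintro k g ⟨hg, hgM⟩
    obtain ⟨c, hc, hcB, hcε⟩ := H.exists_approx hB hB0 (show 0 < ε ^ k * M by positivity) hg hgM
    refine ⟨c, hc, hcB, hg.sub (ApproxOn.sum _ fun j _ => ?_), fun x hx => ?_⟩
    · obtain ⟨M', -, hM'⟩ := (hrig j).exists_bound H.nonneg
      exact (H.pullback (hc j)).mul (hrig j) (fun x hx => hcB j _ (H.mapsTo hx)) hM'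
    · refine (hcε x hx).trans (le_of_eq (by ring))
  choose! c hc hcB hcr hcε using step
  -- the remainders of the successive approximations of `h`
  let G : ℕ → K → K := fun k => Nat.rec h (fun k g x => g x - ∑ j, c k g j (f x) * (x - β) ^ (j : ℕ)) k
  have hG : ∀ k, RigidOn (G k) U ∧ ∀ x ∈ U, ‖G k x‖ ≤ ε ^ k * M := by
    intro k
    induction k with
    | zero => exact ⟨hh, by simpa [G] using hM⟩
    | succ k ih => exact ⟨hcr k (G k) ih, hcε k (G k) ih⟩
  have hsummable : ∀ j, ∀ y ∈ V, Summable fun k => c k (G k) j y := fun j y hy => by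
    refine Summable.of_norm_bounded (g := fun k => B * M * ε ^ k)
      ((summable_geometric_of_lt_one hε.le H.eps_lt_one).mul_left _) fun k => ?_
    exact (hcB k (G k) (hG k) j y hy).trans (le_of_eq (by ring))
  have htail : ∀ j, ∀ y ∈ V, ∀ N, ‖(∑' k, c k (G k) j y) - ∑ k ∈ Finset.range N, c k (G k) j y‖ ≤
      ε ^ N * (B * M) := fun j y hy N => by
    rw [← (hsummable j y hy).sum_add_tsum_nat_add N, add_sub_cancel_left]
    refine IsUltrametricDist.norm_tsum_le_of_forall_le_of_nonneg (by positivity) fun k => ?_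
    refine (hcB _ _ (hG _) j y hy).trans ?_
    have : ε ^ (k + N) ≤ ε ^ N :=
      pow_le_pow_of_le_one hε.le H.eps_lt_one.le (Nat.le_add_left _ _)
    calc B * (ε ^ (k + N) * M) ≤ B * (ε ^ N * M) := by gcongr
      _ = _ := by ring
  have hlim : ∀ A : ℝ, Tendsto (fun N : ℕ => ε ^ N * A) atTop (𝓝 0) := fun A => by
    simpa using (tendsto_pow_atTop_nhds_zero_of_lt_one hε.le H.eps_lt_one).mul_const A
  refine ⟨fun j y => ∑' k, c k (G k) j y, fun j => ?_, fun x hx => ?_⟩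
  · refine ApproxOn.of_approx fun δ hδ => ?_
    obtain ⟨N, hN⟩ := ((hlim (B * M)).eventually (gt_mem_nhds hδ)).exists
    exact ⟨_, ApproxOn.sum (Finset.range N) fun k _ => hc k (G k) (hG k) j,
      fun y hy => (htail j y hy N).trans_lt hN⟩
  · have hfx := H.mapsTo hx
    have e1 : ∀ N, h x - ∑ j, (∑ k ∈ Finset.range N, c k (G k) j (f x)) * (x - β) ^ (j : ℕ) =
        G N x := by
      intro N
      induction N with
      | zero => simp [G]
      | succ N ih =>
        have e2 : G (N + 1) x = G N x - ∑ j, c N (G N) j (f x) * (x - β) ^ (j : ℕ) := rfl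
        rw [e2, ← ih, sub_sub, ← Finset.sum_add_distrib]
        congr 1
        refine Finset.sum_congr rfl fun j _ => ?_
        rw [Finset.sum_range_succ, add_mul]
    set E : ℝ := (max 1 r₂) ^ d with hE
    have hEb : ∀ (j : Fin d), ‖(x - β) ^ (j : ℕ)‖ ≤ E := fun j => by
      rw [norm_pow]
      calc ‖x - β‖ ^ (j : ℕ) ≤ (max 1 r₂) ^ (j : ℕ) := by
            have := hx.2.trans (le_max_right 1 r₂)
            gcongr
        _ ≤ E := pow_le_pow_right₀ (le_max_left _ _) j.2.le
    have e3 : ∀ N, ‖h x - ∑ j, (∑' k, c k (G k) j (f x)) * (x - β) ^ (j : ℕ)‖ ≤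
        ε ^ N * (max M (B * M * E)) := by
      intro N
      have e4 : h x - ∑ j, (∑' k, c k (G k) j (f x)) * (x - β) ^ (j : ℕ) = G N x -
          ∑ j, ((∑' k, c k (G k) j (f x)) - ∑ k ∈ Finset.range N, c k (G k) j (f x)) *
            (x - β) ^ (j : ℕ) := by
        rw [← e1 N, sub_sub, ← Finset.sum_add_distrib]
        congr 1
        exact Finset.sum_congr rfl fun j _ => by ring
      rw [e4]
      refine ultra_sub_le (((hG N).2 x hx).trans (by gcongr; exact le_max_left _ _))
        (ultra_sum_le (by positivity) fun j _ => ?_)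
      rw [norm_mul]
      calc _ ≤ ε ^ N * (B * M) * E :=
            mul_le_mul (htail j _ hfx N) (hEb j) (norm_nonneg _) (by positivity)
        _ = ε ^ N * (B * M * E) := by ring
        _ ≤ _ := by gcongr; exact le_max_right _ _
    have h5 := ge_of_tendsto' (hlim _) e3
    exact sub_eq_zero.1 (norm_le_zero_iff.1 h5)

end IsNearMonomial

end CoveringPsi

namespace CoveringPsi

open Polynomial Filter Topology

variable {K : Type*} [NontriviallyNormedField K]

/-! ### Orders of vanishing -/

theorem le_of_pow_mul_eventuallyEq {x : K} {m n : ℕ} {u v : K → K} (hu : ContinuousAt u x)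
    (hv : ContinuousAt v x) (hu0 : u x ≠ 0)
    (H : ∀ᶠ z in 𝓝[≠] x, (z - x) ^ m * u z = (z - x) ^ n * v z) : n ≤ m := by
  by_contra! hmn
  obtain ⟨k, rfl⟩ := Nat.exists_eq_add_of_lt hmn
  have h1 : ∀ᶠ z in 𝓝[≠] x, u z = (z - x) ^ (k + 1) * v z := by
    filter_upwards [H, self_mem_nhdsWithin] with z hz hzx
    have h0 : (z - x) ^ m ≠ 0 := pow_ne_zero _ (sub_ne_zero.2 hzx)
    apply mul_left_cancel₀ h0
    rw [hz]
    ring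
  have h2 : Tendsto (fun z => (z - x) ^ (k + 1) * v z) (𝓝[≠] x) (𝓝 0) := by
    have : ContinuousAt (fun z => (z - x) ^ (k + 1) * v z) x := by fun_prop
    simpa [ContinuousAt] using this.tendsto.mono_left nhdsWithin_le_nhds
  exact hu0 (tendsto_nhds_unique (hu.tendsto.mono_left nhdsWithin_le_nhds)
    (h2.congr' (h1.mono fun _ h => h.symm)))

/-- If `P = F w` near `x` with `w` continuous and `w x ≠ 0`, the order of vanishing of `F` at `x` is
the multiplicity of `x` as a root of `P`. -/
theorem analyticOrderAt_eq_rootMultiplicity {F w : K → K} {x : K} {P : K[X]} (hF : AnalyticAt K F x)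
    (hw : ContinuousAt w x) (hw0 : w x ≠ 0) (hP : P ≠ 0)
    (H : ∀ᶠ z in 𝓝 x, P.eval z = F z * w z) :
    analyticOrderAt F x = (P.rootMultiplicity x : ℕ∞) := by
  obtain ⟨Q, hQ, hQx⟩ := exists_eq_pow_rootMultiplicity_mul_and_not_dvd P hP x
  rw [dvd_iff_isRoot, IsRoot.def] at hQx
  set m := P.rootMultiplicity x with hm
  have hPe : ∀ z, P.eval z = (z - x) ^ m * Q.eval z := fun z => by
    conv_lhs => rw [hQ]
    simp
  have hfin : analyticOrderAt F x ≠ ⊤ := by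
    intro htop
    rw [analyticOrderAt_eq_top] at htop
    refine absurd (le_of_pow_mul_eventuallyEq (m := m) (n := m + 1) (v := fun _ => 0)
      Q.continuousAt continuousAt_const hQx ?_) (by omega)
    refine eventually_nhdsWithin_of_eventually_nhds ?_
    filter_upwards [H, htop] with z h1 h2
    rw [← hPe, h1, h2]
    simp
  obtain ⟨n, hn⟩ := ENat.ne_top_iff_exists.1 hfin
  obtain ⟨g, hg, hgx, hFg⟩ := hF.analyticOrderAt_eq_natCast.1 hn.symm
  have hkey : ∀ᶠ z in 𝓝 x, (z - x) ^ m * Q.eval z = (z - x) ^ n * (g z * w z) := by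
    filter_upwards [H, hFg] with z h1 h2
    rw [← hPe, h1, h2, smul_eq_mul, mul_assoc]
  have hkey' := eventually_nhdsWithin_of_eventually_nhds (s := {x}ᶜ) hkey
  have hgw : ContinuousAt (fun z => g z * w z) x := hg.continuousAt.mul hw
  have h1 := le_of_pow_mul_eventuallyEq Q.continuousAt hgw hQx hkey'
  have h2 := le_of_pow_mul_eventuallyEq hgw Q.continuousAt (mul_ne_zero hgx hw0)
    (hkey'.mono fun _ h => h.symm)
  rw [← hn, le_antisymm h1 h2]

/-! ### Fibres of a free map from a disc to a disc -/

variable [IsUltrametricDist K]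

theorem mem_disc_iff {β γ x : K} {r : ℝ} (hγ : γ ∈ annulus β 0 r) :
    x ∈ annulus β 0 r ↔ ‖x - γ‖ ≤ r := by
  constructor
  · intro hx
    have := ultra_sub_le hx.2 hγ.2
    rwa [sub_sub_sub_cancel_right] at this
  · intro hx
    refine ⟨norm_nonneg _, ?_⟩
    have := ultra_add_le hx hγ.2
    rwa [sub_add_sub_cancel] at this

theorem disc_mem_nhds {β γ : K} {r : ℝ} (hr : 0 < r) (hγ : γ ∈ annulus β 0 r) :
    annulus β 0 r ∈ 𝓝 γ := by
  refine mem_of_superset (Metric.closedBall_mem_nhds γ hr) fun x hx => ?_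
  rw [mem_disc_iff hγ, ← dist_eq_norm]
  exact hx

theorem RigidOn.eq_zero_of_sub_mul {β γ : K} {r : ℝ} (hr : 0 < r) (hγ : γ ∈ annulus β 0 r)
    {g : K → K} (hg : RigidOn g (annulus β 0 r)) (h : ∀ x ∈ annulus β 0 r, (x - γ) * g x = 0) :
    ∀ x ∈ annulus β 0 r, g x = 0 := by
  have h1 : ∀ x ∈ annulus β 0 r, x ≠ γ → g x = 0 := fun x hx hxγ =>
    (mul_eq_zero.1 (h x hx)).resolve_left (sub_ne_zero.2 hxγ)
  intro x hx
  by_cases hxγ : x = γ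
  · subst hxγ
    have hc : ContinuousAt g x := (hg.continuousWithinAt hx).continuousAt (disc_mem_nhds hr hx)
    refine tendsto_nhds_unique (hc.tendsto.mono_left nhdsWithin_le_nhds)
      (tendsto_const_nhds.congr' ?_ : Tendsto g (𝓝[≠] x) (𝓝 0))
    filter_upwards [self_mem_nhdsWithin, mem_nhdsWithin_of_mem_nhds (disc_mem_nhds hr hx)]
      with z hz hz'
    exact (h1 z hz' hz).symm
  · exact h1 x hx hxγ

variable [IsAlgClosed K]

theorem RigidOn.exists_poly {β : K} {r : ℝ} {g : K → K} (hg : RigidOn g (annulus β 0 r)) {ε : ℝ}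
    (hε : 0 < ε) : ∃ P : K[X], ∀ x ∈ annulus β 0 r, ‖g x - P.eval x‖ < ε := by
  obtain ⟨P, Q, hQ, h1⟩ := approxOn_laurentDenoms le_rfl hg ε hε
  obtain ⟨N, hN, rfl⟩ := mem_laurentDenoms hQ
  obtain rfl : N = 0 := hN.resolve_right (lt_irrefl _)
  exact ⟨P, fun x hx => by simpa using (h1 x hx).2⟩

variable [CharZero K]

/-- The maximum modulus principle for `(x - γ) q`: the bound on the boundary circle
`‖x - γ‖ = ‖w‖` passes to `q` on the whole disc. -/
theorem norm_eval_le_of_sub_mul {γ w : K} (hw : w ≠ 0) {q : K[X]} {ε : ℝ}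
    (h : ∀ x, ‖x - γ‖ ≤ ‖w‖ → ‖(x - γ) * q.eval x‖ ≤ ‖w‖ * ε) {x : K} (hx : ‖x - γ‖ ≤ ‖w‖) :
    ‖q.eval x‖ ≤ ε := by
  have hwp := norm_pos_iff.2 hw
  have hε : 0 ≤ ε := by
    have := (norm_nonneg _).trans (h γ (by simp))
    exact nonneg_of_mul_nonneg_right this hwp
  set q' := q.comp (X + C γ) with hq'
  have hev : ∀ z, q.eval (z + γ) = ∑ n ∈ q'.support, q'.coeff n * z ^ n := fun z => by
    have : q.eval (z + γ) = q'.eval z := by simp [hq', eval_comp]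
    rw [this, eval_eq_sum, Polynomial.sum]
  have h1 : ∀ n ∈ q'.support, ‖q'.coeff n‖ * ‖w‖ ^ n ≤ ε := by
    intro n hn
    have h2 := cauchy_estimate (s := q'.support) (φ := fun n : ℕ => (n : ℤ) + 1)
      (a := fun n => q'.coeff n) (r₁ := 0) (r₂ := ‖w‖) (M := ‖w‖ * ε)
      (fun a _ b _ hab => by simpa using hab) (fun z _ hz => ?_) hn (norm_nonneg w) le_rfl
    · have e : ((n : ℤ) + 1) = ((n + 1 : ℕ) : ℤ) := by push_cast; ring
      rw [e, zpow_natCast, norm_mul, norm_pow, pow_succ] at h2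
      refine le_of_mul_le_mul_left ?_ hwp
      linarith
    · have h3 := h (z + γ) (by simpa using hz)
      rw [hev, add_sub_cancel_right, Finset.mul_sum] at h3
      refine le_trans (le_of_eq (congrArg norm (Finset.sum_congr rfl fun n _ => ?_))) h3
      have e : ((n : ℤ) + 1) = ((n + 1 : ℕ) : ℤ) := by push_cast; ring
      rw [e, zpow_natCast]
      ring
  rw [← sub_add_cancel x γ, hev]
  refine ultra_sum_le hε fun n hn => ?_
  rw [norm_mul, norm_pow]
  exact (mul_le_mul_of_nonneg_left (pow_le_pow_left₀ (norm_nonneg _) hx n) (norm_nonneg _)).trans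
    (h1 n hn)

variable [CompleteSpace K]

/-- A zero of a rigid function on a disc can be divided out. -/
theorem RigidOn.exists_eq_sub_mul {β γ w : K} (hw : w ≠ 0) (hγ : γ ∈ annulus β 0 ‖w‖) {g : K → K}
    (hg : RigidOn g (annulus β 0 ‖w‖)) (hgγ : g γ = 0) :
    ∃ g', RigidOn g' (annulus β 0 ‖w‖) ∧ ∀ x ∈ annulus β 0 ‖w‖, g x = (x - γ) * g' x := by
  have hwp := norm_pos_iff.2 hw
  have h1 : ∀ k : ℕ, ∃ q : K[X], ∀ x ∈ annulus β 0 ‖w‖,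
      ‖g x - (x - γ) * q.eval x‖ ≤ ‖w‖ * (1 / 2) ^ k := by
    intro k
    obtain ⟨P, hP⟩ := hg.exists_poly (show 0 < ‖w‖ * (1 / 2) ^ k by positivity)
    have hroot : (X - C γ) ∣ P - C (P.eval γ) := by simp [dvd_iff_isRoot]
    obtain ⟨q, hq⟩ := hroot
    refine ⟨q, fun x hx => ?_⟩
    have e : (x - γ) * q.eval x = P.eval x - P.eval γ := by
      have := congrArg (eval x) hq
      simpa using this.symm
    have e2 : g x - (x - γ) * q.eval x = (g x - P.eval x) - (g γ - P.eval γ) := by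
      rw [e, hgγ]
      ring
    rw [e2]
    exact ultra_sub_le (hP x hx).le (hP γ hγ).le
  choose q hq using h1
  have h2 : ∀ x ∈ annulus β 0 ‖w‖, ∀ k l : ℕ, k ≤ l →
      ‖(q l).eval x - (q k).eval x‖ ≤ (1 / 2) ^ k := by
    intro x hx k l hkl
    rw [← eval_sub]
    refine norm_eval_le_of_sub_mul (γ := γ) hw (fun z hz => ?_) ((mem_disc_iff hγ).1 hx)
    have hz' := (mem_disc_iff hγ).2 hz
    have e : (z - γ) * (q l - q k).eval z =
        (g z - (z - γ) * (q k).eval z) - (g z - (z - γ) * (q l).eval z) := by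
      rw [eval_sub]
      ring
    rw [e]
    refine ultra_sub_le (hq k z hz') ((hq l z hz').trans ?_)
    have : (1 / 2 : ℝ) ^ l ≤ (1 / 2) ^ k :=
      pow_le_pow_of_le_one (by norm_num) (by norm_num) hkl
    gcongr
  have h3 : ∀ x, ∃ y, x ∈ annulus β 0 ‖w‖ → Tendsto (fun k => (q k).eval x) atTop (𝓝 y) := by
    intro x
    by_cases hx : x ∈ annulus β 0 ‖w‖
    · have hc : CauchySeq fun k => (q k).eval x := by
        refine cauchySeq_of_le_geometric (1 / 2) 1 (by norm_num) fun k => ?_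
        rw [dist_comm, dist_eq_norm, one_mul]
        exact h2 x hx k (k + 1) (Nat.le_succ k)
      obtain ⟨y, hy⟩ := cauchySeq_tendsto_of_complete hc
      exact ⟨y, fun _ => hy⟩
    · exact ⟨0, fun h => absurd h hx⟩
  choose g' hg' using h3
  have hlim : Tendsto (fun k : ℕ => (1 / 2 : ℝ) ^ k) atTop (𝓝 0) :=
    tendsto_pow_atTop_nhds_zero_of_lt_one (by norm_num) (by norm_num)
  refine ⟨g', ApproxOn.of_approx fun ε hε => ?_, fun x hx => ?_⟩
  · obtain ⟨k, hk⟩ := (hlim.eventually (gt_mem_nhds hε)).exists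
    refine ⟨_, ApproxOn.poly (q k), fun x hx => lt_of_le_of_lt ?_ hk⟩
    refine le_of_tendsto ((hg' x hx).sub_const _).norm ?_
    filter_upwards [eventually_ge_atTop k] with l hl
    exact h2 x hx k l hl
  · have h4 : Tendsto (fun k => g x - (x - γ) * (q k).eval x) atTop (𝓝 (g x - (x - γ) * g' x)) :=
      ((hg' x hx).const_mul _).const_sub _
    have h5 : Tendsto (fun k => g x - (x - γ) * (q k).eval x) atTop (𝓝 0) := by
      refine squeeze_zero_norm (fun k => hq k x hx) ?_
      simpa using hlim.const_mul ‖w‖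
    exact sub_eq_zero.1 (tendsto_nhds_unique h4 h5)

omit [IsAlgClosed K] [CharZero K] [CompleteSpace K] in
/-- A polynomial of degree `< d` that is divisible by `f - a` vanishes. -/
theorem HasFreeBasis.poly_eq_zero {f : K → K} {β : K} {r : ℝ} {V : Set K} {d : ℕ}
    (H : HasFreeBasis f (annulus β 0 r) V (fun (j : Fin d) x => (x - β) ^ (j : ℕ)))
    (hVb : ∃ M, ∀ y ∈ V, ‖y‖ ≤ M) (hVb' : ∀ c, RigidOn c V → ∃ M, ∀ y ∈ V, ‖c y‖ ≤ M)
    {a : K} (ha : a ∈ V) {Q : K[X]} (hQ : Q.natDegree < d) {v : K → K}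
    (hv : RigidOn v (annulus β 0 r)) (h : ∀ x ∈ annulus β 0 r, Q.eval x = (f x - a) * v x) :
    Q = 0 := by
  obtain ⟨b, hb, hvb⟩ := H.span v hv
  set Q' := Q.comp (X + C β) with hQ'
  have hdeg : Q'.natDegree < d := by
    rw [hQ', natDegree_comp]
    simpa using hQ
  have hev : ∀ x, Q.eval x = ∑ j : Fin d, Q'.coeff j * (x - β) ^ (j : ℕ) := fun x => by
    have : Q.eval x = Q'.eval (x - β) := by simp [hQ', eval_comp]
    rw [this, eval_eq_sum_range' hdeg, Finset.sum_range]
  obtain ⟨M, hM⟩ := hVb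
  have h1 := H.unique (fun j y => Q'.coeff j - (y - a) * b j y) (fun j => ?_) (fun x hx => ?_)
  · have h2 : Q' = 0 := by
      ext j
      by_cases hj : j < d
      · have := h1 ⟨j, hj⟩ a ha
        simpa using this
      · rw [coeff_zero]
        exact coeff_eq_zero_of_natDegree_lt (by omega)
    have h3 : Q = Q'.comp (X - C β) := by
      rw [hQ', comp_assoc]
      simp
    rw [h3, h2, zero_comp]
  · obtain ⟨M', hM'⟩ := hVb' _ (hb j)
    refine (ApproxOn.const _).sub (ApproxOn.mul (M := max M ‖a‖) ?_ (hb j) (fun y hy => ?_) hM')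
    · exact (ApproxOn.poly (X - C a)).congr (by simp)
    · exact ultra_sub_le ((hM y hy).trans (le_max_left _ _)) (le_max_right _ _)
  · have e : ∑ j : Fin d, (Q'.coeff j - (f x - a) * b j (f x)) * (x - β) ^ (j : ℕ) =
        Q.eval x - (f x - a) * v x := by
      rw [hev, hvb x hx, Finset.mul_sum, ← Finset.sum_sub_distrib]
      exact Finset.sum_congr rfl fun j _ => by ring
    rw [e, h x hx, sub_self]

/-- If `1, x - β, …, (x - β) ^ (d - 1)` is a basis of the functions on a disc over the functions on
its image disc, each fibre has `d` points with multiplicity: the relation expressing `(x - β) ^ d`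
in this basis is, over `a`, a polynomial of degree `d` with the same zeros as `f - a`. -/
theorem HasFreeBasis.exists_fibre {f : K → K} {β w w' : K} (hw : w ≠ 0) (hw' : w' ≠ 0) {d : ℕ}
    (H : HasFreeBasis f (annulus β 0 ‖w‖) (annulus 0 0 ‖w'‖)
      (fun (j : Fin d) x => (x - β) ^ (j : ℕ)))
    (hf : ∀ x ∈ annulus β 0 ‖w‖, AnalyticAt K f x) {a : K} (ha : a ∈ annulus 0 0 ‖w'‖) :
    ∃ S : Finset K, (∀ x, x ∈ S ↔ x ∈ annulus β 0 ‖w‖ ∧ f x = a) ∧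
      ∑ x ∈ S, analyticOrderAt (fun z => f z - a) x = (d : ℕ∞) := by
  have hwp := norm_pos_iff.2 hw
  set U := annulus β 0 ‖w‖ with hU
  set V := annulus (0 : K) 0 ‖w'‖ with hV
  have hVb : ∃ M, ∀ y ∈ V, ‖y‖ ≤ M := ⟨‖w'‖, fun y hy => by simpa using hy.2⟩
  have hVb' : ∀ c, RigidOn c V → ∃ M, ∀ y ∈ V, ‖c y‖ ≤ M := fun c hc => by
    obtain ⟨M, -, hM⟩ := RigidOn.exists_bound le_rfl hc
    exact ⟨M, hM⟩
  have indep : ∀ {Q : K[X]} (_ : Q.natDegree < d) {v : K → K} (_ : RigidOn v U)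
      (_ : ∀ x ∈ U, Q.eval x = (f x - a) * v x), Q = 0 :=
    fun hQ _ hv h => H.poly_eq_zero hVb hVb' ha hQ hv h
  have hfr : RigidOn (fun x => f x - a) U :=
    (H.pullback (fun y => y) ((ApproxOn.poly X).congr (by simp))).sub (ApproxOn.const a)
  have mulU : ∀ {g h : K → K}, RigidOn g U → RigidOn h U → RigidOn (fun x => g x * h x) U := by
    intro g h hg hh
    obtain ⟨M, -, hM⟩ := RigidOn.exists_bound le_rfl hg
    obtain ⟨M', -, hM'⟩ := RigidOn.exists_bound le_rfl hh
    exact hg.mul hh hM hM'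
  have hzj : ∀ j : ℕ, RigidOn (fun x => (x - β) ^ j) U := fun j =>
    (ApproxOn.poly ((X - C β) ^ j)).congr (by simp)
  obtain ⟨c, hc, hcd⟩ := H.span _ (hzj d)
  -- the characteristic polynomial of `x - β` modulo `f - a`
  set P₀ : K[X] := X ^ d - ∑ j : Fin d, C (c j a) * X ^ (j : ℕ) with hP₀
  have hdeg0 : (∑ j : Fin d, C (c j a) * X ^ (j : ℕ)).degree < (d : WithBot ℕ) := by
    refine (degree_sum_le _ _).trans_lt ((Finset.sup_lt_iff (by exact WithBot.bot_lt_coe d)).2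
      fun j _ => ?_)
    exact (degree_C_mul_X_pow_le _ _).trans_lt (by exact_mod_cast j.2)
  have hP₀m : P₀.Monic := monic_X_pow_sub hdeg0
  have hP₀d : P₀.natDegree = d := by
    refine natDegree_eq_of_degree_eq_some ?_
    rw [hP₀, degree_sub_eq_left_of_degree_lt (by rwa [degree_X_pow]), degree_X_pow]
  set P : K[X] := P₀.comp (X - C β) with hP
  have hPd : P.natDegree = d := by rw [hP, natDegree_comp, hP₀d]; simp
  have hP0 : P ≠ 0 := (hP₀m.comp (monic_X_sub_C β) (by simp)).ne_zero
  have hPev : ∀ x, P.eval x = (x - β) ^ d - ∑ j : Fin d, c j a * (x - β) ^ (j : ℕ) := fun x => by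
    simp [hP, hP₀, eval_finsetSum]
  have hdiv : ∀ j, ∃ e, RigidOn e V ∧ ∀ y ∈ V, c j y - c j a = (y - a) * e y := fun j =>
    RigidOn.exists_eq_sub_mul hw' ha ((hc j).sub (ApproxOn.const (c j a))) (sub_self _)
  choose e he hce using hdiv
  set u : K → K := fun x => ∑ j : Fin d, e j (f x) * (x - β) ^ (j : ℕ) with hu
  have hur : RigidOn u U := ApproxOn.sum _ fun j _ => mulU (H.pullback _ (he j)) (hzj j)
  have hPu : ∀ x ∈ U, P.eval x = (f x - a) * u x := fun x hx => by
    rw [hPev, hcd x hx, hu, Finset.mul_sum, ← Finset.sum_sub_distrib]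
    refine Finset.sum_congr rfl fun j _ => ?_
    rw [← sub_mul, hce j _ (H.mapsTo hx)]
    ring
  have hfac : ∀ γ, P.IsRoot γ → ∃ P', P = (X - C γ) * P' ∧ P' ≠ 0 ∧ P'.natDegree < d := by
    intro γ hγ
    obtain ⟨P', hP'⟩ := dvd_iff_isRoot.2 hγ
    have h0 : P' ≠ 0 := fun h => hP0 (by rw [hP', h, mul_zero])
    refine ⟨P', hP', h0, ?_⟩
    have := congrArg natDegree hP'
    rw [natDegree_mul (X_sub_C_ne_zero γ) h0, natDegree_X_sub_C, hPd] at this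
    omega
  -- a root outside `U`, or a zero of `u` in `U`, would give a nonzero polynomial of degree `< d`
  -- divisible by `f - a`
  have hrootU : ∀ γ, P.IsRoot γ → γ ∈ U := by
    intro γ hγ
    by_contra hγU
    obtain ⟨P', hP', h0, hd'⟩ := hfac γ hγ
    refine h0 (indep hd' (mulU (approxOn_inv_sub le_rfl γ hγU).toRigid hur) fun x hx => ?_)
    have hx0 : x - γ ≠ 0 := fun h => hγU (by rwa [← sub_eq_zero.1 h])
    have h1 := hPu x hx
    rw [hP', eval_mul, eval_sub, eval_X, eval_C] at h1
    apply mul_left_cancel₀ hx0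
    rw [h1]
    field_simp
  have hu0 : ∀ γ ∈ U, u γ ≠ 0 := by
    intro γ hγ h
    obtain ⟨u', hu'r, hu'⟩ := RigidOn.exists_eq_sub_mul hw hγ hur h
    have hroot : P.IsRoot γ := by rw [IsRoot.def, hPu γ hγ, h, mul_zero]
    obtain ⟨P', hP', h0, hd'⟩ := hfac γ hroot
    refine h0 (indep hd' hu'r fun x hx => ?_)
    refine sub_eq_zero.1 (RigidOn.eq_zero_of_sub_mul hwp hγ
      (g := fun x => P'.eval x - (f x - a) * u' x)
      ((ApproxOn.poly P').sub (mulU hfr hu'r)) (fun x hx => ?_) x hx)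
    have h1 := hPu x hx
    rw [hP', eval_mul, eval_sub, eval_X, eval_C, hu' x hx] at h1
    rw [mul_sub, h1]
    ring
  classical
  refine ⟨P.roots.toFinset, fun x => ?_, ?_⟩
  · rw [Multiset.mem_toFinset, mem_roots hP0]
    constructor
    · intro hx
      have hxU := hrootU x hx
      refine ⟨hxU, ?_⟩
      rw [IsRoot.def, hPu x hxU] at hx
      exact sub_eq_zero.1 ((mul_eq_zero.1 hx).resolve_right (hu0 x hxU))
    · rintro ⟨hxU, hxa⟩
      rw [IsRoot.def, hPu x hxU, hxa, sub_self, zero_mul]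
  · have h1 : ∀ x ∈ P.roots.toFinset,
        analyticOrderAt (fun z => f z - a) x = ((P.roots.count x : ℕ) : ℕ∞) := by
      intro x hx
      rw [Multiset.mem_toFinset, mem_roots hP0] at hx
      have hxU := hrootU x hx
      have hnh := disc_mem_nhds hwp hxU
      rw [count_roots]
      refine analyticOrderAt_eq_rootMultiplicity ((hf x hxU).sub analyticAt_const)
        ((hur.continuousWithinAt hxU).continuousAt hnh) (hu0 x hxU) hP0 ?_
      filter_upwards [hnh] with z hz using hPu z hz
    rw [Finset.sum_congr rfl h1, ← Nat.cast_sum, Multiset.toFinset_sum_count_eq,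
      splits_iff_card_roots.1 (IsAlgClosed.splits P), hPd]

end CoveringPsi

namespace CoveringPsi


/-! ### The integral rescalings of `Ψ` -/

section Integrality

open PowerSeries

variable {p q : ℕ}

/-- `b_k = 1 + q + … + q ^ (k - 1)`. -/
def geomSum (q k : ℕ) : ℕ := ∑ i ∈ Finset.range k, q ^ i

theorem geomSum_add (q j l : ℕ) : geomSum q (j + l) = geomSum q j + q ^ j * geomSum q l := by
  simp only [geomSum, Finset.sum_range_add, Finset.mul_sum, pow_add]

theorem geomSum_succ (q k : ℕ) : geomSum q (k + 1) = geomSum q k + q ^ k :=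
  Finset.sum_range_succ _ _

theorem le_geomSum (hq : 2 ≤ q) (k : ℕ) : k ≤ geomSum q k := by
  induction k with
  | zero => simp
  | succ k ih =>
    rw [geomSum_succ]
    have := Nat.one_le_pow k q (by omega)
    omega

/-- The reason why only the terms with `j ≤ 1` of the functional equation matter modulo `p`. -/
theorem lt_geomSum (hq : 2 ≤ q) {k : ℕ} (hk : 2 ≤ k) : k < geomSum q k := by
  obtain ⟨k, rfl⟩ := Nat.exists_eq_add_of_le hk
  rw [geomSum_add]
  have h1 : geomSum q 2 = 1 + q := by simp [geomSum, Finset.sum_range_succ]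
  have h2 := le_geomSum hq k
  have h3 : geomSum q k ≤ q ^ 2 * geomSum q k := Nat.le_mul_of_pos_left _ (by positivity)
  omega

/-- `F = p ^ b_k Ψ(T / p ^ k)`, in an integral form. -/
def IsRescaledPsi (p q k : ℕ) (F : PowerSeries ℤ) : Prop :=
  ∀ n, (p : ℤ) ^ geomSum q k * coeff n (psi p q) = (p : ℤ) ^ (k * n) * coeff n F

theorem IsRescaledPsi.unique (hp : p ≠ 0) {k : ℕ} {F G : PowerSeries ℤ}
    (hF : IsRescaledPsi p q k F) (hG : IsRescaledPsi p q k G) : F = G := by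
  ext n
  have hp' : (p : ℤ) ^ (k * n) ≠ 0 := pow_ne_zero _ (by exact_mod_cast hp)
  exact mul_left_cancel₀ hp' ((hF n).symm.trans (hG n))

theorem IsRescaledPsi.pow {k : ℕ} {F : PowerSeries ℤ} (hF : IsRescaledPsi p q k F) (m n : ℕ) :
    (p : ℤ) ^ (m * geomSum q k) * coeff n (psi p q ^ m) = (p : ℤ) ^ (k * n) * coeff n (F ^ m) := by
  have h1 : C ((p : ℤ) ^ geomSum q k) * psi p q = rescale ((p : ℤ) ^ k) F := by
    ext n
    rw [coeff_C_mul, coeff_rescale, hF n, pow_mul]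
  have h2 : coeff n ((C ((p : ℤ) ^ geomSum q k) * psi p q) ^ m) =
      coeff n (rescale ((p : ℤ) ^ k) F ^ m) := by rw [h1]
  rw [mul_pow, ← map_pow, ← map_pow, coeff_C_mul, coeff_rescale, ← pow_mul, ← pow_mul] at h2
  rw [mul_comm m, h2]

/-- The functional equation, rescaled: the `j`-th term of the equation for `F_k` is
`p ^ (b_j - j) * F_{k - j} ^ (q ^ j)` for `j ≤ k` and is divisible by `p` for `j > k`. Modulo `p`
only the terms with `j ≤ 1` survive. -/
theorem exists_isRescaledPsi_of_lt (hq : 2 ≤ q) (k : ℕ) (F : ℕ → PowerSeries ℤ)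
    (hF : ∀ l < k, IsRescaledPsi p q l (F l)) :
    ∃ G, IsRescaledPsi p q k G ∧ ∀ n, (p : ℤ) ∣ coeff n G -
      ((if k ≤ 1 then coeff n (PowerSeries.X : PowerSeries ℤ) else 0) -
        if k = 0 then 0 else coeff n (F (k - 1) ^ q)) := by
  set t : ℕ → ℕ → ℤ := fun n j => if j ≤ k then
    (p : ℤ) ^ (geomSum q j - j) * coeff n (F (k - j) ^ (q ^ j)) else
    (p : ℤ) ^ (geomSum q k + (j - k) * n - j) * coeff n (psi p q ^ (q ^ j)) with ht
  have hlarge : ∀ n j, k < j → coeff n (psi p q ^ (q ^ j)) ≠ 0 →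
      j < geomSum q k + (j - k) * n := by
    intro n j hj h0
    have h1 : q ^ j ≤ n := by
      by_contra! h
      exact h0 (coeff_pow_eq_zero (coeff_zero_psi p q) h)
    have h2 : j < q ^ j := Nat.lt_pow_self (by omega)
    have h3 : n ≤ (j - k) * n := Nat.le_mul_of_pos_left _ (by omega)
    omega
  have hterm : ∀ n j, 1 ≤ n → 1 ≤ j → (p : ℤ) ^ geomSum q k *
      ((p : ℤ) ^ (j * (n - 1)) * coeff n (psi p q ^ (q ^ j))) = (p : ℤ) ^ (k * n) * t n j := by
    intro n j hn hj
    obtain ⟨m, rfl⟩ : ∃ m, n = m + 1 := ⟨n - 1, by omega⟩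
    simp only [ht, Nat.add_sub_cancel]
    split_ifs with hjk
    · obtain ⟨l, rfl⟩ := Nat.exists_eq_add_of_le hjk
      have h1 := (hF l (by omega)).pow (q ^ j) (m + 1)
      obtain ⟨e, he⟩ := Nat.exists_eq_add_of_le (le_geomSum hq j)
      rw [Nat.add_sub_cancel_left, geomSum_add, he, Nat.add_sub_cancel_left]
      calc _ = (p : ℤ) ^ (j + e + j * m) *
            ((p : ℤ) ^ (q ^ j * geomSum q l) * coeff (m + 1) (psi p q ^ q ^ j)) := by ring
        _ = _ := by rw [h1]; ring
    · by_cases h0 : coeff (m + 1) (psi p q ^ (q ^ j)) = 0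
      · rw [h0]; simp
      · have h1 := hlarge _ j (by omega) h0
        rw [← mul_assoc, ← mul_assoc, ← pow_add, ← pow_add]
        congr 2
        obtain ⟨l, rfl⟩ : ∃ l, j = k + l := ⟨j - k, by omega⟩
        rw [Nat.add_sub_cancel_left] at h1 ⊢
        zify [h1.le]
        ring
  refine ⟨PowerSeries.mk fun n => if n = 0 then 0 else
    (if n = 1 then (p : ℤ) ^ (geomSum q k - k) else 0) - ∑ j ∈ Finset.Icc 1 n, t n j, ?_, ?_⟩
  · intro n
    rw [coeff_mk]
    split_ifs with hn hn1
    · rw [hn, coeff_zero_psi]; simp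
    · have h1 := congrArg (coeff n) (psiStep_psi p hq)
      simp only [psiStep, map_sub, coeff_mk, coeff_X] at h1
      rw [← h1, if_pos hn1, mul_sub, mul_sub, Finset.mul_sum, Finset.mul_sum]
      congr 1
      · subst hn1
        rw [mul_one, mul_one, ← pow_add, Nat.add_sub_cancel' (le_geomSum hq k)]
      · exact Finset.sum_congr rfl fun j hj =>
          hterm n j (by omega) (Finset.mem_Icc.1 hj).1
    · have h1 := congrArg (coeff n) (psiStep_psi p hq)
      simp only [psiStep, map_sub, coeff_mk, coeff_X] at h1
      rw [← h1, if_neg hn1, mul_sub, mul_sub, Finset.mul_sum, Finset.mul_sum]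
      congr 1
      exact Finset.sum_congr rfl fun j hj => hterm n j (by omega) (Finset.mem_Icc.1 hj).1
  · intro n
    rw [coeff_mk, coeff_X]
    by_cases hn : n = 0
    · subst hn
      rw [if_pos rfl]
      by_cases hk : k = 0
      · simp [hk]
      · have h1 : coeff 0 (F (k - 1)) = 0 := by
          have := hF (k - 1) (by omega) 0
          simpa [coeff_zero_psi] using this.symm
        have h2 : coeff 0 (F (k - 1) ^ q) = 0 := by
          rw [coeff_zero_eq_constantCoeff_apply] at h1 ⊢
          rw [map_pow, h1, zero_pow (by omega)]
        simp [hk, h2]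
    · rw [if_neg hn]
      have hsplit : ∑ j ∈ Finset.Icc 1 n, t n j = t n 1 + ∑ j ∈ Finset.Icc 2 n, t n j := by
        have h : Finset.Icc 1 n = insert 1 (Finset.Icc 2 n) := by
          ext j
          simp only [Finset.mem_insert, Finset.mem_Icc]
          omega
        rw [h, Finset.sum_insert (by simp)]
      have hbig : ∀ j, 1 ≤ j → (k < j ∨ 2 ≤ j) → (p : ℤ) ∣ t n j := by
        intro j hj1 hj
        simp only [ht]
        split_ifs with hjk
        · have := lt_geomSum hq (hj.resolve_left (by omega))
          exact (dvd_pow_self _ (by omega)).mul_right _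
        · by_cases h0 : coeff n (psi p q ^ (q ^ j)) = 0
          · rw [h0]; simp
          · have := hlarge n j (by omega) h0
            exact (dvd_pow_self _ (by omega)).mul_right _
      have h2 : (p : ℤ) ∣ ∑ j ∈ Finset.Icc 2 n, t n j :=
        Finset.dvd_sum fun j hj => hbig j (by have := (Finset.mem_Icc.1 hj).1; omega)
          (Or.inr (Finset.mem_Icc.1 hj).1)
      have h3 : (p : ℤ) ∣ t n 1 - if k = 0 then 0 else coeff n (F (k - 1) ^ q) := by
        by_cases hk : k = 0
        · rw [if_pos hk, sub_zero]
          exact hbig 1 le_rfl (Or.inl (by omega))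
        · simp [ht, hk, Nat.one_le_iff_ne_zero, geomSum]
      have h4 : (p : ℤ) ∣ (if n = 1 then (p : ℤ) ^ (geomSum q k - k) else 0) -
          if k ≤ 1 then (if n = 1 then 1 else 0) else 0 := by
        by_cases hn1 : n = 1
        · rw [if_pos hn1, if_pos hn1]
          split_ifs with hk
          · have : geomSum q k - k = 0 := by
              interval_cases k <;> simp [geomSum]
            rw [this]; simp
          · have := lt_geomSum hq (k := k) (by omega)
            rw [sub_zero]
            exact dvd_pow_self _ (by omega)
        · simp [hn1]
      rw [hsplit]
      obtain ⟨x, hx⟩ := h2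
      obtain ⟨y, hy⟩ := h3
      obtain ⟨z, hz⟩ := h4
      exact ⟨z - y - x, by linear_combination hz - hy - hx⟩

theorem exists_isRescaledPsi (hq : 2 ≤ q) (k : ℕ) :
    ∃ F, IsRescaledPsi p q k F := by
  induction k using Nat.strong_induction_on with
  | _ k ih =>
    choose! F hF using ih
    obtain ⟨G, hG, -⟩ := exists_isRescaledPsi_of_lt hq k F hF
    exact ⟨G, hG⟩

/-- Modulo `p`, the series `p ^ b_{k + 1} Ψ(T / p ^ (k + 1))` is `± (T ^ (q ^ k) - T ^ (q ^ (k + 1)))`.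
This contains the whole Newton polygon of `Ψ`. -/
theorem IsRescaledPsi.map_eq [Fact p.Prime] {f : ℕ} (hf : 1 ≤ f) (hq : q = p ^ f) (k : ℕ) :
    ∃ s : ℤ, (s = 1 ∨ s = -1) ∧ ∀ F, IsRescaledPsi p q (k + 1) F → ∀ n,
      (p : ℤ) ∣ coeff n F - s * ((if n = q ^ k then 1 else 0) - if n = q ^ (k + 1) then 1 else 0) := by
  have hp : p.Prime := Fact.out
  have hq2 : 2 ≤ q := by
    rw [hq]
    exact hp.two_le.trans (Nat.le_self_pow (by omega) p)
  choose F hF using exists_isRescaledPsi hq2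
  have hrec : ∀ k, (F k).map (Int.castRingHom (ZMod p)) =
      (if k ≤ 1 then PowerSeries.X else 0) -
        if k = 0 then 0 else ((F (k - 1)).map (Int.castRingHom (ZMod p))) ^ q := by
    intro k
    obtain ⟨G, hG, h⟩ := exists_isRescaledPsi_of_lt hq2 k F fun l _ => hF l
    obtain rfl := (hF k).unique hp.ne_zero hG
    ext n
    have h1 := (ZMod.intCast_zmod_eq_zero_iff_dvd _ p).2 (h n)
    rw [coeff_map, ← map_pow, map_sub]
    rw [Int.cast_sub, sub_eq_zero, Int.cast_sub] at h1
    rw [eq_intCast, h1]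
    congr 1
    · split_ifs <;> simp [coeff_X]
    · split_ifs
      · simp
      · rw [coeff_map, eq_intCast]
  have h0 : (F 0).map (Int.castRingHom (ZMod p)) = PowerSeries.X := by simpa using hrec 0
  have hchar : CharP (PowerSeries (ZMod p)) p := by
    refine charP_of_injective_ringHom (f := (PowerSeries.C : ZMod p →+* _)) ?_ p
    exact PowerSeries.C_injective
  have hform : ∀ k, ∃ s : ℤ, (s = 1 ∨ s = -1) ∧ (F (k + 1)).map (Int.castRingHom (ZMod p)) =
      C (s : ZMod p) * (PowerSeries.X ^ (q ^ k) - PowerSeries.X ^ (q ^ (k + 1))) := by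
    intro k
    induction k with
    | zero =>
      refine ⟨1, Or.inl rfl, ?_⟩
      rw [hrec 1]
      simp [h0]
    | succ k ih =>
      obtain ⟨s, hs, h⟩ := ih
      refine ⟨-s ^ q, ?_, ?_⟩
      · rcases hs with rfl | rfl
        · simp
        · rcases neg_one_pow_eq_or ℤ q with h | h <;> simp [h]
      · have h1 := sub_pow_char_pow (p := p) (n := f) (PowerSeries.X ^ (q ^ k))
          (PowerSeries.X ^ (q ^ (k + 1)) : PowerSeries (ZMod p))
        rw [← hq, ← pow_mul, ← pow_mul, ← pow_succ, ← pow_succ] at h1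
        rw [hrec (k + 1 + 1)]
        simp only [Nat.add_sub_cancel, h]
        rw [if_neg (by omega), if_neg (by omega), mul_pow, h1]
        push_cast
        rw [map_neg, map_pow]
        ring
  obtain ⟨s, hs, h⟩ := hform k
  refine ⟨s, hs, fun G hG n => ?_⟩
  obtain rfl := (hF (k + 1)).unique hp.ne_zero hG
  have h1 := congrArg (coeff n) h
  rw [coeff_map, coeff_C_mul, map_sub, coeff_X_pow, coeff_X_pow] at h1
  rw [← ZMod.intCast_zmod_eq_zero_iff_dvd]
  push_cast
  rw [sub_eq_zero, ← h1]
  simp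

end Integrality

end CoveringPsi

namespace CoveringPsi

open Polynomial Filter Topology

variable {p : ℕ} [hp : Fact p.Prime]

/-! ### Valuations and norms -/

theorem isRigidOn_iff {g : ℂ_[p] → ℂ_[p]} {U : Set ℂ_[p]} : IsRigidOn g U ↔ RigidOn g U := by
  constructor
  · intro h ε hε
    obtain ⟨P, Q, H⟩ := h ε hε
    exact ⟨P, Q, trivial, H⟩
  · intro h ε hε
    obtain ⟨P, Q, -, H⟩ := h ε hε
    exact ⟨P, Q, H⟩

theorem one_lt_p : (1 : ℝ) < p := by exact_mod_cast hp.out.one_lt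

theorem p_pos : (0 : ℝ) < p := one_pos.trans one_lt_p

theorem norm_p : ‖(p : ℂ_[p])‖ = (p : ℝ)⁻¹ := by
  have := PadicComplex.norm_extends' p (p : ℚ_[p])
  rw [Padic.norm_p] at this
  rw [← this]
  simp

theorem vp_le_iff {x : ℂ_[p]} {c : ℝ} : vp x ≤ (c : EReal) ↔ (p : ℝ) ^ (-c) ≤ ‖x‖ := by
  unfold vp
  split_ifs with h
  · subst h
    have : 0 < (p : ℝ) ^ (-c) := Real.rpow_pos_of_pos p_pos _
    simp [this]
  · rw [EReal.coe_le_coe_iff, neg_le, Real.le_logb_iff_rpow_le one_lt_p (norm_pos_iff.2 h)]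

theorem le_vp_iff {x : ℂ_[p]} {c : ℝ} : (c : EReal) ≤ vp x ↔ ‖x‖ ≤ (p : ℝ) ^ (-c) := by
  unfold vp
  split_ifs with h
  · subst h
    have : 0 < (p : ℝ) ^ (-c) := Real.rpow_pos_of_pos p_pos _
    simp [this.le]
  · rw [EReal.coe_le_coe_iff, le_neg, Real.logb_le_iff_le_rpow one_lt_p (norm_pos_iff.2 h)]

theorem lt_vp_iff {x : ℂ_[p]} {c : ℝ} : (c : EReal) < vp x ↔ ‖x‖ < (p : ℝ) ^ (-c) := by
  rw [← not_le, vp_le_iff, not_le]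

theorem vp_lt_iff {x : ℂ_[p]} {c : ℝ} : vp x < (c : EReal) ↔ (p : ℝ) ^ (-c) < ‖x‖ := by
  rw [← not_le, le_vp_iff, not_le]

theorem shell_Icc_top (s : ℝ) : shell p (Set.Icc (s : EReal) ⊤) = annulus 0 0 ((p : ℝ) ^ (-s)) := by
  ext x
  simp [shell, annulus, le_vp_iff]

theorem shell_Icc (s t : ℝ) :
    shell p (Set.Icc (s : EReal) t) = annulus 0 ((p : ℝ) ^ (-t)) ((p : ℝ) ^ (-s)) := by
  ext x
  simp [shell, annulus, le_vp_iff, vp_le_iff, and_comm]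

theorem exists_norm_eq_rpow (s : ℚ) : ∃ w : ℂ_[p], w ≠ 0 ∧ ‖w‖ = (p : ℝ) ^ (-(s : ℝ)) := by
  have hp0 : (p : ℂ_[p]) ≠ 0 := by exact_mod_cast hp.out.ne_zero
  obtain ⟨w, hw⟩ := IsAlgClosed.exists_pow_nat_eq ((p : ℂ_[p]) ^ s.num) s.den_pos
  have h1 : ‖w‖ ^ s.den = ((p : ℝ)⁻¹) ^ s.num := by
    rw [← norm_pow, hw, norm_zpow, norm_p]
  have hd : (s.den : ℝ) ≠ 0 := by exact_mod_cast s.den_ne_zero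
  refine ⟨w, fun h => ?_, ?_⟩
  · rw [h, zero_pow s.den_ne_zero] at hw
    exact zpow_ne_zero _ hp0 hw.symm
  · have h2 : ((p : ℝ) ^ (-(s : ℝ))) ^ s.den = ((p : ℝ)⁻¹) ^ s.num := by
      rw [← Real.rpow_natCast, ← Real.rpow_mul p_pos.le, inv_zpow', ← Real.rpow_intCast]
      congr 1
      rw [Rat.cast_def]
      push_cast
      field_simp
    exact (pow_left_inj₀ (norm_nonneg _) (Real.rpow_pos_of_pos p_pos _).le s.den_ne_zero).1
      (h1.trans h2.symm)

theorem exists_rat_rpow_between {x y : ℝ} (hxy : x < y) (hy : 0 < y) :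
    ∃ s : ℚ, x < (p : ℝ) ^ (-(s : ℝ)) ∧ (p : ℝ) ^ (-(s : ℝ)) < y := by
  have hx' : 0 < max x (y / 2) := by positivity
  have h1 : max x (y / 2) < y := max_lt hxy (by linarith)
  obtain ⟨s, hs1, hs2⟩ := exists_rat_btwn (Real.logb_lt_logb (one_lt_p (p := p)) hx' h1)
  refine ⟨-s, ?_, ?_⟩
  · rw [Rat.cast_neg, neg_neg]
    exact (le_max_left _ _).trans_lt ((Real.logb_lt_iff_lt_rpow one_lt_p hx').1 hs1)
  · rw [Rat.cast_neg, neg_neg]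
    exact (Real.lt_logb_iff_rpow_lt one_lt_p hy).1 hs2

theorem exists_norm_between {x y : ℝ} (hxy : x < y) (hy : 0 < y) :
    ∃ w : ℂ_[p], w ≠ 0 ∧ x < ‖w‖ ∧ ‖w‖ < y := by
  obtain ⟨s, h1, h2⟩ := exists_rat_rpow_between (p := p) hxy hy
  obtain ⟨w, hw0, hw⟩ := exists_norm_eq_rpow (p := p) s
  exact ⟨w, hw0, hw ▸ h1, hw ▸ h2⟩

theorem psiBound_eq {q : ℕ} (hq : 2 ≤ q) (n : ℕ) : psiBound q n = -(geomSum q n : ℝ) := by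
  have h : (q : ℝ) ≠ 1 := by
    have : (2 : ℝ) ≤ q := by exact_mod_cast hq
    linarith
  rw [psiBound, geomSum, ← geom_sum_eq h]
  push_cast
  rfl

/-! ### Estimates for `Ψ` -/

/-- The coefficients of `Ψ` in `ℂ_p`. -/
noncomputable def psiCoeff (p q : ℕ) [Fact p.Prime] (n : ℕ) : ℂ_[p] :=
  ((PowerSeries.coeff n (psi p q) : ℤ) : ℂ_[p])

theorem norm_intCast_of_dvd {m : ℤ} (h : (p : ℤ) ∣ m) : ‖(m : ℂ_[p])‖ ≤ (p : ℝ)⁻¹ := by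
  obtain ⟨k, rfl⟩ := h
  push_cast
  rw [norm_mul, norm_p]
  exact mul_le_of_le_one_right (inv_nonneg.2 p_pos.le) (IsUltrametricDist.norm_intCast_le_one _ k)

theorem norm_psiCoeff_mul {q k : ℕ} {F : PowerSeries ℤ} (hF : IsRescaledPsi p q k F) (n : ℕ) :
    ‖psiCoeff p q n‖ * (p : ℝ) ^ (k * n) =
      (p : ℝ) ^ geomSum q k * ‖((PowerSeries.coeff n F : ℤ) : ℂ_[p])‖ := by
  have h := congrArg (fun m : ℤ => ‖(m : ℂ_[p])‖) (hF n)
  push_cast at h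
  rw [norm_mul, norm_mul, norm_pow, norm_pow, norm_p, inv_pow, inv_pow] at h
  have h1 : (p : ℝ) ^ geomSum q k ≠ 0 := pow_ne_zero _ p_pos.ne'
  have h2 : (p : ℝ) ^ (k * n) ≠ 0 := pow_ne_zero _ p_pos.ne'
  rw [inv_mul_eq_div, inv_mul_eq_div, div_eq_div_iff h1 h2] at h
  rw [psiCoeff, h, mul_comm]

theorem norm_psiCoeff_mul_le {q : ℕ} (hq : 2 ≤ q) (k n : ℕ) :
    ‖psiCoeff p q n‖ * (p : ℝ) ^ (k * n) ≤ (p : ℝ) ^ geomSum q k := by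
  obtain ⟨F, hF⟩ := exists_isRescaledPsi (p := p) hq k
  rw [norm_psiCoeff_mul hF]
  exact mul_le_of_le_one_right (pow_nonneg p_pos.le _) (IsUltrametricDist.norm_intCast_le_one _ _)

theorem two_le_q {f q : ℕ} (hf : 1 ≤ f) (hq : q = p ^ f) : 2 ≤ q := by
  rw [hq]
  exact hp.out.two_le.trans (Nat.le_self_pow (by omega) p)

theorem norm_psiCoeff_pow {f q : ℕ} (hf : 1 ≤ f) (hq : q = p ^ f) (i : ℕ) :
    ‖psiCoeff p q (q ^ i)‖ * (p : ℝ) ^ (i * q ^ i) = (p : ℝ) ^ geomSum q i := by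
  have hq2 := two_le_q hf hq
  obtain ⟨F, hF⟩ := exists_isRescaledPsi (p := p) hq2 (i + 1)
  obtain ⟨s, hs, h⟩ := IsRescaledPsi.map_eq hf hq i
  have h1 := h F hF (q ^ i)
  have hne : q ^ i ≠ q ^ (i + 1) := (Nat.pow_lt_pow_right (by omega) (Nat.lt_succ_self i)).ne
  rw [if_pos rfl, if_neg hne, sub_zero, mul_one] at h1
  have h2 := norm_intCast_of_dvd h1
  push_cast at h2
  have hs1 : ‖(s : ℂ_[p])‖ = 1 := by rcases hs with rfl | rfl <;> simp
  have h3 : ‖((PowerSeries.coeff (q ^ i) F : ℤ) : ℂ_[p])‖ = 1 := by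
    rw [← hs1]
    refine ultra_norm_eq_of_sub_lt (h2.trans_lt ?_)
    rw [hs1]
    exact inv_lt_one_of_one_lt₀ one_lt_p
  have h4 := norm_psiCoeff_mul hF (q ^ i)
  rw [h3, mul_one, geomSum_succ, add_mul, one_mul, pow_add, pow_add, ← mul_assoc] at h4
  exact mul_right_cancel₀ (pow_ne_zero _ p_pos.ne') h4

theorem norm_psiCoeff_mul_pow_le {q : ℕ} (hq : 2 ≤ q) (k n : ℕ) {r : ℝ} (hr : 0 ≤ r) :
    ‖psiCoeff p q n‖ * r ^ n ≤ (p : ℝ) ^ geomSum q k * (r / (p : ℝ) ^ k) ^ n := by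
  have h1 := norm_psiCoeff_mul_le (p := p) hq k n
  have h2 : (0 : ℝ) < (p : ℝ) ^ (k * n) := pow_pos p_pos _
  rw [div_pow, ← pow_mul, mul_div_assoc', le_div_iff₀ h2]
  nlinarith [pow_nonneg hr n]

theorem exists_lt_p_pow (r : ℝ) : ∃ k : ℕ, r < (p : ℝ) ^ k := pow_unbounded_of_one_lt r one_lt_p

theorem summable_psi {q : ℕ} (hq : 2 ≤ q) (x : ℂ_[p]) :
    Summable fun n : ℕ => psiCoeff p q n * x ^ n := by
  obtain ⟨k, hk⟩ := exists_lt_p_pow (p := p) ‖x‖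
  have h0 : (0 : ℝ) < (p : ℝ) ^ k := pow_pos p_pos _
  refine Summable.of_norm_bounded (g := fun n => (p : ℝ) ^ geomSum q k * (‖x‖ / (p : ℝ) ^ k) ^ n)
    ((summable_geometric_of_lt_one (by positivity) ((div_lt_one h0).2 hk)).mul_left _) fun n => ?_
  rw [norm_mul, norm_pow]
  exact norm_psiCoeff_mul_pow_le hq k n (norm_nonneg x)

theorem psiFun_eq {q : ℕ} (x : ℂ_[p]) : psiFun p q x = ∑' n, psiCoeff p q n * x ^ n := rfl

theorem rigidOn_psiFun {q : ℕ} (hq : 2 ≤ q) {U : Set ℂ_[p]} {r : ℝ} (hU : ∀ x ∈ U, ‖x‖ ≤ r) :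
    RigidOn (psiFun p q) U := by
  refine ApproxOn.of_approx fun ε hε => ?_
  obtain ⟨k, hk⟩ := exists_lt_p_pow (p := p) (max r 0)
  have h0 : (0 : ℝ) < (p : ℝ) ^ k := pow_pos p_pos _
  have hlt : max r 0 / (p : ℝ) ^ k < 1 := (div_lt_one h0).2 hk
  have h0' : 0 ≤ max r 0 / (p : ℝ) ^ k := by positivity
  have h1 : Tendsto (fun N : ℕ => (p : ℝ) ^ geomSum q k * (max r 0 / (p : ℝ) ^ k) ^ N) atTop (𝓝 0) := by
    simpa using (tendsto_pow_atTop_nhds_zero_of_lt_one h0' hlt).const_mul _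
  obtain ⟨N, hN⟩ := (h1.eventually (gt_mem_nhds hε)).exists
  refine ⟨_, ApproxOn.poly (∑ n ∈ Finset.range N, C (psiCoeff p q n) * X ^ n), fun x hx => ?_⟩
  rw [psiFun_eq, ← (summable_psi hq x).sum_add_tsum_nat_add N, eval_finsetSum]
  simp only [eval_mul, eval_C, eval_pow, eval_X, add_sub_cancel_left]
  refine lt_of_le_of_lt (IsUltrametricDist.norm_tsum_le_of_forall_le_of_nonneg (by positivity)
    fun n => ?_) hN
  rw [norm_mul, norm_pow]
  calc ‖psiCoeff p q (n + N)‖ * ‖x‖ ^ (n + N) ≤ ‖psiCoeff p q (n + N)‖ * (max r 0) ^ (n + N) := by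
        have := (hU x hx).trans (le_max_left r 0)
        gcongr
    _ ≤ _ := norm_psiCoeff_mul_pow_le hq k (n + N) (le_max_right _ _)
    _ ≤ _ := by
      gcongr (p : ℝ) ^ geomSum q k * ?_
      exact pow_le_pow_of_le_one h0' hlt.le (Nat.le_add_left _ _)

theorem analyticAt_psiFun {q : ℕ} (hq : 2 ≤ q) (x : ℂ_[p]) : AnalyticAt ℂ_[p] (psiFun p q) x := by
  set φ := FormalMultilinearSeries.ofScalars ℂ_[p] (𝕜 := ℂ_[p]) (psiCoeff p q) with hφ
  have hsum : φ.sum = psiFun p q := by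
    funext y
    rw [hφ]
    simp only [FormalMultilinearSeries.sum, FormalMultilinearSeries.ofScalars_apply_eq, psiFun_eq,
      smul_eq_mul]
  have hrad : φ.radius = ⊤ := by
    refine φ.radius_eq_top_of_summable_norm fun r => ?_
    obtain ⟨k, hk⟩ := exists_lt_p_pow (p := p) r
    have h0 : (0 : ℝ) < (p : ℝ) ^ k := pow_pos p_pos _
    refine Summable.of_nonneg_of_le (fun n => by positivity) (fun n => ?_)
      ((summable_geometric_of_lt_one (r := r / (p : ℝ) ^ k) (by positivity)
        ((div_lt_one h0).2 hk)).mul_left ((p : ℝ) ^ geomSum q k))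
    rw [hφ, FormalMultilinearSeries.ofScalars_norm]
    exact norm_psiCoeff_mul_pow_le hq k n r.2
  have h := φ.hasFPowerSeriesOnBall (by rw [hrad]; exact ENNReal.zero_lt_top)
  rw [hsum, hrad] at h
  exact h.analyticAt_of_mem (by simp)

theorem norm_psiFun_le {q : ℕ} (hq : 2 ≤ q) {k : ℕ} {x : ℂ_[p]} (hx : ‖x‖ ≤ (p : ℝ) ^ k) :
    ‖psiFun p q x‖ ≤ (p : ℝ) ^ geomSum q k := by
  rw [psiFun_eq]
  refine IsUltrametricDist.norm_tsum_le_of_forall_le_of_nonneg (pow_nonneg p_pos.le _) fun n => ?_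
  rw [norm_mul, norm_pow]
  refine le_trans ?_ (norm_psiCoeff_mul_le hq k n)
  rw [pow_mul]
  gcongr

/-- Between the radii `p ^ i` and `p ^ (i + 1)` the term of degree `q ^ i` dominates `Ψ`. -/
theorem norm_psiFun_sub_le {f q : ℕ} (hf : 1 ≤ f) (hq : q = p ^ f) {i : ℕ} {r : ℝ}
    (h1 : (p : ℝ) ^ i < r) (h2 : r < (p : ℝ) ^ (i + 1)) {x : ℂ_[p]} (hx : ‖x‖ ≤ r) :
    ‖psiFun p q x - psiCoeff p q (q ^ i) * x ^ (q ^ i)‖ ≤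
      max ((p : ℝ) ^ i / r) (r / (p : ℝ) ^ (i + 1)) * (‖psiCoeff p q (q ^ i)‖ * r ^ (q ^ i)) := by
  have hq2 := two_le_q hf hq
  set d := q ^ i with hd
  have hpi : (0 : ℝ) < (p : ℝ) ^ i := pow_pos p_pos _
  have hpi' : (0 : ℝ) < (p : ℝ) ^ (i + 1) := pow_pos p_pos _
  have hr : 0 < r := hpi.trans h1
  have e1 := norm_psiCoeff_pow (p := p) hf hq i
  rw [← hd] at e1
  have e2 : ‖psiCoeff p q d‖ * (p : ℝ) ^ ((i + 1) * d) = (p : ℝ) ^ geomSum q (i + 1) := by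
    rw [geomSum_succ, pow_add, ← e1, add_mul, one_mul, pow_add, hd]
    ring
  rw [psiFun_eq, (summable_psi hq2 x).tsum_eq_add_tsum_ite d, add_sub_cancel_left]
  refine IsUltrametricDist.norm_tsum_le_of_forall_le_of_nonneg (by positivity) fun n => ?_
  split_ifs with hn
  · rw [norm_zero]
    positivity
  rw [norm_mul, norm_pow]
  refine (mul_le_mul_of_nonneg_left (pow_le_pow_left₀ (norm_nonneg _) hx n) (norm_nonneg _)).trans ?_
  rcases lt_or_gt_of_ne hn with h | h
  · obtain ⟨m, hm⟩ := Nat.exists_eq_add_of_lt h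
    have hb := norm_psiCoeff_mul_le (p := p) hq2 i n
    rw [← e1, hm, pow_mul, pow_mul, show n + m + 1 = n + (m + 1) by ring, pow_add] at hb
    have hb' : ‖psiCoeff p q n‖ ≤ ‖psiCoeff p q d‖ * ((p : ℝ) ^ i) ^ (m + 1) := by
      rw [hm, show n + m + 1 = n + (m + 1) by ring]
      have h3 : (0 : ℝ) < ((p : ℝ) ^ i) ^ n := pow_pos hpi _
      refine le_of_mul_le_mul_right (hb.trans (le_of_eq ?_)) h3
      ring
    calc ‖psiCoeff p q n‖ * r ^ n ≤ ‖psiCoeff p q d‖ * ((p : ℝ) ^ i) ^ (m + 1) * r ^ n := by gcongr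
      _ = ((p : ℝ) ^ i / r) ^ (m + 1) * (‖psiCoeff p q d‖ * r ^ d) := by
        rw [div_pow, hm]
        field_simp
        ring
      _ ≤ ((p : ℝ) ^ i / r) * (‖psiCoeff p q d‖ * r ^ d) := by
        gcongr
        exact pow_le_of_le_one (by positivity) ((div_lt_one hr).2 h1).le (by omega)
      _ ≤ _ := by
        gcongr
        exact le_max_left _ _
  · obtain ⟨m, hm⟩ := Nat.exists_eq_add_of_lt h
    have hb := norm_psiCoeff_mul_pow_le (p := p) hq2 (i + 1) n hr.le
    have h3 : (0 : ℝ) < ((p : ℝ) ^ (i + 1)) ^ d := pow_pos hpi' _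
    calc ‖psiCoeff p q n‖ * r ^ n ≤ (p : ℝ) ^ geomSum q (i + 1) * (r / (p : ℝ) ^ (i + 1)) ^ n := hb
      _ = (r / (p : ℝ) ^ (i + 1)) ^ (m + 1) * (‖psiCoeff p q d‖ * r ^ d) := by
        rw [← e2, hm, pow_mul, show d + m + 1 = (m + 1) + d by ring, pow_add (r / _), div_pow _ _ d]
        field_simp
      _ ≤ (r / (p : ℝ) ^ (i + 1)) * (‖psiCoeff p q d‖ * r ^ d) := by
        gcongr
        exact pow_le_of_le_one (by positivity) ((div_lt_one hpi').2 h2).le (by omega)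
      _ ≤ _ := by
        gcongr
        exact le_max_right _ _

/-- On the circle of radius `p ^ (i + 1)`, up to scaling, `Ψ` is `± (t ^ (q ^ i) - t ^ (q ^ (i + 1)))`
modulo `p`. -/
theorem exists_norm_psiFun_sub_le {f q : ℕ} (hf : 1 ≤ f) (hq : q = p ^ f) (i : ℕ) :
    ∃ s : ℂ_[p], (s = 1 ∨ s = -1) ∧ ∀ t : ℂ_[p], ‖t‖ ≤ 1 →
      ‖(p : ℂ_[p]) ^ geomSum q (i + 1) * psiFun p q (t / (p : ℂ_[p]) ^ (i + 1)) -
        s * (t ^ (q ^ i) - t ^ (q ^ (i + 1)))‖ ≤ (p : ℝ)⁻¹ := by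
  have hq2 := two_le_q hf hq
  have hp0 : (p : ℂ_[p]) ≠ 0 := by exact_mod_cast hp.out.ne_zero
  obtain ⟨F, hF⟩ := exists_isRescaledPsi (p := p) hq2 (i + 1)
  obtain ⟨s, hs, h⟩ := IsRescaledPsi.map_eq hf hq i
  refine ⟨(s : ℂ_[p]), ?_, fun t ht => ?_⟩
  · rcases hs with rfl | rfl
    · left; simp
    · right; simp
  have hterm : ∀ n, (p : ℂ_[p]) ^ geomSum q (i + 1) *
      (psiCoeff p q n * (t / (p : ℂ_[p]) ^ (i + 1)) ^ n) =
      ((PowerSeries.coeff n F : ℤ) : ℂ_[p]) * t ^ n := by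
    intro n
    have h1 := congrArg (fun m : ℤ => (m : ℂ_[p])) (hF n)
    push_cast at h1
    rw [← mul_assoc, psiCoeff, h1, div_pow, pow_mul]
    field_simp
  have h1 : HasSum (fun n => ((PowerSeries.coeff n F : ℤ) : ℂ_[p]) * t ^ n)
      ((p : ℂ_[p]) ^ geomSum q (i + 1) * psiFun p q (t / (p : ℂ_[p]) ^ (i + 1))) := by
    have := (summable_psi hq2 (t / (p : ℂ_[p]) ^ (i + 1))).hasSum.mul_left
      ((p : ℂ_[p]) ^ geomSum q (i + 1))
    rw [← psiFun_eq] at this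
    simpa only [hterm] using this
  have hmono : ∀ d : ℕ, HasSum (fun n => (if n = d then (1 : ℂ_[p]) else 0) * t ^ n) (t ^ d) := by
    intro d
    have := hasSum_single (f := fun n => (if n = d then (1 : ℂ_[p]) else 0) * t ^ n) d
      (fun n hn => by simp [hn])
    simpa using this
  have h2 := h1.sub (((hmono (q ^ i)).sub (hmono (q ^ (i + 1)))).mul_left (s : ℂ_[p]))
  rw [← h2.tsum_eq]
  refine IsUltrametricDist.norm_tsum_le_of_forall_le_of_nonneg (inv_nonneg.2 p_pos.le) fun n => ?_
  have h3 := norm_intCast_of_dvd (h F hF n)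
  push_cast at h3
  have e : ((PowerSeries.coeff n F : ℤ) : ℂ_[p]) * t ^ n - (s : ℂ_[p]) *
      ((if n = q ^ i then (1 : ℂ_[p]) else 0) * t ^ n -
        (if n = q ^ (i + 1) then (1 : ℂ_[p]) else 0) * t ^ n) =
      (((PowerSeries.coeff n F : ℤ) : ℂ_[p]) - (s : ℂ_[p]) *
      ((if n = q ^ i then (1 : ℂ_[p]) else 0) -
        (if n = q ^ (i + 1) then (1 : ℂ_[p]) else 0))) * t ^ n := by ring
  rw [e, norm_mul, norm_pow]
  exact (mul_le_of_le_one_right (norm_nonneg _) (pow_le_one₀ (norm_nonneg _) ht)).trans h3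

end CoveringPsi

namespace CoveringPsi

open Polynomial Filter Topology

/-! ### Disjoint unions of discs -/

section Union

variable {K : Type*} [NontriviallyNormedField K] [IsUltrametricDist K]

/-- The function equal to `1` on the disc `‖x - β‖ ≤ r` and to `0` for `‖x - β‖ ≥ D > r` is the
limit of `1 / (1 - ((x - β) / c) ^ N)`, where `r < ‖c‖ < D`. -/
theorem rigidOn_indicator_one {β c : K} {r D : ℝ} (hr : 0 ≤ r) (hrc : r < ‖c‖) (hcD : ‖c‖ < D)
    {W : Set K} (hW : ∀ x ∈ W, x ∈ annulus β 0 r ∨ D ≤ ‖x - β‖) :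
    RigidOn ((annulus β 0 r).indicator fun _ => 1) W := by
  have hc : 0 < ‖c‖ := hr.trans_lt hrc
  have hc0 : c ≠ 0 := norm_pos_iff.1 hc
  have hD : 0 < D := hc.trans hcD
  intro ε hε
  obtain ⟨N₁, hN₁⟩ := tendsto_geom_error hr hrc one_pos hε
  obtain ⟨N₂, hN₂⟩ := tendsto_geom_error hc.le hcD one_pos hε
  rw [div_one] at hN₁ hN₂
  set N := N₁ + N₂ + 1 with hN
  have hb₁ : (r / ‖c‖) ^ N < ε := lt_of_le_of_lt
    (pow_le_pow_of_le_one (by positivity) ((div_lt_one hc).2 hrc).le (by omega)) hN₁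
  have hb₂ : (‖c‖ / D) ^ N < ε := lt_of_le_of_lt
    (pow_le_pow_of_le_one (by positivity) ((div_lt_one hD).2 hcD).le (by omega)) hN₂
  refine ⟨1, 1 - C (c⁻¹ ^ N) * (X - C β) ^ N, trivial, fun x hx => ?_⟩
  have hev : (1 - C (c⁻¹ ^ N) * (X - C β) ^ N).eval x = 1 - ((x - β) / c) ^ N := by
    simp [div_eq_mul_inv, mul_pow, mul_comm]
  rw [hev, eval_one]
  rcases hW x hx with h | h
  · have h1 : ‖((x - β) / c) ^ N‖ ≤ (r / ‖c‖) ^ N := by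
      rw [norm_pow, norm_div]
      have := h.2
      gcongr
    have h2 : ‖((x - β) / c) ^ N‖ < 1 := h1.trans_lt
      (pow_lt_one₀ (by positivity) ((div_lt_one hc).2 hrc) (by omega))
    have h3 : ‖1 - ((x - β) / c) ^ N‖ = 1 := by
      rw [ultra_norm_sub_eq_left (by rwa [norm_one]), norm_one]
    have h4 : 1 - ((x - β) / c) ^ N ≠ 0 := norm_ne_zero_iff.1 (by rw [h3]; exact one_ne_zero)
    refine ⟨h4, ?_⟩
    have e : 1 - 1 / (1 - ((x - β) / c) ^ N) = -(((x - β) / c) ^ N / (1 - ((x - β) / c) ^ N)) := by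
      generalize ((x - β) / c) ^ N = y at h4 ⊢
      field_simp
      ring
    rw [Set.indicator_of_mem h, e, norm_neg, norm_div, h3, div_one]
    exact h1.trans_lt hb₁
  · have hx0 : 0 < ‖x - β‖ := hD.trans_le h
    have h1 : 1 < ‖((x - β) / c) ^ N‖ := by
      rw [norm_pow, norm_div]
      exact one_lt_pow₀ ((one_lt_div hc).2 (hcD.trans_le h)) (by omega)
    have h3 : ‖1 - ((x - β) / c) ^ N‖ = ‖((x - β) / c) ^ N‖ := by
      rw [norm_sub_rev, ultra_norm_sub_eq_left (by rwa [norm_one])]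
    have h4 : 1 - ((x - β) / c) ^ N ≠ 0 := norm_ne_zero_iff.1 (by rw [h3]; linarith)
    refine ⟨h4, ?_⟩
    have h5 : x ∉ annulus β 0 r := fun hx' => absurd (h.trans hx'.2) (by linarith)
    rw [Set.indicator_of_notMem h5, zero_sub, norm_neg, norm_div, norm_one, h3, norm_pow, norm_div,
      one_div, ← inv_pow, inv_div]
    refine lt_of_le_of_lt ?_ hb₂
    gcongr

variable [IsAlgClosed K]

theorem RigidOn.indicator {β c : K} {r D : ℝ} (hr : 0 ≤ r) (hrc : r < ‖c‖) (hcD : ‖c‖ < D)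
    {W : Set K} (hW : ∀ x ∈ W, x ∈ annulus β 0 r ∨ D ≤ ‖x - β‖) (hWb : ∃ ρ, ∀ x ∈ W, ‖x - β‖ ≤ ρ)
    {g : K → K} (hg : RigidOn g (annulus β 0 r)) : RigidOn ((annulus β 0 r).indicator g) W := by
  refine ApproxOn.of_approx fun ε hε => ?_
  obtain ⟨P, hP⟩ := hg.exists_poly hε
  obtain ⟨ρ, hρ⟩ := hWb
  obtain ⟨M, hM⟩ := exists_norm_eval_le P β ρ
  refine ⟨_, (rigidOn_indicator_one hr hrc hcD hW).mul (ApproxOn.poly P) (M := 1) (M' := M)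
    (fun x _ => ?_) (fun x hx => hM x (hρ x hx)), fun x _ => ?_⟩
  · by_cases h : x ∈ annulus β 0 r
    · simp [Set.indicator_of_mem h]
    · simp [Set.indicator_of_notMem h]
  · by_cases h : x ∈ annulus β 0 r
    · simpa [Set.indicator_of_mem h] using hP x h
    · simpa [Set.indicator_of_notMem h] using hε

/-- Freeness on finitely many discs of the same radius at a positive distance from each other gives
freeness on their union. -/
theorem HasFreeBasis.iUnion {ι κ : Type*} [Fintype ι] [Fintype κ] {f : K → K} {V : Set K}
    {β : ι → K} {c : K} {r D : ℝ} (hr : 0 ≤ r) (hrc : r < ‖c‖) (hcD : ‖c‖ < D)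
    (hβ : ∀ i j, i ≠ j → ∀ x ∈ annulus (β j) 0 r, D ≤ ‖x - β i‖) {e : ι → κ → K → K}
    (H : ∀ i, HasFreeBasis f (annulus (β i) 0 r) V (e i)) :
    HasFreeBasis f (⋃ i, annulus (β i) 0 r) V
      (fun (ij : ι × κ) => (annulus (β ij.1) 0 r).indicator (e ij.1 ij.2)) := by
  classical
  have hW : ∀ i, ∀ x ∈ ⋃ j, annulus (β j) 0 r, x ∈ annulus (β i) 0 r ∨ D ≤ ‖x - β i‖ := by
    intro i x hx
    obtain ⟨j, hj⟩ := Set.mem_iUnion.1 hx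
    by_cases hij : i = j
    · exact Or.inl (hij ▸ hj)
    · exact Or.inr (hβ i j hij x hj)
  have hWb : ∀ i, ∃ ρ, ∀ x ∈ ⋃ j, annulus (β j) 0 r, ‖x - β i‖ ≤ ρ := by
    intro i
    refine ⟨r + ∑ j, ‖β j - β i‖, fun x hx => ?_⟩
    obtain ⟨j, hj⟩ := Set.mem_iUnion.1 hx
    calc ‖x - β i‖ = ‖(x - β j) + (β j - β i)‖ := by rw [sub_add_sub_cancel]
      _ ≤ ‖x - β j‖ + ‖β j - β i‖ := norm_add_le _ _
      _ ≤ _ := add_le_add hj.2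
        (Finset.single_le_sum (f := fun j => ‖β j - β i‖) (fun _ _ => norm_nonneg _)
          (Finset.mem_univ j))
  have hext : ∀ i {g : K → K}, RigidOn g (annulus (β i) 0 r) →
      RigidOn ((annulus (β i) 0 r).indicator g) (⋃ j, annulus (β j) 0 r) :=
    fun i _ hg => hg.indicator hr hrc hcD (hW i) (hWb i)
  have hsep : ∀ i j, i ≠ j → ∀ x ∈ annulus (β j) 0 r, x ∉ annulus (β i) 0 r := fun i j hij x hx hx' =>
    absurd (hβ i j hij x hx) (by linarith [hx'.2])
  have hsum : ∀ (g : ι → K → K) (j : ι), ∀ x ∈ annulus (β j) 0 r,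
      ∑ i, (annulus (β i) 0 r).indicator (g i) x = g j x := by
    intro g j x hx
    rw [Finset.sum_eq_single j (fun i _ hij => Set.indicator_of_notMem (hsep i j hij x hx) _)
      (fun h => absurd (Finset.mem_univ j) h), Set.indicator_of_mem hx]
  have hsub : ∀ i, annulus (β i) 0 r ⊆ ⋃ j, annulus (β j) 0 r := fun i =>
    Set.subset_iUnion (fun j => annulus (β j) 0 r) i
  have hcomb : ∀ (b : ι × κ → K → K) (i : ι), ∀ x ∈ annulus (β i) 0 r,
      ∑ ij : ι × κ, b ij (f x) * (annulus (β ij.1) 0 r).indicator (e ij.1 ij.2) x =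
        ∑ k, b (i, k) (f x) * e i k x := by
    intro b i x hx
    rw [Fintype.sum_prod_type, ← hsum (fun i x => ∑ k, b (i, k) (f x) * e i k x) i x hx]
    refine Finset.sum_congr rfl fun i' _ => ?_
    by_cases h : x ∈ annulus (β i') 0 r
    · simp [Set.indicator_of_mem h]
    · simp [Set.indicator_of_notMem h]
  refine ⟨fun x hx => ?_, fun c hc => ?_, fun ij => hext _ ((H ij.1).rigid ij.2), fun h hh => ?_,
    fun b hb h0 ij y hy => ?_⟩
  · obtain ⟨i, hi⟩ := Set.mem_iUnion.1 hx
    exact (H i).mapsTo hi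
  · refine (ApproxOn.sum Finset.univ fun i _ => hext i ((H i).pullback c hc)).congr fun x hx => ?_
    obtain ⟨i, hi⟩ := Set.mem_iUnion.1 hx
    exact hsum (fun _ x => c (f x)) i x hi
  · choose b hb hbe using fun i => (H i).span h (hh.mono (hsub i))
    refine ⟨fun ij => b ij.1 ij.2, fun ij => hb ij.1 ij.2, fun x hx => ?_⟩
    obtain ⟨i, hi⟩ := Set.mem_iUnion.1 hx
    rw [hcomb (fun ij => b ij.1 ij.2) i x hi]
    exact hbe i x hi
  · refine (H ij.1).unique (fun k => b (ij.1, k)) (fun k => hb _) (fun x hx => ?_) ij.2 y hy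
    rw [← hcomb b ij.1 x hx]
    exact h0 x (hsub _ hx)

end Union

/-! ### Finite maps between subsets of `ℂ_p` -/

section Finite

variable {p : ℕ} [hp : Fact p.Prime]

theorem HasFreeBasis.isFreeOfRank {f : ℂ_[p] → ℂ_[p]} {U V : Set ℂ_[p]} {ι : Type*} [Fintype ι]
    {e : ι → ℂ_[p] → ℂ_[p]} (H : HasFreeBasis f U V e) {d : ℕ} (hd : Fintype.card ι = d) :
    IsFreeOfRank f U V d := by
  let σ : Fin d ≃ ι := (Fintype.equivFinOfCardEq hd).symm
  refine ⟨H.mapsTo, fun c hc => isRigidOn_iff.2 (H.pullback c (isRigidOn_iff.1 hc)),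
    fun j => e (σ j), fun j => isRigidOn_iff.2 (H.rigid _), fun h hh => ?_, fun c hc h0 j y hy => ?_⟩
  · obtain ⟨c, hc, h⟩ := H.span h (isRigidOn_iff.1 hh)
    refine ⟨fun j => c (σ j), fun j => isRigidOn_iff.2 (hc _), fun x hx => ?_⟩
    rw [h x hx]
    exact (Equiv.sum_comp σ fun i => c i (f x) * e i x).symm
  · have h1 := H.unique (fun i => c (σ.symm i)) (fun i => isRigidOn_iff.1 (hc _)) (fun x hx => ?_)
      (σ j) y hy
    · simpa using h1
    · rw [← h0 x hx, ← Equiv.sum_comp σ]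
      simp

theorem HasFibreDegree.congr {f : ℂ_[p] → ℂ_[p]} {X X' : Set ℂ_[p]} {a : ℂ_[p]} {d : ℕ}
    (H : HasFibreDegree f X a d) (h : ∀ x, f x = a → (x ∈ X ↔ x ∈ X')) : HasFibreDegree f X' a d := by
  obtain ⟨S, hS, hd⟩ := H
  refine ⟨S, fun x => ?_, hd⟩
  rw [hS]
  exact ⟨fun ⟨h1, h2⟩ => ⟨(h x h2).1 h1, h2⟩, fun ⟨h1, h2⟩ => ⟨(h x h2).2 h1, h2⟩⟩

theorem HasFibreDegree.of_sub {f : ℂ_[p] → ℂ_[p]} {X : Set ℂ_[p]} {a b : ℂ_[p]} {d : ℕ}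
    (H : HasFibreDegree (fun x => f x - a) X b d) : HasFibreDegree f X (a + b) d := by
  obtain ⟨S, hS, hd⟩ := H
  refine ⟨S, fun x => ?_, ?_⟩
  · rw [hS, sub_eq_iff_eq_add']
  · simpa only [sub_sub] using hd

theorem HasFibreDegree.iUnion {ι : Type*} [Fintype ι] {f : ℂ_[p] → ℂ_[p]} {X : ι → Set ℂ_[p]}
    {a : ℂ_[p]} {d : ℕ} (hX : ∀ i j, i ≠ j → Disjoint (X i) (X j))
    (H : ∀ i, HasFibreDegree f (X i) a d) :
    HasFibreDegree f (⋃ i, X i) a (Fintype.card ι * d) := by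
  classical
  choose S hS hd using H
  refine ⟨Finset.univ.biUnion S, fun x => ?_, ?_⟩
  · simp [hS]
  · rw [Finset.sum_biUnion, Finset.sum_congr rfl fun i _ => hd i]
    · simp
    · intro i _ j _ hij
      rw [Function.onFun, Finset.disjoint_left]
      intro x hx hx'
      exact Set.disjoint_left.1 (hX i j hij) ((hS i x).1 hx).1 ((hS j x).1 hx').1

end Finite

end CoveringPsi

namespace CoveringPsi

open Polynomial Filter Topology

variable {p : ℕ} [hp : Fact p.Prime]

/-! ### The equation `t - t ^ q = b` -/

theorem norm_add_pow_sub_le (m : ℕ) {x y : ℂ_[p]} (hx : ‖x‖ ≤ 1) (hy : ‖y‖ ≤ 1) :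
    ‖(x + y) ^ p ^ m - x ^ p ^ m - y ^ p ^ m‖ ≤ (p : ℝ)⁻¹ := by
  obtain ⟨N, hN⟩ : ∃ N, p ^ m = N + 1 := ⟨p ^ m - 1, by have := hp.out.pos; have := Nat.pow_pos (n := m) this; omega⟩
  have e : (x + y) ^ p ^ m - x ^ p ^ m - y ^ p ^ m =
      ∑ k ∈ Finset.range N, x ^ (k + 1) * y ^ (N + 1 - (k + 1)) * ((N + 1).choose (k + 1) : ℂ_[p]) := by
    rw [hN, add_pow, Finset.sum_range_succ, Finset.sum_range_succ']
    simp
  rw [e]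
  refine ultra_sum_le (inv_nonneg.2 p_pos.le) fun k hk => ?_
  have hd : (p : ℤ) ∣ ((N + 1).choose (k + 1) : ℤ) := by
    have := hp.out.dvd_choose_pow (n := m) (k := k + 1) (by omega)
      (by rw [hN]; have := Finset.mem_range.1 hk; omega)
    rw [hN] at this
    exact_mod_cast this
  have h1 := norm_intCast_of_dvd hd
  rw [Int.cast_natCast] at h1
  rw [norm_mul, norm_mul, norm_pow, norm_pow]
  have h2 : ‖x‖ ^ (k + 1) * ‖y‖ ^ (N + 1 - (k + 1)) ≤ 1 :=
    mul_le_one₀ (pow_le_one₀ (norm_nonneg _) hx) (by positivity) (pow_le_one₀ (norm_nonneg _) hy)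
  exact (mul_le_of_le_one_left (norm_nonneg _) h2).trans h1

/-- For `‖b‖ ≤ 1` the equation `t - t ^ q = b` has `q` solutions, any two of them at distance `1`:
the derivative `1 - q t ^ (q - 1)` is a unit. -/
theorem exists_roots {f q : ℕ} (hf : 1 ≤ f) (hq : q = p ^ f) {b : ℂ_[p]} (hb : ‖b‖ ≤ 1) :
    ∃ B : Finset ℂ_[p], B.card = q ∧ (∀ β ∈ B, β - β ^ q = b ∧ ‖β‖ ≤ 1) ∧
      (∀ β ∈ B, ∀ γ ∈ B, β ≠ γ → ‖β - γ‖ = 1) ∧ ∀ t, ‖t - t ^ q - b‖ = ∏ β ∈ B, ‖t - β‖ := by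
  classical
  have hq2 := two_le_q hf hq
  set P : ℂ_[p][X] := X ^ q - (X - C b) with hP
  have hdeg : (X - C b).degree < (q : WithBot ℕ) := by
    rw [degree_X_sub_C]
    exact_mod_cast hq2
  have hmonic : P.Monic := monic_X_pow_sub hdeg
  have hnat : P.natDegree = q := by
    refine natDegree_eq_of_degree_eq_some ?_
    rw [hP, degree_sub_eq_left_of_degree_lt (by rwa [degree_X_pow]), degree_X_pow]
  have hsplit : P.Splits := IsAlgClosed.splits P
  have hev : ∀ t, P.eval t = -(t - t ^ q - b) := fun t => by
    simp [hP]
    ring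
  have hroot : ∀ β ∈ P.roots, β - β ^ q = b ∧ ‖β‖ ≤ 1 := by
    intro β hβ
    have h1 := (mem_roots hmonic.ne_zero).1 hβ
    rw [IsRoot.def, hev, neg_eq_zero, sub_eq_zero] at h1
    refine ⟨h1, ?_⟩
    by_contra! h
    have h2 : ‖β‖ < ‖β ^ q‖ := by
      rw [norm_pow]
      exact lt_self_pow₀ h (by omega)
    have h3 : ‖β ^ q - β‖ = ‖β ^ q‖ := ultra_norm_sub_eq_left h2
    rw [norm_sub_rev, h1] at h3
    linarith
  have hdiff : ∀ β ∈ P.roots, ∀ γ ∈ P.roots.erase β, ‖β - γ‖ = 1 := by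
    intro β hβ γ hγ
    have hle : ∀ γ ∈ P.roots.erase β, ‖β - γ‖ ≤ 1 := fun γ hγ =>
      ultra_sub_le (hroot β hβ).2 (hroot γ (Multiset.mem_of_mem_erase hγ)).2
    have h1 := hsplit.eval_root_derivative hmonic hβ
    have h2 : P.derivative.eval β = (q : ℂ_[p]) * β ^ (q - 1) - 1 := by
      rw [hP, derivative_sub, derivative_X_pow]
      simp
    have hqn : ‖(q : ℂ_[p])‖ < 1 := by
      rw [hq, Nat.cast_pow, norm_pow, norm_p]
      exact pow_lt_one₀ (inv_nonneg.2 p_pos.le) (inv_lt_one_of_one_lt₀ one_lt_p) (by omega)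
    have h3 : ‖(q : ℂ_[p]) * β ^ (q - 1)‖ < 1 := by
      rw [norm_mul, norm_pow]
      exact (mul_le_of_le_one_right (norm_nonneg _)
        (pow_le_one₀ (norm_nonneg _) (hroot β hβ).2)).trans_lt hqn
    have h4 : ‖P.derivative.eval β‖ = 1 := by
      rw [h2, norm_sub_rev, ultra_norm_sub_eq_left (by rwa [norm_one]), norm_one]
    rw [h1, ← Multiset.cons_erase hγ, Multiset.map_cons, Multiset.prod_cons, norm_mul] at h4
    have h5 : ‖((((P.roots.erase β).erase γ).map (β - ·)).prod)‖ ≤ 1 := by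
      have : ∀ s : Multiset ℂ_[p], (∀ γ ∈ s, ‖β - γ‖ ≤ 1) → ‖(s.map (β - ·)).prod‖ ≤ 1 := by
        intro s
        induction s using Multiset.induction_on with
        | empty => simp
        | cons a s ih =>
          intro h
          rw [Multiset.map_cons, Multiset.prod_cons, norm_mul]
          exact mul_le_one₀ (h a (by simp)) (norm_nonneg _) (ih fun γ hγ => h γ (by simp [hγ]))
      exact this _ fun γ' hγ' => hle γ' (Multiset.mem_of_mem_erase hγ')
    refine le_antisymm (hle γ hγ) ?_
    rw [← h4]
    exact mul_le_of_le_one_right (norm_nonneg _) h5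
  have hnodup : P.roots.Nodup := by
    rw [Multiset.nodup_iff_count_le_one]
    intro β
    by_contra! h
    have hβ : β ∈ P.roots := Multiset.count_pos.1 (by omega)
    have h1 : β ∈ P.roots.erase β := by
      rw [← Multiset.count_pos, Multiset.count_erase_self]
      omega
    have := hdiff β hβ β h1
    simp at this
  refine ⟨P.roots.toFinset, ?_, fun β hβ => hroot β (Multiset.mem_toFinset.1 hβ),
    fun β hβ γ hγ hne => ?_, fun t => ?_⟩
  · rw [Multiset.toFinset_card_of_nodup hnodup, splits_iff_card_roots.1 hsplit, hnat]
  · exact hdiff β (Multiset.mem_toFinset.1 hβ) γ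
      ((Multiset.mem_erase_of_ne hne.symm).2 (Multiset.mem_toFinset.1 hγ))
  · have h1 := congrArg (eval t) hsplit.eq_prod_roots
    rw [hmonic.leadingCoeff, C_1, one_mul, eval_multiset_prod, Multiset.map_map, hev] at h1
    rw [← norm_neg, h1, Finset.prod, Multiset.toFinset_val, hnodup.dedup]
    have : ∀ s : Multiset ℂ_[p], ‖(s.map (eval t ∘ fun a => X - C a)).prod‖ =
        (s.map fun β => ‖t - β‖).prod := by
      intro s
      induction s using Multiset.induction_on with
      | empty => simp
      | cons a s ih => rw [Multiset.map_cons, Multiset.prod_cons, norm_mul, ih]; simp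
    exact this _

/-! ### `Ψ` on a critical circle -/

/-- The approximation of `Ψ` on the circle of radius `p ^ (i + 1)` by
`± (t ^ (q ^ i) - t ^ (q ^ (i + 1)))`, where `x = t / p ^ (i + 1)`. -/
def IsCircleSign (p q i : ℕ) [Fact p.Prime] (s : ℂ_[p]) : Prop :=
  (s = 1 ∨ s = -1) ∧ ∀ t : ℂ_[p], ‖t‖ ≤ 1 →
    ‖(p : ℂ_[p]) ^ geomSum q (i + 1) * psiFun p q (t / (p : ℂ_[p]) ^ (i + 1)) -
      s * (t ^ (q ^ i) - t ^ (q ^ (i + 1)))‖ ≤ (p : ℝ)⁻¹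

variable {f q i : ℕ} {s : ℂ_[p]}

theorem IsCircleSign.norm_eq (hs : IsCircleSign p q i s) : ‖s‖ = 1 := by
  rcases hs.1 with rfl | rfl <;> simp

theorem p_ne_zero : (p : ℂ_[p]) ≠ 0 := by exact_mod_cast hp.out.ne_zero

theorem norm_p_pow (k : ℕ) : ‖(p : ℂ_[p]) ^ k‖ = ((p : ℝ) ^ k)⁻¹ := by
  rw [norm_pow, norm_p, inv_pow]

/-- Around a point `β / p ^ (i + 1)` with `β - β ^ q = b`, the function `Ψ` minus the constant
`± b ^ (q ^ i) / p ^ b_{i + 1}` is close to a monomial of degree `q ^ i`, since `q`-th powers are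
additive modulo `p`. -/
theorem IsCircleSign.isNearMonomial (hf : 1 ≤ f) (hq : q = p ^ f) (hs : IsCircleSign p q i s)
    {b β w : ℂ_[p]} (hb : ‖b‖ ≤ 1) (hβ : ‖β‖ ≤ 1) (hβb : β - β ^ q = b) (hw : (p : ℝ)⁻¹ < ‖w‖ ^ q ^ i)
    (hw1 : ‖w‖ < 1) :
    IsNearMonomial (fun x => psiFun p q x - s * b ^ q ^ i / (p : ℂ_[p]) ^ geomSum q (i + 1))
      (β / (p : ℂ_[p]) ^ (i + 1)) 0 ‖w / (p : ℂ_[p]) ^ (i + 1)‖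
      (s * ((p : ℂ_[p]) ^ (i + 1)) ^ q ^ i / (p : ℂ_[p]) ^ geomSum q (i + 1)) (q ^ i)
      (max ‖w‖ ((p : ℝ)⁻¹ / ‖w‖ ^ q ^ i)) := by
  have hq2 := two_le_q hf hq
  have hpi : (0 : ℝ) < (p : ℝ)⁻¹ := inv_pos.2 p_pos
  have hQ : 0 < q ^ i := Nat.pow_pos (by omega)
  have hwQ : 0 < ‖w‖ ^ q ^ i := hpi.trans hw
  have hw0 : w ≠ 0 := fun h => by
    rw [h, norm_zero, zero_pow hQ.ne'] at hwQ
    exact lt_irrefl _ hwQ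
  have hwp : 0 < ‖w‖ := norm_pos_iff.2 hw0
  have hs0 : s ≠ 0 := norm_ne_zero_iff.1 (by rw [hs.norm_eq]; exact one_ne_zero)
  set c : ℂ_[p] := (p : ℂ_[p]) ^ (i + 1) with hc
  set N : ℂ_[p] := (p : ℂ_[p]) ^ geomSum q (i + 1) with hN
  have hc0 : c ≠ 0 := pow_ne_zero _ p_ne_zero
  have hN0 : N ≠ 0 := pow_ne_zero _ p_ne_zero
  have hcp := norm_pos_iff.2 hc0
  have hNp := norm_pos_iff.2 hN0
  refine ⟨?_, le_rfl, ⟨w / c, div_ne_zero hw0 hc0, rfl⟩,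
    div_ne_zero (mul_ne_zero hs0 (pow_ne_zero _ hc0)) hN0, hQ, by positivity,
    max_lt hw1 ((div_lt_one hwQ).2 hw), Or.inr ⟨rfl, fun x hx => ?_⟩⟩
  · refine (rigidOn_psiFun hq2 (r := max ‖w / c‖ ‖β / c‖) fun x hx => ?_).sub (ApproxOn.const _)
    rw [← sub_add_cancel x (β / c)]
    exact ultra_add_le (hx.2.trans (le_max_left _ _)) (le_max_right _ _)
  · set t := c * x with ht
    set δ := t - β with hδ
    have htx : t / c = x := by rw [ht]; field_simp
    have hxδ : x - β / c = δ / c := by rw [hδ, ht]; field_simp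
    have hδw : ‖δ‖ ≤ ‖w‖ := by
      have := hx.2
      rw [hxδ, norm_div, norm_div] at this
      exact (div_le_div_iff_of_pos_right hcp).1 this
    have hδ1 : ‖δ‖ ≤ 1 := hδw.trans hw1.le
    have hβδ : β + δ = t := by rw [hδ]; ring
    have ht1 : ‖t‖ ≤ 1 := hβδ ▸ ultra_add_le hβ hδ1
    have hβq : ‖β ^ q‖ ≤ 1 := by rw [norm_pow]; exact pow_le_one₀ (norm_nonneg _) hβ
    have e1 : q ^ i = p ^ (f * i) := by rw [hq, pow_mul]
    have e2 : q ^ (i + 1) = p ^ (f * (i + 1)) := by rw [hq, pow_mul]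
    have h1 := hs.2 t ht1
    have h2 := norm_add_pow_sub_le (f * i) hβ hδ1
    have h3 := norm_add_pow_sub_le (f * (i + 1)) hβ hδ1
    have h4 := norm_add_pow_sub_le (f * i) hβq hb
    rw [hβδ, ← e1] at h2
    rw [hβδ, ← e2] at h3
    rw [← e1, ← hβb, add_sub_cancel, hβb, ← pow_mul, ← pow_succ'] at h4
    rw [htx] at h1
    set E : ℝ := max ‖w‖ ((p : ℝ)⁻¹ / ‖w‖ ^ q ^ i) * ‖w‖ ^ q ^ i with hE
    have hpE : (p : ℝ)⁻¹ ≤ E := by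
      rw [hE, ← div_le_iff₀ hwQ]
      exact le_max_right _ _
    have hδE : ‖δ ^ q ^ (i + 1)‖ ≤ E := by
      rw [norm_pow]
      have : q ^ i + 1 ≤ q ^ (i + 1) := by
        rw [pow_succ]
        nlinarith
      calc ‖δ‖ ^ q ^ (i + 1) ≤ ‖δ‖ ^ (q ^ i + 1) := pow_le_pow_of_le_one (norm_nonneg _) hδ1 this
        _ ≤ ‖w‖ ^ (q ^ i + 1) := by gcongr
        _ = ‖w‖ * ‖w‖ ^ q ^ i := by rw [pow_succ']
        _ ≤ E := by
          rw [hE]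
          gcongr
          exact le_max_left _ _
    have hsn : ∀ y : ℂ_[p], ‖s * y‖ = ‖y‖ := fun y => by rw [norm_mul, hs.norm_eq, one_mul]
    have key : ‖N * psiFun p q x - s * b ^ q ^ i - s * δ ^ q ^ i‖ ≤ E := by
      have e : N * psiFun p q x - s * b ^ q ^ i - s * δ ^ q ^ i =
          (N * psiFun p q x - s * (t ^ q ^ i - t ^ q ^ (i + 1))) +
          s * (t ^ q ^ i - β ^ q ^ i - δ ^ q ^ i) -
          s * (t ^ q ^ (i + 1) - β ^ q ^ (i + 1) - δ ^ q ^ (i + 1)) - s * δ ^ q ^ (i + 1) +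
          s * (β ^ q ^ i - β ^ q ^ (i + 1) - b ^ q ^ i) := by ring
      rw [e]
      refine ultra_add_le (ultra_sub_le (ultra_sub_le (ultra_add_le (h1.trans hpE) ?_) ?_) ?_) ?_
      · rw [hsn]; exact h2.trans hpE
      · rw [hsn]; exact h3.trans hpE
      · rw [hsn]; exact hδE
      · rw [hsn]; exact h4.trans hpE
    have e3 : psiFun p q x - s * b ^ q ^ i / N - s * c ^ q ^ i / N * (x - β / c) ^ q ^ i =
        (N * psiFun p q x - s * b ^ q ^ i - s * δ ^ q ^ i) / N := by
      rw [hxδ, div_pow]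
      have := pow_ne_zero (q ^ i) hc0
      field_simp
    have e4 : max ‖w‖ ((p : ℝ)⁻¹ / ‖w‖ ^ q ^ i) * (‖s * c ^ q ^ i / N‖ * ‖w / c‖ ^ q ^ i) = E / ‖N‖ := by
      rw [norm_div, norm_mul, hs.norm_eq, one_mul, norm_pow, norm_div, div_pow, hE]
      field_simp
    rw [e3, e4, norm_div]
    gcongr

/-- If `Ψ` is close to `± b ^ (q ^ i) / p ^ b_{i + 1}` at `t / p ^ (i + 1)`, then `t` is close to a
solution of `t - t ^ q = b`. -/
theorem IsCircleSign.exists_root_near (hf : 1 ≤ f) (hq : q = p ^ f) (hs : IsCircleSign p q i s)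
    {b w : ℂ_[p]} (hb : ‖b‖ ≤ 1) (hw : (p : ℝ)⁻¹ < ‖w‖ ^ q ^ i) (hw1 : ‖w‖ < 1)
    {B : Finset ℂ_[p]} (hB : ∀ β ∈ B, ∀ γ ∈ B, β ≠ γ → ‖β - γ‖ = 1)
    (hBprod : ∀ t, ‖t - t ^ q - b‖ = ∏ β ∈ B, ‖t - β‖) {x : ℂ_[p]}
    (hx : ‖(p : ℂ_[p]) ^ (i + 1) * x‖ ≤ 1)
    (hΨ : ‖psiFun p q x - s * b ^ q ^ i / (p : ℂ_[p]) ^ geomSum q (i + 1)‖ ≤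
      ‖w ^ q ^ i / (p : ℂ_[p]) ^ geomSum q (i + 1)‖) :
    ∃ β ∈ B, ‖(p : ℂ_[p]) ^ (i + 1) * x - β‖ ≤ ‖w‖ := by
  have hq2 := two_le_q hf hq
  have hQ : 0 < q ^ i := Nat.pow_pos (by omega)
  set c : ℂ_[p] := (p : ℂ_[p]) ^ (i + 1) with hc
  set N : ℂ_[p] := (p : ℂ_[p]) ^ geomSum q (i + 1) with hN
  have hc0 : c ≠ 0 := pow_ne_zero _ p_ne_zero
  have hN0 : N ≠ 0 := pow_ne_zero _ p_ne_zero
  have hNp := norm_pos_iff.2 hN0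
  set t := c * x with ht
  have htx : t / c = x := by rw [ht]; field_simp
  set T := t - t ^ q - b with hT
  have htq : ‖t ^ q‖ ≤ 1 := by rw [norm_pow]; exact pow_le_one₀ (norm_nonneg _) hx
  have htqb : ‖t ^ q + b‖ ≤ 1 := ultra_add_le htq hb
  have hT1 : ‖T‖ ≤ 1 := ultra_sub_le (ultra_sub_le hx htq) hb
  have e1 : q ^ i = p ^ (f * i) := by rw [hq, pow_mul]
  have h1 := hs.2 t hx
  have h2 := norm_add_pow_sub_le (f * i) hT1 htqb
  have h3 := norm_add_pow_sub_le (f * i) htq hb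
  rw [show T + (t ^ q + b) = t by rw [hT]; ring, ← e1] at h2
  rw [← e1, ← pow_mul, ← pow_succ'] at h3
  rw [htx] at h1
  have h4 : ‖N * psiFun p q x - s * b ^ q ^ i‖ ≤ ‖w‖ ^ q ^ i := by
    have e : N * psiFun p q x - s * b ^ q ^ i = N * (psiFun p q x - s * b ^ q ^ i / N) := by
      field_simp
    rw [e, norm_mul]
    rw [norm_div, norm_pow, le_div_iff₀ hNp] at hΨ
    linarith
  have hsn : ∀ y : ℂ_[p], ‖s * y‖ = ‖y‖ := fun y => by rw [norm_mul, hs.norm_eq, one_mul]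
  have h5 : ‖s * T ^ q ^ i‖ ≤ ‖w‖ ^ q ^ i := by
    have e : s * T ^ q ^ i = (N * psiFun p q x - s * b ^ q ^ i) -
        (N * psiFun p q x - s * (t ^ q ^ i - t ^ q ^ (i + 1))) -
        s * (t ^ q ^ i - T ^ q ^ i - (t ^ q + b) ^ q ^ i) -
        s * ((t ^ q + b) ^ q ^ i - t ^ q ^ (i + 1) - b ^ q ^ i) := by ring
    rw [e]
    refine ultra_sub_le (ultra_sub_le (ultra_sub_le h4 (h1.trans hw.le)) ?_) ?_
    · rw [hsn]; exact h2.trans hw.le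
    · rw [hsn]; exact h3.trans hw.le
  rw [hsn, norm_pow] at h5
  have h6 : ‖T‖ ≤ ‖w‖ := le_of_pow_le_pow_left₀ hQ.ne' (norm_nonneg _) h5
  rw [hT, hBprod] at h6
  by_contra! hcon
  by_cases hnear : ∃ β ∈ B, ‖t - β‖ < 1
  · obtain ⟨β, hβ, hβ1⟩ := hnear
    have h7 : ∀ γ ∈ B, γ ≠ β → ‖t - γ‖ = 1 := by
      intro γ hγ hne
      rw [← hB β hβ γ hγ hne.symm]
      refine ultra_norm_eq_of_sub_lt ?_
      rw [sub_sub_sub_cancel_right, hB β hβ γ hγ hne.symm]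
      exact hβ1
    rw [Finset.prod_eq_single β h7 (fun h => absurd hβ h)] at h6
    exact absurd h6 (not_le.2 (hcon β hβ))
  · push Not at hnear
    have h7 : (1 : ℝ) ≤ ∏ β ∈ B, ‖t - β‖ := by
      have := Finset.prod_le_prod (s := B) (f := fun _ => (1 : ℝ)) (g := fun β => ‖t - β‖)
        (fun _ _ => zero_le_one) hnear
      simpa using this
    linarith

/-- The preimage in the circle of radius `p ^ (i + 1)` of a closed disc with centre
`± b ^ (q ^ i) / p ^ b_{i + 1}` is a disjoint union of discs, one around each solution of
`t - t ^ q = b` with `‖t‖ = 1`. -/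
theorem IsCircleSign.preimage_eq (hf : 1 ≤ f) (hq : q = p ^ f) (hs : IsCircleSign p q i s)
    {b w : ℂ_[p]} (hb : ‖b‖ ≤ 1) (hw : (p : ℝ)⁻¹ < ‖w‖ ^ q ^ i) (hw1 : ‖w‖ < 1)
    {B : Finset ℂ_[p]} (hBr : ∀ β ∈ B, β - β ^ q = b ∧ ‖β‖ ≤ 1)
    (hB : ∀ β ∈ B, ∀ γ ∈ B, β ≠ γ → ‖β - γ‖ = 1)
    (hBprod : ∀ t, ‖t - t ^ q - b‖ = ∏ β ∈ B, ‖t - β‖) {B' : Finset ℂ_[p]}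
    (hB' : ∀ β, β ∈ B' ↔ β ∈ B ∧ ‖β‖ = 1) :
    {x : ℂ_[p] | ‖x‖ = (p : ℝ) ^ (i + 1)} ∩
      (fun x => psiFun p q x - s * b ^ q ^ i / (p : ℂ_[p]) ^ geomSum q (i + 1)) ⁻¹'
        annulus 0 0 ‖w ^ q ^ i / (p : ℂ_[p]) ^ geomSum q (i + 1)‖ =
    ⋃ β : B', annulus ((β : ℂ_[p]) / (p : ℂ_[p]) ^ (i + 1)) 0 ‖w / (p : ℂ_[p]) ^ (i + 1)‖ := by
  have hq2 := two_le_q hf hq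
  have hc0 : (p : ℂ_[p]) ^ (i + 1) ≠ 0 := pow_ne_zero _ p_ne_zero
  have hcp := norm_pos_iff.2 hc0
  have hdist : ∀ β x : ℂ_[p], x ∈ annulus (β / (p : ℂ_[p]) ^ (i + 1)) 0 ‖w / (p : ℂ_[p]) ^ (i + 1)‖ ↔
      ‖(p : ℂ_[p]) ^ (i + 1) * x - β‖ ≤ ‖w‖ := by
    intro β x
    have e : x - β / (p : ℂ_[p]) ^ (i + 1) =
        ((p : ℂ_[p]) ^ (i + 1) * x - β) / (p : ℂ_[p]) ^ (i + 1) := by field_simp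
    simp only [annulus, Set.mem_ofPred_eq, norm_nonneg, true_and]
    rw [e, norm_div, norm_div, div_le_div_iff_of_pos_right hcp]
  have hcirc : ∀ x : ℂ_[p], ‖x‖ = (p : ℝ) ^ (i + 1) ↔ ‖(p : ℂ_[p]) ^ (i + 1) * x‖ = 1 := by
    intro x
    rw [norm_mul, norm_p_pow, inv_mul_eq_one₀ (pow_ne_zero _ p_pos.ne'), eq_comm]
  ext x
  simp only [Set.mem_inter_iff, Set.mem_ofPred_eq, Set.mem_preimage, Set.mem_iUnion, hcirc, hdist]
  constructor
  · rintro ⟨hx1, hx2⟩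
    obtain ⟨β, hβ, hxβ⟩ := hs.exists_root_near hf hq hb hw hw1 hB hBprod hx1.le
      (by simpa [annulus] using hx2)
    have hβ1 : ‖β‖ = 1 := by
      rw [← hx1]
      refine ultra_norm_eq_of_sub_lt ?_
      rw [norm_sub_rev, hx1]
      exact hxβ.trans_lt hw1
    exact ⟨⟨β, (hB' β).2 ⟨hβ, hβ1⟩⟩, hxβ⟩
  · rintro ⟨⟨β, hβ⟩, hxβ⟩
    obtain ⟨hβB, hβ1⟩ := (hB' β).1 hβ
    refine ⟨?_, ?_⟩
    · rw [← hβ1]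
      refine ultra_norm_eq_of_sub_lt ?_
      rw [hβ1]
      exact hxβ.trans_lt hw1
    · have H := hs.isNearMonomial hf hq hb hβ1.le (hBr β hβB).1 hw hw1
      have h1 := H.norm_le ((hdist β x).2 hxβ)
      simp only [annulus, Set.mem_ofPred_eq, norm_nonneg, true_and, sub_zero]
      refine h1.trans (le_of_eq ?_)
      rw [norm_div, norm_mul, hs.norm_eq, one_mul, norm_pow, norm_div, norm_div, norm_pow w,
        div_pow]
      field_simp

theorem IsCircleSign.target_eq (hq : 2 ≤ q) (hs : IsCircleSign p q i s) (w : ℂ_[p]) :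
    annulus (0 : ℂ_[p])
      (‖s * ((p : ℂ_[p]) ^ (i + 1)) ^ q ^ i / (p : ℂ_[p]) ^ geomSum q (i + 1)‖ * 0 ^ q ^ i)
      (‖s * ((p : ℂ_[p]) ^ (i + 1)) ^ q ^ i / (p : ℂ_[p]) ^ geomSum q (i + 1)‖ *
        ‖w / (p : ℂ_[p]) ^ (i + 1)‖ ^ q ^ i) =
    annulus 0 0 ‖w ^ q ^ i / (p : ℂ_[p]) ^ geomSum q (i + 1)‖ := by
  have hQ : 0 < q ^ i := Nat.pow_pos (by omega)
  have hcp := norm_pos_iff.2 (pow_ne_zero (i + 1) (p_ne_zero (p := p)))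
  rw [zero_pow hQ.ne', mul_zero, norm_div, norm_mul, hs.norm_eq, one_mul, norm_pow, norm_div,
    norm_div, norm_pow w, div_pow]
  congr 1
  field_simp

theorem IsCircleSign.hasFreeBasis (hf : 1 ≤ f) (hq : q = p ^ f) (hs : IsCircleSign p q i s)
    {b β w : ℂ_[p]} (hb : ‖b‖ ≤ 1) (hβ : ‖β‖ ≤ 1) (hβb : β - β ^ q = b) (hw : (p : ℝ)⁻¹ < ‖w‖ ^ q ^ i)
    (hw1 : ‖w‖ < 1) :
    HasFreeBasis (fun x => psiFun p q x - s * b ^ q ^ i / (p : ℂ_[p]) ^ geomSum q (i + 1))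
      (annulus (β / (p : ℂ_[p]) ^ (i + 1)) 0 ‖w / (p : ℂ_[p]) ^ (i + 1)‖)
      (annulus 0 0 ‖w ^ q ^ i / (p : ℂ_[p]) ^ geomSum q (i + 1)‖)
      (fun (j : Fin (q ^ i)) x => (x - β / (p : ℂ_[p]) ^ (i + 1)) ^ (j : ℕ)) := by
  rw [← hs.target_eq (two_le_q hf hq) w]
  exact (hs.isNearMonomial hf hq hb hβ hβb hw hw1).hasFreeBasis

/-- Over a closed disc with centre `± b ^ (q ^ i) / p ^ b_{i + 1}`, the fibres of `Ψ` in the circle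
have `q ^ i` points for each solution of `t - t ^ q = b` with `‖t‖ = 1`. -/
theorem IsCircleSign.hasFibreDegree (hf : 1 ≤ f) (hq : q = p ^ f) (hs : IsCircleSign p q i s)
    {b w : ℂ_[p]} (hb : ‖b‖ ≤ 1) (hw : (p : ℝ)⁻¹ < ‖w‖ ^ q ^ i) (hw1 : ‖w‖ < 1)
    {B : Finset ℂ_[p]} (hBr : ∀ β ∈ B, β - β ^ q = b ∧ ‖β‖ ≤ 1)
    (hB : ∀ β ∈ B, ∀ γ ∈ B, β ≠ γ → ‖β - γ‖ = 1)
    (hBprod : ∀ t, ‖t - t ^ q - b‖ = ∏ β ∈ B, ‖t - β‖) {B' : Finset ℂ_[p]}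
    (hB' : ∀ β, β ∈ B' ↔ β ∈ B ∧ ‖β‖ = 1) {a : ℂ_[p]}
    (ha : a ∈ annulus 0 0 ‖w ^ q ^ i / (p : ℂ_[p]) ^ geomSum q (i + 1)‖) :
    HasFibreDegree (psiFun p q) {x : ℂ_[p] | ‖x‖ = (p : ℝ) ^ (i + 1)}
      (s * b ^ q ^ i / (p : ℂ_[p]) ^ geomSum q (i + 1) + a) (B'.card * q ^ i) := by
  have hq2 := two_le_q hf hq
  have hc0 : (p : ℂ_[p]) ^ (i + 1) ≠ 0 := pow_ne_zero _ p_ne_zero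
  have hcp := norm_pos_iff.2 hc0
  have hQ : 0 < q ^ i := Nat.pow_pos (by omega)
  have hw0 : w ≠ 0 := fun h => by
    rw [h, norm_zero, zero_pow hQ.ne'] at hw
    exact absurd (inv_pos.2 (p_pos (p := p))) (not_lt.2 hw.le)
  refine HasFibreDegree.of_sub ?_
  have h1 : HasFibreDegree
      (fun x => psiFun p q x - s * b ^ q ^ i / (p : ℂ_[p]) ^ geomSum q (i + 1))
      (⋃ β : B', annulus ((β : ℂ_[p]) / (p : ℂ_[p]) ^ (i + 1)) 0 ‖w / (p : ℂ_[p]) ^ (i + 1)‖) a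
      (Fintype.card B' * q ^ i) := by
    refine HasFibreDegree.iUnion (fun β γ hβγ => ?_) fun β => ?_
    · rw [Set.disjoint_left]
      intro x hx hx'
      have h2 := ultra_sub_le hx'.2 hx.2
      rw [sub_sub_sub_cancel_left, ← sub_div, norm_div, norm_div,
        div_le_div_iff_of_pos_right hcp, hB _ ((hB' _).1 β.2).1 _ ((hB' _).1 γ.2).1
          (fun h => hβγ (Subtype.ext h))] at h2
      linarith
    · obtain ⟨hβB, hβ1⟩ := (hB' _).1 β.2
      exact (hs.hasFreeBasis hf hq hb hβ1.le (hBr _ hβB).1 hw hw1).exists_fibre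
        (div_ne_zero hw0 hc0) (div_ne_zero (pow_ne_zero _ hw0) (pow_ne_zero _ p_ne_zero))
        (fun x _ => (analyticAt_psiFun hq2 x).sub analyticAt_const) ha
  rw [Fintype.card_coe, ← hs.preimage_eq hf hq hb hw hw1 hBr hB hBprod hB'] at h1
  refine h1.congr fun x hx => ?_
  rw [Set.mem_inter_iff, Set.mem_preimage, hx]
  exact and_iff_left ha

end CoveringPsi

namespace CoveringPsi

open Polynomial Filter Topology

variable {p : ℕ} [hp : Fact p.Prime]

/-! ### Intervals of valuations -/

omit hp in
theorem rpow_neg_neg_natCast (k : ℕ) : (p : ℝ) ^ (-(-(k : ℝ))) = (p : ℝ) ^ k := by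
  rw [neg_neg, Real.rpow_natCast]

theorem shell_Ioi_neg (k : ℕ) :
    shell p (Set.Ioi ((-(k : ℝ) : ℝ) : EReal)) = {x | ‖x‖ < (p : ℝ) ^ k} := by
  ext x
  simp only [shell, Set.mem_ofPred_eq, Set.mem_Ioi, lt_vp_iff, rpow_neg_neg_natCast]

theorem shell_Ici_neg (k : ℕ) :
    shell p (Set.Ici ((-(k : ℝ) : ℝ) : EReal)) = {x | ‖x‖ ≤ (p : ℝ) ^ k} := by
  ext x
  simp only [shell, Set.mem_ofPred_eq, Set.mem_Ici, le_vp_iff, rpow_neg_neg_natCast]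

theorem shell_singleton_neg (k : ℕ) :
    shell p {((-(k : ℝ) : ℝ) : EReal)} = {x | ‖x‖ = (p : ℝ) ^ k} := by
  ext x
  simp only [shell, Set.mem_ofPred_eq, Set.mem_singleton_iff, le_antisymm_iff, le_vp_iff, vp_le_iff,
    rpow_neg_neg_natCast, and_comm]

theorem shell_Ioo_neg (k l : ℕ) :
    shell p (Set.Ioo ((-(k : ℝ) : ℝ) : EReal) ((-(l : ℝ) : ℝ) : EReal)) =
      {x | (p : ℝ) ^ l < ‖x‖ ∧ ‖x‖ < (p : ℝ) ^ k} := by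
  ext x
  simp only [shell, Set.mem_ofPred_eq, Set.mem_Ioo, lt_vp_iff, vp_lt_iff, rpow_neg_neg_natCast,
    and_comm]

theorem IsClosedRationalInterval.subset_Icc_top {K : Set EReal} (hK : IsClosedRationalInterval K)
    {lo hi : ℝ} (hlt : lo < hi) (h : K ⊆ Set.Ioi (lo : EReal)) :
    ∃ σ : ℚ, lo < σ ∧ (σ : ℝ) < hi ∧ K ⊆ Set.Icc ((σ : ℝ) : EReal) ⊤ := by
  obtain ⟨m, hm, hKm⟩ : ∃ m : ℝ, lo < m ∧ K ⊆ Set.Icc (m : EReal) ⊤ := by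
    obtain ⟨s, rfl | ⟨t, rfl⟩⟩ := hK
    · exact ⟨s, by exact_mod_cast Set.mem_Ioi.1 (h (Set.left_mem_Icc.2 le_top)), subset_rfl⟩
    · by_cases hst : ((s : ℝ) : EReal) ≤ ((t : ℝ) : EReal)
      · exact ⟨s, by exact_mod_cast Set.mem_Ioi.1 (h (Set.left_mem_Icc.2 hst)),
          Set.Icc_subset_Icc_right le_top⟩
      · exact ⟨hi, hlt, by rw [Set.Icc_eq_empty hst]; exact Set.empty_subset _⟩
  obtain ⟨σ, h1, h2⟩ := exists_rat_btwn (lt_min hm hlt)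
  refine ⟨σ, h1, h2.trans_le (min_le_right _ _), hKm.trans (Set.Icc_subset_Icc_left ?_)⟩
  exact_mod_cast (h2.trans_le (min_le_left _ _)).le

theorem IsClosedRationalInterval.subset_Icc {K : Set EReal} (hK : IsClosedRationalInterval K)
    {lo hi : ℝ} (hlt : lo < hi) (h : K ⊆ Set.Ioo (lo : EReal) (hi : EReal)) :
    ∃ σ τ : ℚ, lo < σ ∧ (σ : ℝ) ≤ τ ∧ (τ : ℝ) < hi ∧
      K ⊆ Set.Icc ((σ : ℝ) : EReal) ((τ : ℝ) : EReal) := by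
  obtain ⟨s, rfl | ⟨t, rfl⟩⟩ := hK
  · exact absurd (h (Set.right_mem_Icc.2 le_top)).2 not_top_lt
  · by_cases hst : ((s : ℝ) : EReal) ≤ ((t : ℝ) : EReal)
    · exact ⟨s, t, by exact_mod_cast (h (Set.left_mem_Icc.2 hst)).1, by exact_mod_cast hst,
        by exact_mod_cast (h (Set.right_mem_Icc.2 hst)).2, subset_rfl⟩
    · obtain ⟨σ, h1, h2⟩ := exists_rat_btwn hlt
      exact ⟨σ, σ, h1, le_rfl, h2, by rw [Set.Icc_eq_empty hst]; exact Set.empty_subset _⟩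

theorem isAffinoid_disc (ρ : ℚ) : IsAffinoid (annulus (0 : ℂ_[p]) 0 ((p : ℝ) ^ (-(ρ : ℝ)))) := by
  refine ⟨ρ, ∅, ∅, ?_⟩
  ext x
  simp [annulus, le_vp_iff]

theorem isAffinoid_annulus (ρ ρ' : ℚ) :
    IsAffinoid (annulus (0 : ℂ_[p]) ((p : ℝ) ^ (-(ρ' : ℝ))) ((p : ℝ) ^ (-(ρ : ℝ)))) := by
  refine ⟨ρ, ∅, {(X, ρ')}, ?_⟩
  ext x
  simp [annulus, le_vp_iff, vp_le_iff, and_comm]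

/-! ### `Ψ` between two critical radii -/

variable {f q i : ℕ}

theorem norm_psiCoeff_pow_succ (hf : 1 ≤ f) (hq : q = p ^ f) (i : ℕ) :
    ‖psiCoeff p q (q ^ i)‖ * ((p : ℝ) ^ (i + 1)) ^ q ^ i = (p : ℝ) ^ geomSum q (i + 1) := by
  rw [geomSum_succ, pow_add _ (geomSum q i), ← norm_psiCoeff_pow hf hq, ← pow_mul, add_mul,
    one_mul, pow_add, mul_assoc]

theorem norm_psiCoeff_pow' (hf : 1 ≤ f) (hq : q = p ^ f) (i : ℕ) :
    ‖psiCoeff p q (q ^ i)‖ * ((p : ℝ) ^ i) ^ q ^ i = (p : ℝ) ^ geomSum q i := by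
  rw [← pow_mul, norm_psiCoeff_pow hf hq]

theorem norm_psiCoeff_pos (hf : 1 ≤ f) (hq : q = p ^ f) (i : ℕ) :
    0 < ‖psiCoeff p q (q ^ i)‖ := by
  refine (norm_nonneg _).lt_of_ne fun h => ?_
  have h1 := norm_psiCoeff_pow hf hq i
  rw [← h, zero_mul] at h1
  exact (pow_pos (p_pos (p := p)) _).ne h1

theorem norm_psiCoeff_mul_le_iff (hf : 1 ≤ f) (hq : q = p ^ f) {r r' : ℝ} (hr : 0 ≤ r)
    (hr' : 0 ≤ r') :
    ‖psiCoeff p q (q ^ i)‖ * r ^ q ^ i ≤ ‖psiCoeff p q (q ^ i)‖ * r' ^ q ^ i ↔ r ≤ r' := by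
  have hQ : 0 < q ^ i := Nat.pow_pos (by have := two_le_q hf hq; omega)
  rw [mul_le_mul_iff_right₀ (norm_psiCoeff_pos hf hq i), pow_le_pow_iff_left₀ hr hr' hQ.ne']

theorem norm_psiCoeff_mul_lt_iff (hf : 1 ≤ f) (hq : q = p ^ f) {r r' : ℝ} (hr : 0 ≤ r)
    (hr' : 0 ≤ r') :
    ‖psiCoeff p q (q ^ i)‖ * r ^ q ^ i < ‖psiCoeff p q (q ^ i)‖ * r' ^ q ^ i ↔ r < r' := by
  rw [← not_le, norm_psiCoeff_mul_le_iff hf hq hr' hr, not_le]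

theorem eps_lt_one {r r' : ℝ} (h1 : (p : ℝ) ^ i < r) (h2 : r' < (p : ℝ) ^ (i + 1)) :
    max ((p : ℝ) ^ i / r) (r' / (p : ℝ) ^ (i + 1)) < 1 :=
  max_lt ((div_lt_one ((pow_pos p_pos _).trans h1)).2 h1) ((div_lt_one (pow_pos p_pos _)).2 h2)

/-- The slope of the Newton polygon: the maximum of `‖Ψ‖` on a disc with centre `0` and radius
strictly between `p ^ i` and `p ^ (i + 1)` comes from the term of degree `q ^ i`. -/
theorem norm_psiFun_eq (hf : 1 ≤ f) (hq : q = p ^ f) {x : ℂ_[p]} (h1 : (p : ℝ) ^ i < ‖x‖)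
    (h2 : ‖x‖ < (p : ℝ) ^ (i + 1)) :
    ‖psiFun p q x‖ = ‖psiCoeff p q (q ^ i)‖ * ‖x‖ ^ q ^ i := by
  have hx : 0 < ‖x‖ := (pow_pos p_pos _).trans h1
  rw [← norm_pow, ← norm_mul]
  refine ultra_norm_eq_of_sub_lt ((norm_psiFun_sub_le hf hq h1 h2 le_rfl).trans_lt ?_)
  rw [norm_mul, norm_pow]
  exact mul_lt_of_lt_one_left (mul_pos (norm_psiCoeff_pos hf hq i) (pow_pos hx _))
    (eps_lt_one h1 h2)

theorem norm_psiFun_le_iff (hf : 1 ≤ f) (hq : q = p ^ f) {r : ℝ} (h1 : (p : ℝ) ^ i < r)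
    {x : ℂ_[p]} (hx : ‖x‖ < (p : ℝ) ^ (i + 1)) :
    ‖psiFun p q x‖ ≤ ‖psiCoeff p q (q ^ i)‖ * r ^ q ^ i ↔ ‖x‖ ≤ r := by
  have hpi : (0 : ℝ) < (p : ℝ) ^ i := pow_pos p_pos _
  rcases le_or_gt ‖x‖ ((p : ℝ) ^ i) with h | h
  · refine iff_of_true ?_ (h.trans h1.le)
    refine (norm_psiFun_le (two_le_q hf hq) h).trans ?_
    rw [← norm_psiCoeff_pow' hf hq, norm_psiCoeff_mul_le_iff hf hq hpi.le (hpi.trans h1).le]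
    exact h1.le
  · rw [norm_psiFun_eq hf hq h hx, norm_psiCoeff_mul_le_iff hf hq (norm_nonneg _) (hpi.trans h1).le]

theorem le_norm_psiFun_iff (hf : 1 ≤ f) (hq : q = p ^ f) {r : ℝ} (h1 : (p : ℝ) ^ i < r)
    {x : ℂ_[p]} (hx : ‖x‖ < (p : ℝ) ^ (i + 1)) :
    ‖psiCoeff p q (q ^ i)‖ * r ^ q ^ i ≤ ‖psiFun p q x‖ ↔ r ≤ ‖x‖ := by
  have hpi : (0 : ℝ) < (p : ℝ) ^ i := pow_pos p_pos _
  rcases le_or_gt ‖x‖ ((p : ℝ) ^ i) with h | h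
  · refine iff_of_false (not_le.2 ?_) (not_le.2 (h.trans_lt h1))
    refine (norm_psiFun_le (two_le_q hf hq) h).trans_lt ?_
    rw [← norm_psiCoeff_pow' hf hq, norm_psiCoeff_mul_lt_iff hf hq hpi.le (hpi.trans h1).le]
    exact h1
  · rw [norm_psiFun_eq hf hq h hx, norm_psiCoeff_mul_le_iff hf hq (hpi.trans h1).le (norm_nonneg _)]

theorem norm_psiFun_lt (hf : 1 ≤ f) (hq : q = p ^ f) {x : ℂ_[p]} (hx : ‖x‖ < (p : ℝ) ^ (i + 1)) :
    ‖psiFun p q x‖ < (p : ℝ) ^ geomSum q (i + 1) := by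
  obtain ⟨r, hr1, hr2⟩ := exists_between (max_lt hx
    (pow_lt_pow_right₀ (one_lt_p (p := p)) (Nat.lt_succ_self i)))
  have hr0 := (pow_pos (p_pos (p := p)) i).trans_le ((le_max_right _ _).trans hr1.le)
  refine ((norm_psiFun_le_iff hf hq ((le_max_right _ _).trans_lt hr1) hx).2
    ((le_max_left _ _).trans hr1.le)).trans_lt ?_
  rwa [← norm_psiCoeff_pow_succ hf hq, norm_psiCoeff_mul_lt_iff hf hq hr0.le (pow_pos p_pos _).le]

/-- Rational exponents of radii in the target correspond to rational exponents in the source. -/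
theorem exists_radius (hf : 1 ≤ f) (hq : q = p ^ f) {σ : ℚ}
    (h1 : (p : ℝ) ^ geomSum q i < (p : ℝ) ^ (-(σ : ℝ)))
    (h2 : (p : ℝ) ^ (-(σ : ℝ)) < (p : ℝ) ^ geomSum q (i + 1)) :
    ∃ ρ : ℚ, ‖psiCoeff p q (q ^ i)‖ * ((p : ℝ) ^ (-(ρ : ℝ))) ^ q ^ i = (p : ℝ) ^ (-(σ : ℝ)) ∧
      (p : ℝ) ^ i < (p : ℝ) ^ (-(ρ : ℝ)) ∧ (p : ℝ) ^ (-(ρ : ℝ)) < (p : ℝ) ^ (i + 1) := by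
  have hQ : 0 < q ^ i := Nat.pow_pos (by have := two_le_q hf hq; omega)
  have hQ' : ((q ^ i : ℕ) : ℝ) ≠ 0 := by exact_mod_cast hQ.ne'
  have hpp := p_pos (p := p)
  have key : ‖psiCoeff p q (q ^ i)‖ *
      ((p : ℝ) ^ (-(((σ + geomSum q i - i * (q ^ i : ℕ)) / (q ^ i : ℕ) : ℚ) : ℝ))) ^ q ^ i =
      (p : ℝ) ^ (-(σ : ℝ)) := by
    have e := norm_psiCoeff_pow (p := p) hf hq i
    rw [← Real.rpow_natCast, ← Real.rpow_natCast] at e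
    have e' : ‖psiCoeff p q (q ^ i)‖ = (p : ℝ) ^ ((geomSum q i : ℝ) - ((i * q ^ i : ℕ) : ℝ)) := by
      rw [Real.rpow_sub hpp, ← e]
      have := (Real.rpow_pos_of_pos hpp ((i * q ^ i : ℕ) : ℝ)).ne'
      field_simp
    rw [e', ← Real.rpow_natCast _ (q ^ i), ← Real.rpow_mul hpp.le, ← Real.rpow_add hpp]
    congr 1
    push_cast at hQ' ⊢
    field_simp
    ring
  refine ⟨_, key, ?_, ?_⟩
  · rw [← key, ← norm_psiCoeff_pow' hf hq,
      norm_psiCoeff_mul_lt_iff hf hq (pow_pos hpp _).le (Real.rpow_pos_of_pos hpp _).le] at h1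
    exact h1
  · rw [← key, ← norm_psiCoeff_pow_succ hf hq,
      norm_psiCoeff_mul_lt_iff hf hq (Real.rpow_pos_of_pos hpp _).le (pow_pos hpp _).le] at h2
    exact h2

theorem isNearMonomial_disc (hf : 1 ≤ f) (hq : q = p ^ f) {ρ : ℚ}
    (h1 : (p : ℝ) ^ i < (p : ℝ) ^ (-(ρ : ℝ))) (h2 : (p : ℝ) ^ (-(ρ : ℝ)) < (p : ℝ) ^ (i + 1)) :
    IsNearMonomial (psiFun p q) 0 0 ((p : ℝ) ^ (-(ρ : ℝ))) (psiCoeff p q (q ^ i)) (q ^ i)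
      (max ((p : ℝ) ^ i / (p : ℝ) ^ (-(ρ : ℝ))) ((p : ℝ) ^ (-(ρ : ℝ)) / (p : ℝ) ^ (i + 1))) := by
  have hq2 := two_le_q hf hq
  refine ⟨rigidOn_psiFun hq2 fun x hx => by simpa using hx.2, le_rfl, exists_norm_eq_rpow ρ,
    norm_pos_iff.1 (norm_psiCoeff_pos hf hq i), Nat.pow_pos (by omega), lt_max_of_lt_left
      (div_pos (pow_pos p_pos _) (Real.rpow_pos_of_pos p_pos _)), eps_lt_one h1 h2,
    Or.inr ⟨rfl, fun x hx => ?_⟩⟩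
  rw [sub_zero]
  exact norm_psiFun_sub_le hf hq h1 h2 (by simpa using hx.2)

theorem isNearMonomial_annulus (hf : 1 ≤ f) (hq : q = p ^ f) {ρ : ℚ} {r : ℝ}
    (h1 : (p : ℝ) ^ i < r) (h2 : (p : ℝ) ^ (-(ρ : ℝ)) < (p : ℝ) ^ (i + 1)) :
    IsNearMonomial (psiFun p q) 0 r ((p : ℝ) ^ (-(ρ : ℝ))) (psiCoeff p q (q ^ i)) (q ^ i)
      (max ((p : ℝ) ^ i / r) ((p : ℝ) ^ (-(ρ : ℝ)) / (p : ℝ) ^ (i + 1))) := by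
  have hq2 := two_le_q hf hq
  have hr : 0 < r := (pow_pos p_pos _).trans h1
  refine ⟨rigidOn_psiFun hq2 fun x hx => by simpa using hx.2, hr.le, exists_norm_eq_rpow ρ,
    norm_pos_iff.1 (norm_psiCoeff_pos hf hq i), Nat.pow_pos (by omega), lt_max_of_lt_left
      (div_pos (pow_pos p_pos _) hr), eps_lt_one h1 h2,
    Or.inl ⟨hr, fun x hx => ?_⟩⟩
  have hx1 : r ≤ ‖x‖ := by simpa using hx.1
  have hx2 : ‖x‖ ≤ (p : ℝ) ^ (-(ρ : ℝ)) := by simpa using hx.2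
  rw [sub_zero, norm_mul, norm_pow]
  refine (norm_psiFun_sub_le hf hq (h1.trans_le hx1) (hx2.trans_lt h2) le_rfl).trans ?_
  gcongr

/-- Over a closed disc of radius between `p ^ b_i` and `p ^ b_{i + 1}`, functions have the power
basis of length `q ^ i`. -/
theorem hasFreeBasis_disc (hf : 1 ≤ f) (hq : q = p ^ f) {ρ σ : ℚ}
    (hρ : ‖psiCoeff p q (q ^ i)‖ * ((p : ℝ) ^ (-(ρ : ℝ))) ^ q ^ i = (p : ℝ) ^ (-(σ : ℝ)))
    (h1 : (p : ℝ) ^ i < (p : ℝ) ^ (-(ρ : ℝ))) (h2 : (p : ℝ) ^ (-(ρ : ℝ)) < (p : ℝ) ^ (i + 1)) :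
    HasFreeBasis (psiFun p q) (annulus 0 0 ((p : ℝ) ^ (-(ρ : ℝ))))
      (annulus 0 0 ((p : ℝ) ^ (-(σ : ℝ)))) (fun (j : Fin (q ^ i)) x => (x - 0) ^ (j : ℕ)) := by
  have H := (isNearMonomial_disc hf hq h1 h2).hasFreeBasis
  have hQ : 0 < q ^ i := Nat.pow_pos (by have := two_le_q hf hq; omega)
  rwa [zero_pow hQ.ne', mul_zero, hρ] at H

theorem preimage_disc (hf : 1 ≤ f) (hq : q = p ^ f) {ρ σ : ℚ}
    (hρ : ‖psiCoeff p q (q ^ i)‖ * ((p : ℝ) ^ (-(ρ : ℝ))) ^ q ^ i = (p : ℝ) ^ (-(σ : ℝ)))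
    (h1 : (p : ℝ) ^ i < (p : ℝ) ^ (-(ρ : ℝ))) (h2 : (p : ℝ) ^ (-(ρ : ℝ)) < (p : ℝ) ^ (i + 1)) :
    {x : ℂ_[p] | ‖x‖ < (p : ℝ) ^ (i + 1)} ∩ psiFun p q ⁻¹' annulus 0 0 ((p : ℝ) ^ (-(σ : ℝ))) =
      annulus 0 0 ((p : ℝ) ^ (-(ρ : ℝ))) := by
  ext x
  simp only [annulus, Set.mem_inter_iff, Set.mem_ofPred_eq, Set.mem_preimage, norm_nonneg, true_and,
    sub_zero]
  rw [← hρ]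
  exact ⟨fun h => (norm_psiFun_le_iff hf hq h1 h.1).1 h.2,
    fun h => ⟨h.trans_lt h2, (norm_psiFun_le_iff hf hq h1 (h.trans_lt h2)).2 h⟩⟩

theorem preimage_annulus (hf : 1 ≤ f) (hq : q = p ^ f) {ρ ρ' σ σ' : ℚ}
    (hρ : ‖psiCoeff p q (q ^ i)‖ * ((p : ℝ) ^ (-(ρ : ℝ))) ^ q ^ i = (p : ℝ) ^ (-(σ : ℝ)))
    (hρ' : ‖psiCoeff p q (q ^ i)‖ * ((p : ℝ) ^ (-(ρ' : ℝ))) ^ q ^ i = (p : ℝ) ^ (-(σ' : ℝ)))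
    (h1 : (p : ℝ) ^ i < (p : ℝ) ^ (-(ρ : ℝ))) (h2 : (p : ℝ) ^ (-(ρ : ℝ)) < (p : ℝ) ^ (i + 1))
    (h1' : (p : ℝ) ^ i < (p : ℝ) ^ (-(ρ' : ℝ))) :
    {x : ℂ_[p] | (p : ℝ) ^ i < ‖x‖ ∧ ‖x‖ < (p : ℝ) ^ (i + 1)} ∩
        psiFun p q ⁻¹' annulus 0 ((p : ℝ) ^ (-(σ' : ℝ))) ((p : ℝ) ^ (-(σ : ℝ))) =
      annulus 0 ((p : ℝ) ^ (-(ρ' : ℝ))) ((p : ℝ) ^ (-(ρ : ℝ))) := by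
  ext x
  simp only [annulus, Set.mem_inter_iff, Set.mem_ofPred_eq, Set.mem_preimage, sub_zero]
  rw [← hρ, ← hρ']
  refine ⟨fun h => ⟨(le_norm_psiFun_iff hf hq h1' h.1.2).1 h.2.1,
    (norm_psiFun_le_iff hf hq h1 h.1.2).1 h.2.2⟩, fun h => ?_⟩
  have hx := h.2.trans_lt h2
  exact ⟨⟨h1'.trans_le h.1, hx⟩, (le_norm_psiFun_iff hf hq h1' hx).2 h.1,
    (norm_psiFun_le_iff hf hq h1 hx).2 h.2⟩

theorem hasFibreDegree_disc (hf : 1 ≤ f) (hq : q = p ^ f) {a : ℂ_[p]}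
    (ha : ‖a‖ < (p : ℝ) ^ geomSum q (i + 1)) :
    HasFibreDegree (psiFun p q) {x : ℂ_[p] | ‖x‖ < (p : ℝ) ^ (i + 1)} a (q ^ i) := by
  have hb : geomSum q i < geomSum q (i + 1) := by
    rw [geomSum_succ]
    have : 0 < q ^ i := Nat.pow_pos (by have := two_le_q hf hq; omega)
    omega
  obtain ⟨σ, hσ1, hσ2⟩ := exists_rat_rpow_between (p := p)
    (max_lt ha (pow_lt_pow_right₀ (one_lt_p (p := p)) hb)) (pow_pos p_pos _)
  obtain ⟨ρ, hρ, h1, h2⟩ := exists_radius hf hq ((le_max_right _ _).trans_lt hσ1) hσ2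
  obtain ⟨w, hw0, hw⟩ := exists_norm_eq_rpow (p := p) ρ
  obtain ⟨w', hw0', hw'⟩ := exists_norm_eq_rpow (p := p) σ
  have H := hasFreeBasis_disc hf hq hρ h1 h2
  have haσ : a ∈ annulus 0 0 ((p : ℝ) ^ (-(σ : ℝ))) := by
    simpa [annulus] using (le_max_left _ _).trans hσ1.le
  have hpre := preimage_disc hf hq hρ h1 h2
  rw [← hw, ← hw'] at H hpre
  rw [← hw'] at haσ
  have H1 : HasFibreDegree (psiFun p q) (annulus 0 0 ‖w‖) a (q ^ i) :=
    H.exists_fibre hw0 hw0' (fun x _ => analyticAt_psiFun (two_le_q hf hq) x) haσ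
  rw [← hpre] at H1
  refine H1.congr fun x hx => ?_
  rw [Set.mem_inter_iff, Set.mem_preimage, hx]
  exact and_iff_left haσ

/-! ### Coverings of open discs and annuli -/

theorem geomSum_lt_succ (hq : 2 ≤ q) (i : ℕ) : geomSum q i < geomSum q (i + 1) := by
  rw [geomSum_succ]
  have : 0 < q ^ i := Nat.pow_pos (by omega)
  omega

theorem lt_rpow_neg_iff {k : ℕ} {σ : ℝ} : (p : ℝ) ^ k < (p : ℝ) ^ (-σ) ↔ σ < -(k : ℝ) := by
  rw [← Real.rpow_natCast, Real.rpow_lt_rpow_left_iff one_lt_p, lt_neg]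

theorem rpow_neg_lt_iff {k : ℕ} {σ : ℝ} : (p : ℝ) ^ (-σ) < (p : ℝ) ^ k ↔ -(k : ℝ) < σ := by
  rw [← Real.rpow_natCast, Real.rpow_lt_rpow_left_iff one_lt_p, neg_lt]

theorem isFiniteOfDegree_disc (hf : 1 ≤ f) (hq : q = p ^ f) (i : ℕ) :
    IsFiniteOfDegree (psiFun p q) {x : ℂ_[p] | ‖x‖ < (p : ℝ) ^ (i + 1)}
      (Set.Ioi ((-(geomSum q (i + 1) : ℝ) : ℝ) : EReal)) (q ^ i) where
  mapsTo x hx := by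
    rw [shell_Ioi_neg]
    exact norm_psiFun_lt hf hq hx
  finite K hK hKJ := by
    have hb : -(geomSum q (i + 1) : ℝ) < -(geomSum q i : ℝ) :=
      neg_lt_neg (by exact_mod_cast geomSum_lt_succ (two_le_q hf hq) i)
    obtain ⟨σ, hσ1, hσ2, hKσ⟩ := hK.subset_Icc_top hb hKJ
    obtain ⟨ρ, hρ, h1, h2⟩ := exists_radius (p := p) hf hq (lt_rpow_neg_iff.2 hσ2)
      (rpow_neg_lt_iff.2 hσ1)
    refine ⟨_, ⟨σ, Or.inl rfl⟩, hKσ, fun v hv => lt_of_lt_of_le (by exact_mod_cast hσ1) hv.1, ?_⟩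
    rw [shell_Icc_top, preimage_disc hf hq hρ h1 h2]
    exact ⟨isAffinoid_disc ρ, (hasFreeBasis_disc hf hq hρ h1 h2).isFreeOfRank (Fintype.card_fin _)⟩
  fibres a ha := by
    rw [shell_Ioi_neg] at ha
    exact hasFibreDegree_disc hf hq ha

theorem isFiniteOfDegree_annulus (hf : 1 ≤ f) (hq : q = p ^ f) (i : ℕ) :
    IsFiniteOfDegree (psiFun p q) {x : ℂ_[p] | (p : ℝ) ^ i < ‖x‖ ∧ ‖x‖ < (p : ℝ) ^ (i + 1)}
      (Set.Ioo ((-(geomSum q (i + 1) : ℝ) : ℝ) : EReal) ((-(geomSum q i : ℝ) : ℝ) : EReal))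
      (q ^ i) where
  mapsTo x hx := by
    rw [shell_Ioo_neg]
    refine ⟨?_, norm_psiFun_lt hf hq hx.2⟩
    rw [norm_psiFun_eq hf hq hx.1 hx.2, ← norm_psiCoeff_pow' hf hq,
      norm_psiCoeff_mul_lt_iff hf hq (pow_pos p_pos _).le (norm_nonneg _)]
    exact hx.1
  finite K hK hKJ := by
    have hQ : 0 < q ^ i := Nat.pow_pos (by have := two_le_q hf hq; omega)
    have hb : -(geomSum q (i + 1) : ℝ) < -(geomSum q i : ℝ) :=
      neg_lt_neg (by exact_mod_cast geomSum_lt_succ (two_le_q hf hq) i)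
    obtain ⟨σ, τ, hσ, hστ, hτ, hKσ⟩ := hK.subset_Icc hb hKJ
    obtain ⟨ρ, hρ, h1, h2⟩ := exists_radius (p := p) hf hq (lt_rpow_neg_iff.2 (hστ.trans_lt hτ))
      (rpow_neg_lt_iff.2 hσ)
    obtain ⟨ρ', hρ', h1', h2'⟩ := exists_radius (p := p) hf hq (lt_rpow_neg_iff.2 hτ)
      (rpow_neg_lt_iff.2 (hσ.trans_le hστ))
    refine ⟨_, ⟨σ, Or.inr ⟨τ, rfl⟩⟩, hKσ, fun v hv =>
      ⟨lt_of_lt_of_le (by exact_mod_cast hσ) hv.1, hv.2.trans_lt (by exact_mod_cast hτ)⟩, ?_⟩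
    rw [shell_Icc, preimage_annulus hf hq hρ hρ' h1 h2 h1']
    refine ⟨isAffinoid_annulus ρ ρ', ?_⟩
    have H := (isNearMonomial_annulus hf hq h1' h2).hasFreeBasis
    rw [hρ, hρ'] at H
    exact H.isFreeOfRank (Fintype.card_fin _)
  fibres a ha := by
    rw [shell_Ioo_neg] at ha
    refine (hasFibreDegree_disc hf hq ha.2).congr fun x hx => ⟨fun h => ⟨?_, h⟩, fun h => h.2⟩
    by_contra! hcon
    have := norm_psiFun_le (two_le_q hf hq) hcon
    rw [hx] at this
    exact absurd ha.1 (not_lt.2 this)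

/-- In degree `1` the covering of discs is an isomorphism: the inverse is the coefficient of the
coordinate function in the basis `{1}`. -/
theorem isAnalyticIso_psiFun (hf : 1 ≤ f) (hq : q = p ^ f) :
    IsAnalyticIso (psiFun p q) (Set.Ioi ((-((0 + 1 : ℕ) : ℝ) : ℝ) : EReal))
      (Set.Ioi ((-(geomSum q (0 + 1) : ℝ) : ℝ) : EReal)) := by
  have hq2 := two_le_q hf hq
  have hb : -(geomSum q (0 + 1) : ℝ) < -(geomSum q 0 : ℝ) :=
    neg_lt_neg (by exact_mod_cast geomSum_lt_succ hq2 0)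
  have hsurj : Set.SurjOn (psiFun p q) {x : ℂ_[p] | ‖x‖ < (p : ℝ) ^ (0 + 1)}
      {y : ℂ_[p] | ‖y‖ < (p : ℝ) ^ geomSum q (0 + 1)} := by
    intro a ha
    obtain ⟨S, hS, hd⟩ := hasFibreDegree_disc hf hq ha
    obtain ⟨x, hx⟩ : S.Nonempty := by
      rw [Finset.nonempty_iff_ne_empty]
      rintro rfl
      simp at hd
    exact ⟨x, (hS x).1 hx⟩
  have hinv : ∀ σ : ℚ, -(geomSum q (0 + 1) : ℝ) < σ → (σ : ℝ) < -(geomSum q 0 : ℝ) →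
      ∃ c : ℂ_[p] → ℂ_[p], RigidOn c (annulus 0 0 ((p : ℝ) ^ (-(σ : ℝ)))) ∧
        ∀ x : ℂ_[p], ‖x‖ < (p : ℝ) ^ (0 + 1) →
          psiFun p q x ∈ annulus (0 : ℂ_[p]) 0 ((p : ℝ) ^ (-(σ : ℝ))) → x = c (psiFun p q x) := by
    intro σ hσ1 hσ2
    obtain ⟨ρ, hρ, h1, h2⟩ := exists_radius (p := p) hf hq (lt_rpow_neg_iff.2 hσ2)
      (rpow_neg_lt_iff.2 hσ1)
    obtain ⟨c, hc, hc'⟩ := (hasFreeBasis_disc hf hq hρ h1 h2).span (fun x => x)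
      ((ApproxOn.poly X).congr fun x _ => by simp)
    refine ⟨c ⟨0, by simp⟩, hc _, fun x hx hx' => ?_⟩
    have h3 := hc' x ((preimage_disc hf hq hρ h1 h2).subset ⟨hx, hx'⟩)
    have : Subsingleton (Fin (q ^ 0)) := inferInstanceAs (Subsingleton (Fin 1))
    rw [Fintype.sum_subsingleton _ ⟨0, by simp⟩] at h3
    simpa using h3
  have hinj : Set.InjOn (psiFun p q) {x : ℂ_[p] | ‖x‖ < (p : ℝ) ^ (0 + 1)} := by
    intro x hx y hy hxy
    have h1 := norm_psiFun_lt hf hq hx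
    obtain ⟨σ, hσ1, hσ2⟩ := exists_rat_rpow_between (p := p)
      (max_lt h1 (pow_lt_pow_right₀ (one_lt_p (p := p)) (geomSum_lt_succ hq2 0))) (pow_pos p_pos _)
    obtain ⟨c, -, hc⟩ := hinv σ (rpow_neg_lt_iff.1 hσ2)
      (lt_rpow_neg_iff.1 ((le_max_right _ _).trans_lt hσ1))
    have h2 : psiFun p q x ∈ annulus (0 : ℂ_[p]) 0 ((p : ℝ) ^ (-(σ : ℝ))) := by
      simpa [annulus] using (le_max_left _ _).trans hσ1.le
    rw [hc x hx h2, hxy, ← hc y hy (hxy ▸ h2)]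
  refine ⟨fun K hK hKJ => isRigidOn_iff.2 (rigidOn_psiFun hq2 (r := (p : ℝ) ^ (0 + 1))
    fun x hx => ?_), Function.invFunOn (psiFun p q) {x : ℂ_[p] | ‖x‖ < (p : ℝ) ^ (0 + 1)},
    fun K hK hKJ => isRigidOn_iff.2 ?_, ?_, ?_, ?_, ?_⟩
  · have : x ∈ shell p (Set.Ioi ((-((0 + 1 : ℕ) : ℝ) : ℝ) : EReal)) := hKJ hx
    rw [shell_Ioi_neg] at this
    exact le_of_lt this
  · obtain ⟨σ, hσ1, hσ2, hKσ⟩ := hK.subset_Icc_top hb hKJ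
    obtain ⟨c, hc, hc'⟩ := hinv σ hσ1 hσ2
    have hsub : shell p K ⊆ annulus 0 0 ((p : ℝ) ^ (-(σ : ℝ))) := by
      rw [← shell_Icc_top]
      exact fun x hx => hKσ hx
    refine (hc.mono hsub).congr fun y hy => ?_
    have hy1 : y ∈ {y : ℂ_[p] | ‖y‖ < (p : ℝ) ^ geomSum q (0 + 1)} := by
      rw [← shell_Ioi_neg]
      exact hKJ hy
    have h1 := Function.invFunOn_mem (hsurj hy1)
    have h2 := Function.invFunOn_eq (hsurj hy1)
    rw [hc' _ h1 (by rw [h2]; exact hsub hy), h2]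
  all_goals rw [shell_Ioi_neg]
  · rw [shell_Ioi_neg]
    exact fun x hx => norm_psiFun_lt hf hq hx
  · rw [shell_Ioi_neg]
    exact fun y hy => Function.invFunOn_mem (hsurj hy)
  · exact hinj.leftInvOn_invFunOn
  · exact fun y hy => Function.invFunOn_eq (hsurj hy)

end CoveringPsi

namespace CoveringPsi

open Polynomial Filter Topology

variable {p : ℕ} [hp : Fact p.Prime] {f q i : ℕ} {s : ℂ_[p]}

/-! ### Coverings over the critical circles -/

theorem exists_isCircleSign (hf : 1 ≤ f) (hq : q = p ^ f) (i : ℕ) :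
    ∃ s : ℂ_[p], IsCircleSign p q i s :=
  exists_norm_psiFun_sub_le hf hq i

theorem exists_pow_eq_of_norm {d : ℕ} (hd : 0 < d) {v : ℂ_[p]} (h1 : (p : ℝ)⁻¹ < ‖v‖)
    (h2 : ‖v‖ < 1) : ∃ w : ℂ_[p], w ^ d = v ∧ (p : ℝ)⁻¹ < ‖w‖ ^ d ∧ ‖w‖ < 1 := by
  obtain ⟨w, rfl⟩ := IsAlgClosed.exists_pow_nat_eq v hd
  rw [norm_pow] at h1 h2
  exact ⟨w, rfl, h1, lt_of_not_ge fun h => absurd h2 (not_lt.2 (one_le_pow₀ h))⟩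

/-- The nonzero solutions of `t = t ^ q`. -/
theorem exists_unit_roots (hf : 1 ≤ f) (hq : q = p ^ f) :
    ∃ B B' : Finset ℂ_[p], (∀ β ∈ B, β - β ^ q = 0 ∧ ‖β‖ ≤ 1) ∧
      (∀ β ∈ B, ∀ γ ∈ B, β ≠ γ → ‖β - γ‖ = 1) ∧ (∀ t, ‖t - t ^ q - 0‖ = ∏ β ∈ B, ‖t - β‖) ∧
      (∀ β, β ∈ B' ↔ β ∈ B ∧ ‖β‖ = 1) ∧ B'.card = q - 1 := by
  classical
  have hq2 := two_le_q hf hq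
  obtain ⟨B, hcard, hBr, hB, hBprod⟩ := exists_roots hf hq (b := (0 : ℂ_[p])) (by simp)
  have h0 : (0 : ℂ_[p]) ∈ B := by
    have h := hBprod 0
    rw [zero_pow (by omega), sub_zero, sub_zero, norm_zero, eq_comm, Finset.prod_eq_zero_iff] at h
    obtain ⟨β, hβ, h⟩ := h
    rw [norm_eq_zero, sub_eq_zero] at h
    rwa [h]
  refine ⟨B, B.erase 0, hBr, hB, hBprod, fun β => ?_, by rw [Finset.card_erase_of_mem h0, hcard]⟩
  rw [Finset.mem_erase]
  refine ⟨fun h => ⟨h.2, by simpa using hB β h.2 0 h0 h.1⟩, fun h => ⟨?_, h.1⟩⟩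
  rintro rfl
  simp at h

theorem sub_circle_centre_zero (hq : 2 ≤ q) :
    (fun x => psiFun p q x - s * 0 ^ q ^ i / (p : ℂ_[p]) ^ geomSum q (i + 1)) = psiFun p q := by
  funext x
  rw [zero_pow (Nat.pow_pos (by omega)).ne', mul_zero, zero_div, sub_zero]

/-- The preimage of a closed disc in the circle of radius `p ^ k` is affinoid: replace `Ψ` by a
polynomial approximating it on the closed disc of radius `p ^ k`. -/
theorem isAffinoid_circle_preimage (hq : 2 ≤ q) (k : ℕ) (σ : ℚ) :
    IsAffinoid ({x : ℂ_[p] | ‖x‖ = (p : ℝ) ^ k} ∩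
      psiFun p q ⁻¹' annulus 0 0 ((p : ℝ) ^ (-(σ : ℝ)))) := by
  have hσ : 0 < (p : ℝ) ^ (-(σ : ℝ)) := Real.rpow_pos_of_pos p_pos _
  obtain ⟨P, hP⟩ := RigidOn.exists_poly (rigidOn_psiFun (p := p) hq (U := annulus 0 0 ((p : ℝ) ^ k))
    fun x hx => by simpa using hx.2) hσ
  refine ⟨-(k : ℚ), {(P, σ)}, {(X, -(k : ℚ))}, ?_⟩
  ext x
  have e : (((-(k : ℚ) : ℚ) : ℝ)) = -(k : ℝ) := by push_cast; rfl
  simp only [annulus, Set.mem_inter_iff, Set.mem_ofPred_eq, Set.mem_preimage, norm_nonneg, true_and,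
    sub_zero, Finset.mem_singleton, forall_eq, eval_X, e, le_vp_iff, vp_le_iff, rpow_neg_neg_natCast]
  have key : ‖x‖ ≤ (p : ℝ) ^ k →
      (‖psiFun p q x‖ ≤ (p : ℝ) ^ (-(σ : ℝ)) ↔ ‖P.eval x‖ ≤ (p : ℝ) ^ (-(σ : ℝ))) := by
    intro hx
    have h := (hP x (by simpa [annulus] using hx)).le
    constructor
    · intro h1
      rw [← sub_sub_cancel (psiFun p q x) (P.eval x)]
      exact ultra_sub_le h1 h
    · intro h1
      rw [← sub_add_cancel (psiFun p q x) (P.eval x)]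
      exact ultra_add_le h h1
  constructor
  · rintro ⟨h1, h2⟩
    exact ⟨h1.le, (key h1.le).1 h2, h1.ge⟩
  · rintro ⟨h1, h2, h3⟩
    exact ⟨le_antisymm h1 h3, (key h1).2 h2⟩

/-- Over a closed disc of radius close to `p ^ b_{i + 1}`, the part of the circle lying above it is a
union of `q - 1` disjoint discs, each of degree `q ^ i`. -/
theorem isFreeOfRank_circle (hf : 1 ≤ f) (hq : q = p ^ f) {v : ℂ_[p]} (h1 : (p : ℝ)⁻¹ < ‖v‖)
    (h2 : ‖v‖ < 1) :
    IsFreeOfRank (psiFun p q) ({x : ℂ_[p] | ‖x‖ = (p : ℝ) ^ (i + 1)} ∩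
      psiFun p q ⁻¹' annulus 0 0 ‖v / (p : ℂ_[p]) ^ geomSum q (i + 1)‖)
      (annulus 0 0 ‖v / (p : ℂ_[p]) ^ geomSum q (i + 1)‖) (q ^ (i + 1) - q ^ i) := by
  have hq2 := two_le_q hf hq
  have hQ : 0 < q ^ i := Nat.pow_pos (by omega)
  obtain ⟨s, hs⟩ := exists_isCircleSign (p := p) hf hq i
  obtain ⟨B, B', hBr, hB, hBprod, hB', hcard⟩ := exists_unit_roots (p := p) hf hq
  obtain ⟨w, rfl, hw, hw1⟩ := exists_pow_eq_of_norm hQ h1 h2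
  have hpk : (0 : ℝ) < (p : ℝ) ^ (i + 1) := pow_pos p_pos _
  have hr : ‖w / (p : ℂ_[p]) ^ (i + 1)‖ < (p : ℝ) ^ (i + 1) := by
    rw [norm_div, norm_p_pow, div_inv_eq_mul]
    exact mul_lt_of_lt_one_left hpk hw1
  obtain ⟨c, -, hc1, hc2⟩ := exists_norm_between (p := p) hr hpk
  have hpre := hs.preimage_eq hf hq (b := 0) (by simp) hw hw1 hBr hB hBprod hB'
  rw [sub_circle_centre_zero hq2] at hpre
  rw [hpre]
  have H := HasFreeBasis.iUnion (ι := B') (f := psiFun p q)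
    (β := fun β : B' => (β : ℂ_[p]) / (p : ℂ_[p]) ^ (i + 1))
    (V := annulus 0 0 ‖w ^ q ^ i / (p : ℂ_[p]) ^ geomSum q (i + 1)‖)
    (e := fun β (j : Fin (q ^ i)) x => (x - (β : ℂ_[p]) / (p : ℂ_[p]) ^ (i + 1)) ^ (j : ℕ))
    (norm_nonneg (w / (p : ℂ_[p]) ^ (i + 1))) hc1 hc2
    (fun β γ hβγ x hx => ?_) (fun β => ?_)
  · refine H.isFreeOfRank ?_
    simp only [Fintype.card_prod, Fintype.card_coe, Fintype.card_fin, hcard]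
    rw [pow_succ, Nat.sub_mul, one_mul, mul_comm]
  · have h3 : ‖(γ : ℂ_[p]) / (p : ℂ_[p]) ^ (i + 1) - (β : ℂ_[p]) / (p : ℂ_[p]) ^ (i + 1)‖ =
        (p : ℝ) ^ (i + 1) := by
      rw [← sub_div, norm_div, hB _ ((hB' _).1 γ.2).1 _ ((hB' _).1 β.2).1
        (fun h => hβγ (Subtype.ext h.symm)), norm_p_pow, one_div, inv_inv]
    refine le_of_eq ?_
    rw [← h3]
    refine (ultra_norm_eq_of_sub_lt ?_).symm
    rw [sub_sub_sub_cancel_right, h3]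
    exact hx.2.trans_lt hr
  · obtain ⟨hβB, hβ1⟩ := (hB' _).1 β.2
    have := hs.hasFreeBasis hf hq (b := 0) (by simp) hβ1.le (hBr _ hβB).1 hw hw1
    rwa [sub_circle_centre_zero hq2] at this

theorem hasFibreDegree_circle (hf : 1 ≤ f) (hq : q = p ^ f) {a : ℂ_[p]}
    (ha : ‖a‖ < (p : ℝ) ^ geomSum q (i + 1)) :
    HasFibreDegree (psiFun p q) {x : ℂ_[p] | ‖x‖ = (p : ℝ) ^ (i + 1)} a
      (q ^ (i + 1) - q ^ i) := by
  have hq2 := two_le_q hf hq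
  have hQ : 0 < q ^ i := Nat.pow_pos (by omega)
  have hN : (0 : ℝ) < (p : ℝ) ^ geomSum q (i + 1) := pow_pos p_pos _
  obtain ⟨s, hs⟩ := exists_isCircleSign (p := p) hf hq i
  obtain ⟨B, B', hBr, hB, hBprod, hB', hcard⟩ := exists_unit_roots (p := p) hf hq
  obtain ⟨v, -, h1, h2⟩ := exists_norm_between (p := p) (max_lt ((div_lt_one hN).2 ha)
    (inv_lt_one_of_one_lt₀ (one_lt_p (p := p)))) one_pos
  obtain ⟨w, rfl, hw, hw1⟩ := exists_pow_eq_of_norm hQ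
    ((le_max_right _ _).trans_lt h1) h2
  have haw : a ∈ annulus 0 0 ‖w ^ q ^ i / (p : ℂ_[p]) ^ geomSum q (i + 1)‖ := by
    refine ⟨norm_nonneg _, ?_⟩
    rw [sub_zero, norm_div, norm_p_pow, div_inv_eq_mul, ← div_le_iff₀ hN]
    exact (le_max_left _ _).trans h1.le
  have H := hs.hasFibreDegree hf hq (b := 0) (by simp) hw hw1 hBr hB hBprod hB' haw
  rwa [zero_pow hQ.ne', mul_zero, zero_div, zero_add, hcard, Nat.sub_mul,
    one_mul, ← pow_succ'] at H

theorem isFiniteOfDegree_circle (hf : 1 ≤ f) (hq : q = p ^ f) (i : ℕ) :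
    IsFiniteOfDegree (psiFun p q) ({x : ℂ_[p] | ‖x‖ = (p : ℝ) ^ (i + 1)} ∩
      psiFun p q ⁻¹' shell p (Set.Ioi ((-(geomSum q (i + 1) : ℝ) : ℝ) : EReal)))
      (Set.Ioi ((-(geomSum q (i + 1) : ℝ) : ℝ) : EReal)) (q ^ (i + 1) - q ^ i) where
  mapsTo x hx := hx.2
  finite K hK hKJ := by
    have hq2 := two_le_q hf hq
    obtain ⟨σ, hσ1, hσ2, hKσ⟩ := hK.subset_Icc_top
      (lt_add_one (-(geomSum q (i + 1) : ℝ))) hKJ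
    have hsub : Set.Icc ((σ : ℝ) : EReal) ⊤ ⊆
        Set.Ioi ((-(geomSum q (i + 1) : ℝ) : ℝ) : EReal) :=
      fun v hv => lt_of_lt_of_le (by exact_mod_cast hσ1) hv.1
    refine ⟨_, ⟨σ, Or.inl rfl⟩, hKσ, hsub, ?_⟩
    have e : {x : ℂ_[p] | ‖x‖ = (p : ℝ) ^ (i + 1)} ∩
        psiFun p q ⁻¹' shell p (Set.Ioi ((-(geomSum q (i + 1) : ℝ) : ℝ) : EReal)) ∩
        psiFun p q ⁻¹' shell p (Set.Icc ((σ : ℝ) : EReal) ⊤) =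
        {x : ℂ_[p] | ‖x‖ = (p : ℝ) ^ (i + 1)} ∩
        psiFun p q ⁻¹' shell p (Set.Icc ((σ : ℝ) : EReal) ⊤) := by
      rw [Set.inter_assoc]
      congr 1
      exact Set.inter_eq_right.2 fun x hx => hsub hx
    rw [e, shell_Icc_top]
    refine ⟨isAffinoid_circle_preimage hq2 _ σ, ?_⟩
    -- `0 < σ + b_{i + 1} < 1`, hence `p⁻¹ < ‖v‖ < 1`
    obtain ⟨v, -, hv⟩ := exists_norm_eq_rpow (p := p) (σ + geomSum q (i + 1))
    have hv' : ‖v / (p : ℂ_[p]) ^ geomSum q (i + 1)‖ = (p : ℝ) ^ (-(σ : ℝ)) := by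
      rw [norm_div, norm_p_pow, hv, div_inv_eq_mul, ← Real.rpow_natCast, ← Real.rpow_add p_pos]
      congr 1
      push_cast
      ring
    rw [← hv']
    refine isFreeOfRank_circle hf hq ?_ ?_
    · rw [hv, ← Real.rpow_neg_one, Real.rpow_lt_rpow_left_iff one_lt_p]
      push_cast
      linarith
    · rw [hv, Real.rpow_lt_one_iff_of_pos p_pos]
      refine Or.inl ⟨one_lt_p, ?_⟩
      push_cast
      linarith
  fibres a ha := by
    refine (hasFibreDegree_circle hf hq (by rwa [shell_Ioi_neg] at ha)).congr fun x hx => ?_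
    rw [Set.mem_inter_iff, Set.mem_preimage, hx]
    exact (and_iff_left ha).symm

/-- Over a point of the boundary, all `q` solutions of `t - t ^ q = b` have norm `1`. -/
theorem hasFibreDegree_boundary (hf : 1 ≤ f) (hq : q = p ^ f) {a : ℂ_[p]}
    (ha : ‖a‖ = (p : ℝ) ^ geomSum q (i + 1)) :
    HasFibreDegree (psiFun p q) {x : ℂ_[p] | ‖x‖ = (p : ℝ) ^ (i + 1)} a (q ^ (i + 1)) := by
  have hq2 := two_le_q hf hq
  have hQ : 0 < q ^ i := Nat.pow_pos (by omega)
  have hN : (0 : ℝ) < (p : ℝ) ^ geomSum q (i + 1) := pow_pos p_pos _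
  have hN0 : (p : ℂ_[p]) ^ geomSum q (i + 1) ≠ 0 := pow_ne_zero _ p_ne_zero
  obtain ⟨s, hs⟩ := exists_isCircleSign (p := p) hf hq i
  have hss : s * s = 1 := by rcases hs.1 with rfl | rfl <;> norm_num
  obtain ⟨b, hb⟩ := IsAlgClosed.exists_pow_nat_eq
    (s * (a * (p : ℂ_[p]) ^ geomSum q (i + 1))) hQ
  have hba : s * b ^ q ^ i / (p : ℂ_[p]) ^ geomSum q (i + 1) = a := by
    rw [hb, ← mul_assoc, hss, one_mul, mul_div_cancel_right₀ _ hN0]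
  have hb1 : ‖b‖ = 1 := by
    have h := congrArg norm hb
    rw [norm_pow, norm_mul, norm_mul, hs.norm_eq, one_mul, ha, norm_p_pow,
      mul_inv_cancel₀ hN.ne'] at h
    exact (pow_eq_one_iff_of_nonneg (norm_nonneg _) hQ.ne').1 h
  obtain ⟨B, hcard, hBr, hB, hBprod⟩ := exists_roots hf hq hb1.le
  have hB' : ∀ β, β ∈ B ↔ β ∈ B ∧ ‖β‖ = 1 := by
    refine fun β => ⟨fun h => ⟨h, (hBr β h).2.antisymm (not_lt.1 fun hlt => ?_)⟩, fun h => h.1⟩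
    have h1 : ‖β ^ q‖ < 1 := by
      rw [norm_pow]
      exact pow_lt_one₀ (norm_nonneg _) hlt (by omega)
    have h2 := ultra_sub_lt hlt h1
    rw [(hBr β h).1, hb1] at h2
    exact lt_irrefl _ h2
  obtain ⟨v, -, h1, h2⟩ := exists_norm_between (p := p)
    (inv_lt_one_of_one_lt₀ (one_lt_p (p := p))) one_pos
  obtain ⟨w, rfl, hw, hw1⟩ := exists_pow_eq_of_norm hQ h1 h2
  have H := hs.hasFibreDegree hf hq hb1.le hw hw1 hBr hB hBprod hB' (a := 0)
    ⟨norm_nonneg _, by rw [sub_zero, norm_zero]; exact norm_nonneg _⟩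
  rwa [hba, add_zero, hcard, ← pow_succ'] at H

end CoveringPsi

theorem mainTheorem6 (p : ℕ) [Fact p.Prime] (f : ℕ) (hf : 1 ≤ f) (q : ℕ) (hq : q = p ^ f) :
    -- the series converges everywhere
    (∀ x : ℂ_[p],
      Summable fun n : ℕ =>
        ((PowerSeries.coeff n (CoveringPsi.psi p q) : ℤ) : ℂ_[p]) * x ^ n) ∧
    -- isomorphism of the disc of valuation greater than -1 onto itself
    CoveringPsi.IsAnalyticIso (CoveringPsi.psiFun p q)
      (Set.Ioi (((-1 : ℝ)) : EReal)) (Set.Ioi (((-1 : ℝ)) : EReal)) ∧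
    ∀ i : ℕ,
      -- coverings of discs, of degree q ^ i
      CoveringPsi.IsFiniteOfDegree (CoveringPsi.psiFun p q)
        (CoveringPsi.shell p (Set.Ioi ((-(i : ℝ) - 1 : ℝ) : EReal)))
        (Set.Ioi (CoveringPsi.psiBound q (i + 1) : EReal)) (q ^ i) ∧
      -- finite maps of open annuli, of degree q ^ i
      CoveringPsi.IsFiniteOfDegree (CoveringPsi.psiFun p q)
        (CoveringPsi.shell p
          (Set.Ioo ((-((i : ℝ) + 1) : ℝ) : EReal) ((-(i : ℝ) : ℝ) : EReal)))
        (Set.Ioo (CoveringPsi.psiBound q (i + 1) : EReal) (CoveringPsi.psiBound q i : EReal))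
        (q ^ i) ∧
      -- the circle of valuation -i-1 goes to a closed disc
      Set.MapsTo (CoveringPsi.psiFun p q)
        (CoveringPsi.shell p {((-(i : ℝ) - 1 : ℝ) : EReal)})
        (CoveringPsi.shell p (Set.Ici (CoveringPsi.psiBound q (i + 1) : EReal))) ∧
      -- this map is finite of degree q ^ (i + 1) - q ^ i over the open disc
      CoveringPsi.IsFiniteOfDegree (CoveringPsi.psiFun p q)
        (CoveringPsi.shell p {((-(i : ℝ) - 1 : ℝ) : EReal)} ∩
          CoveringPsi.psiFun p q ⁻¹'
            CoveringPsi.shell p (Set.Ioi (CoveringPsi.psiBound q (i + 1) : EReal)))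
        (Set.Ioi (CoveringPsi.psiBound q (i + 1) : EReal)) (q ^ (i + 1) - q ^ i) ∧
      -- and every fibre over the boundary circle has q ^ (i + 1) points with multiplicity
      ∀ a ∈ CoveringPsi.shell p {(CoveringPsi.psiBound q (i + 1) : EReal)},
        CoveringPsi.HasFibreDegree (CoveringPsi.psiFun p q)
          (CoveringPsi.shell p {((-(i : ℝ) - 1 : ℝ) : EReal)}) a (q ^ (i + 1)) := by
  have hq2 := CoveringPsi.two_le_q hf hq
  have e : ∀ i : ℕ, -(i : ℝ) - 1 = -((i + 1 : ℕ) : ℝ) := fun i => by push_cast; ring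
  have e' : ∀ i : ℕ, -((i : ℝ) + 1) = -((i + 1 : ℕ) : ℝ) := fun i => by push_cast; ring
  refine ⟨CoveringPsi.summable_psi hq2, ?_, fun i => ?_⟩
  · have h := CoveringPsi.isAnalyticIso_psiFun hf hq
    simpa [CoveringPsi.geomSum] using h
  · rw [e, e', CoveringPsi.psiBound_eq hq2, CoveringPsi.psiBound_eq hq2,
      CoveringPsi.shell_Ioi_neg, CoveringPsi.shell_Ioo_neg, CoveringPsi.shell_singleton_neg,
      CoveringPsi.shell_singleton_neg, CoveringPsi.shell_Ici_neg]
    exact ⟨CoveringPsi.isFiniteOfDegree_disc hf hq i, CoveringPsi.isFiniteOfDegree_annulus hf hq i,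
      fun x hx => CoveringPsi.norm_psiFun_le hq2 (le_of_eq hx),
      CoveringPsi.isFiniteOfDegree_circle hf hq i,
      fun a ha => CoveringPsi.hasFibreDegree_boundary hf hq ha⟩
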